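/- For $k\ge 0$ let $f_k(x)=(\sqrt\pi\,2^k k!)^{-1/2}H_k(x)e^{-x^2/2}$, where $H_k(x)=(-1)^k e^{x^2}\frac{d^k}{dx^k}e^{-x^2}$, be the Hermite functions, and let $\Theta$ be the completion of $L^2(\mathbb R,\mathbb C)$ for the norm $\|f\|_\Theta^2=\sum_{k\ge0}\frac{|\langle f_k,f\rangle|^2}{1+k^2}$. For $f\in L^2(\mathbb R,\mathbb C)$ let $$\mathcal L_{\mathbb C}f(z)=\frac{e^{-z^2/2}}{\pi^{1/4}}\int_{\mathbb R}\overline{f(x)}\,e^{\sqrt2\,xz-x^2/2}\,dx,\qquad z\in\mathbb C,$$ be its Bargmann transform. Let $N_{\mathbb C}(0,1)$ be the law of $(X+iY)/\sqrt2$ with $X,Y$ independent real standard Gaussian variables. Let $(a_k)_{k\ge0}$ be i.i.d. $N_{\mathbb C}(0,1)$ variables, let $\xi=\sum_k a_kf_k$ (a series in $\Theta$) be the white noise associated with the Hermite basis, and, with $(\xi_k)_{k\ge0}$ i.i.d. $N_{\mathbb C}(0,1)$, let $$\mathsf{GAF}^{(1)}_{\mathbb C,1}(z)=\sum_{k\ge1}\xi_k\frac{\sqrt{k!}}{(k-1)!}\,z^k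 .$$ The random zeros of a random function $F$ on $\mathbb C$ are its zeros outside the set of points $z$ at which $F(z)=0$ almost surely. The first intensity of a random set of points $Z\subset\mathbb C$ is the measure $\rho$ with $\int\psi\,d\rho=\mathbb E\big[\sum_{x\in Z}\psi(x)\big]$ for every bounded compactly supported measurable $\psi:\mathbb C\to\mathbb R$. Then the series defining $\xi$ converges almost surely in $\Theta$; for every $z$ the map $f\mapsto\mathcal L_{\mathbb C}f(z)$ extends continuously to $\Theta$, the extended transform of every element of $\Theta$ being an entire function of $z$; and the critical points of $\mathcal L_{\mathbb C}\xi$, that is, the zeros of $\frac{d}{dz}\mathcal L_{\mathbb C}\xi$, almost surely form a locally finite set. Moreover: 1. The set of critical points of $\mathcal L_{\mathbb C}\xi$ has, as a point process, the same distribution as the set of random zeros of $\mathsf{GAF}^{(1)}_{\mathbb C,1}$. 2. Its first intensity is $$d\rho_1(z)=\frac1\pi\left(1+\frac1{(1+|z|^2)^2}\right)d^2z .$$ 3. Its distribution is characterized by $\rho_1$ among the zero sets of Gaussian analytic functions: if $G=\sum_{k\ge0}\zeta_k\Psi_k$ with $(\zeta_k)$ i.i.d. $N_{\mathbb C}(0,1)$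 and $\Psi_k$ entire functions such that $\sup_{z\in K}\sum_k|\Psi_k(z)|^2<\infty$ for every compact $K\subset\mathbb C$, and if the first intensity of the random zeros of $G$ is $\rho_1$, then the random zeros of $G$ have the same distribution as the critical points of $\mathcal L_{\mathbb C}\xi$. -/

import Mathlib

open MeasureTheory ProbabilityTheory Filter Topology

namespace BargmannNoise

noncomputable section

/-! ### Hermite polynomials and Hermite functions -/

/-- The `n`-th (physicists') Hermite polynomial
`H_n(x) = (-1)^n e^{x^2} (d^n/dx^n) e^{-x^2}`. -/
def hermiteH (n : ℕ) (x : ℝ) : ℝ :=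
  (-1) ^ n * Real.exp (x ^ 2) * iteratedDeriv n (fun y : ℝ => Real.exp (-y ^ 2)) x

/-- The `n`-th Hermite function
`f_n(x) = H_n(x) e^{-x^2/2} / (√π 2^n n!)^{1/2}`. -/
def hermiteFun (n : ℕ) (x : ℝ) : ℝ :=
  hermiteH n x * Real.exp (-x ^ 2 / 2) / √(√Real.pi * 2 ^ n * (n.factorial : ℝ))

/-- Auxiliary: the Hermite polynomials as elements of `ℝ[X]`. -/
def hermitePoly : ℕ → Polynomial ℝ
  | 0 => 1
  | n + 1 => 2 * Polynomial.X * hermitePoly n - Polynomial.derivative (hermitePoly n)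

theorem hermitePoly_succ (n : ℕ) : hermitePoly (n + 1) =
    2 * Polynomial.X * hermitePoly n - Polynomial.derivative (hermitePoly n) := rfl

theorem hasDerivAt_gauss (x : ℝ) :
    HasDerivAt (fun y : ℝ => Real.exp (-y ^ 2)) (-(2 * x) * Real.exp (-x ^ 2)) x := by
  have h1 : HasDerivAt (fun y : ℝ => -y ^ 2) (-(2 * x)) x := by
    simpa using (hasDerivAt_pow 2 x).fun_neg
  simpa only [mul_comm] using h1.exp

theorem hasDerivAt_poly_gauss (p : Polynomial ℝ) (x : ℝ) :
    HasDerivAt (fun y : ℝ => p.eval y * Real.exp (-y ^ 2))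
      ((p.derivative - 2 * Polynomial.X * p).eval x * Real.exp (-x ^ 2)) x := by
  refine ((p.hasDerivAt x).fun_mul (hasDerivAt_gauss x)).congr_deriv ?_
  simp only [Polynomial.eval_sub, Polynomial.eval_mul, Polynomial.eval_X, Polynomial.eval_ofNat]
  ring

theorem iteratedDeriv_gauss (n : ℕ) :
    iteratedDeriv n (fun y : ℝ => Real.exp (-y ^ 2)) =
      fun x => (-1) ^ n * ((hermitePoly n).eval x * Real.exp (-x ^ 2)) := by
  induction n with
  | zero => funext x; simp [hermitePoly]
  | succ n ih =>
    funext x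
    rw [iteratedDeriv_succ, ih, deriv_const_mul_field, (hasDerivAt_poly_gauss _ x).deriv,
      hermitePoly_succ]
    simp
    ring

theorem hermiteH_eq_eval (n : ℕ) (x : ℝ) : hermiteH n x = (hermitePoly n).eval x := by
  rw [hermiteH, iteratedDeriv_gauss]
  have h1 : ((-1 : ℝ) ^ n) * (-1) ^ n = 1 := by rw [← mul_pow]; simp
  have h2 : Real.exp (x ^ 2) * Real.exp (-x ^ 2) = 1 := by rw [← Real.exp_add]; simp
  calc _ = ((-1 : ℝ) ^ n * (-1) ^ n) * (Real.exp (x ^ 2) * Real.exp (-x ^ 2)) *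
        (hermitePoly n).eval x := by ring
    _ = _ := by rw [h1, h2]; ring

theorem derivative_hermitePoly (n : ℕ) :
    Polynomial.derivative (hermitePoly (n + 1)) = 2 * ((n : Polynomial ℝ) + 1) * hermitePoly n := by
  induction n with
  | zero => simp [hermitePoly, Polynomial.derivative_mul]
  | succ n ih =>
    rw [hermitePoly_succ (n + 1), Polynomial.derivative_sub, ih, Polynomial.derivative_mul, ih]
    have h : Polynomial.derivative (2 * ((n : Polynomial ℝ) + 1) * hermitePoly n) =
        2 * ((n : Polynomial ℝ) + 1) * Polynomial.derivative (hermitePoly n) := by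
      simp [Polynomial.derivative_mul]
    rw [h]
    simp only [Polynomial.derivative_mul, Polynomial.derivative_X, Polynomial.derivative_ofNat]
    push_cast
    rw [hermitePoly_succ n]
    ring

theorem integrable_poly_gauss (p : Polynomial ℝ) :
    Integrable (fun x : ℝ => p.eval x * Real.exp (-x ^ 2)) := by
  induction p using Polynomial.induction_on' with
  | add p q hp hq =>
    refine (hp.add hq).congr (ae_of_all _ fun x => ?_)
    simp [add_mul]
  | monomial n a =>
    have h := (integrable_rpow_mul_exp_neg_mul_sq (b := 1) one_pos (s := n)
      (by have : (0 : ℝ) ≤ n := n.cast_nonneg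
          linarith)).const_mul a
    refine h.congr (ae_of_all _ fun x => ?_)
    simp [Real.rpow_natCast, mul_assoc]

theorem integral_hermitePoly_sq (n : ℕ) :
    ∫ x : ℝ, (hermitePoly n * hermitePoly n).eval x * Real.exp (-x ^ 2) =
      √Real.pi * 2 ^ n * (n.factorial : ℝ) := by
  induction n with
  | zero => simpa [hermitePoly] using integral_gaussian 1
  | succ n ih =>
    have key := integral_mul_deriv_eq_deriv_mul_of_integrable
      (u := fun x => (hermitePoly (n + 1)).eval x)
      (v := fun x => (hermitePoly n).eval x * Real.exp (-x ^ 2))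
      (u' := fun x => (Polynomial.derivative (hermitePoly (n + 1))).eval x)
      (v' := fun x => ((Polynomial.derivative (hermitePoly n) -
        2 * Polynomial.X * hermitePoly n).eval x * Real.exp (-x ^ 2)))
      (fun x _ => (hermitePoly (n + 1)).hasDerivAt x)
      (fun x _ => hasDerivAt_poly_gauss _ x)
      ((integrable_poly_gauss (hermitePoly (n + 1) * (Polynomial.derivative (hermitePoly n) -
        2 * Polynomial.X * hermitePoly n))).congr
          (ae_of_all _ fun x => by simp only [Polynomial.eval_mul, Pi.mul_apply]; ring))
      ((integrable_poly_gauss (Polynomial.derivative (hermitePoly (n + 1)) * hermitePoly n)).congr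
          (ae_of_all _ fun x => by simp only [Polynomial.eval_mul, Pi.mul_apply]; ring))
      ((integrable_poly_gauss (hermitePoly (n + 1) * hermitePoly n)).congr
          (ae_of_all _ fun x => by simp only [Polynomial.eval_mul, Pi.mul_apply]; ring))
    have e1 : ∀ x : ℝ, (hermitePoly (n + 1) * hermitePoly (n + 1)).eval x * Real.exp (-x ^ 2) =
        -((hermitePoly (n + 1)).eval x * (((Polynomial.derivative (hermitePoly n) -
        2 * Polynomial.X * hermitePoly n).eval x * Real.exp (-x ^ 2)))) := by
      intro x
      have : Polynomial.derivative (hermitePoly n) - 2 * Polynomial.X * hermitePoly n =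
        -hermitePoly (n + 1) := by rw [hermitePoly_succ]; ring
      rw [this]
      simp
      ring
    have e2 : ∀ x : ℝ, (Polynomial.derivative (hermitePoly (n + 1))).eval x *
        ((hermitePoly n).eval x * Real.exp (-x ^ 2)) =
        (2 * ((n : ℝ) + 1)) * ((hermitePoly n * hermitePoly n).eval x * Real.exp (-x ^ 2)) := by
      intro x
      rw [derivative_hermitePoly]
      simp
      ring
    simp_rw [e1]
    rw [integral_neg, key, neg_neg]
    simp_rw [e2]
    rw [integral_const_mul, ih, Nat.factorial_succ]
    push_cast
    ring

theorem hermiteFun_sq (n : ℕ) (x : ℝ) : hermiteFun n x ^ 2 =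
    (√Real.pi * 2 ^ n * (n.factorial : ℝ))⁻¹ *
      ((hermitePoly n * hermitePoly n).eval x * Real.exp (-x ^ 2)) := by
  have h : Real.exp (-x ^ 2 / 2) ^ 2 = Real.exp (-x ^ 2) := by
    rw [← Real.exp_nat_mul]; congr 1; push_cast; ring
  rw [hermiteFun, hermiteH_eq_eval, div_pow, mul_pow, h, Real.sq_sqrt (by positivity)]
  simp only [Polynomial.eval_mul]
  ring

theorem integral_hermiteFun_sq (n : ℕ) : ∫ x : ℝ, hermiteFun n x ^ 2 = 1 := by
  simp_rw [hermiteFun_sq]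
  rw [integral_const_mul, integral_hermitePoly_sq]
  exact inv_mul_cancel₀ (by positivity)

theorem continuous_hermiteFun (n : ℕ) : Continuous (hermiteFun n) := by
  have : hermiteFun n = fun x => (hermitePoly n).eval x * Real.exp (-x ^ 2 / 2) /
      √(√Real.pi * 2 ^ n * (n.factorial : ℝ)) := by
    funext x; rw [hermiteFun, hermiteH_eq_eval]
  rw [this]
  fun_prop

theorem memLp_hermiteFun (n : ℕ) :
    MemLp (fun x : ℝ => (hermiteFun n x : ℂ)) 2 (volume : Measure ℝ) := by
  have h : MemLp (hermiteFun n) 2 (volume : Measure ℝ) := by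
    rw [memLp_two_iff_integrable_sq (continuous_hermiteFun n).aestronglyMeasurable]
    simp_rw [hermiteFun_sq]
    exact (integrable_poly_gauss _).const_mul _
  exact h.ofReal

/-- The Hilbert space `L²(ℝ, ℂ)`. -/
abbrev Signal : Type := Lp ℂ 2 (volume : Measure ℝ)

/-- The `n`-th Hermite function as an element of `L²(ℝ, ℂ)`. -/
def hermiteL2 (n : ℕ) : Signal := (memLp_hermiteFun n).toLp _

theorem norm_hermiteL2 (n : ℕ) : ‖hermiteL2 n‖ = 1 := by
  have h : inner ℂ (hermiteL2 n) (hermiteL2 n) = (1 : ℂ) := by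
    rw [L2.inner_def, ← Complex.ofReal_one, ← integral_hermiteFun_sq n, ← integral_complex_ofReal]
    refine integral_congr_ae ?_
    filter_upwards [(memLp_hermiteFun n).coeFn_toLp] with x hx
    rw [hermiteL2, hx, RCLike.inner_apply, Complex.conj_ofReal, sq]
    push_cast
    rfl
  have h2 : ‖hermiteL2 n‖ ^ 2 = 1 := by
    rw [← inner_self_eq_norm_sq (𝕜 := ℂ), h]
    simp
  nlinarith [norm_nonneg (hermiteL2 n)]

/-! ### The space carrying the white noise -/

/-- The completion `Θ` of `L²(ℝ, ℂ)` for the norm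
`‖f‖_Θ² = ∑_k |⟨f_k, f⟩|² / (1 + k²)`, realised as `ℓ²(ℕ, ℂ)` through the coordinates
`⟨f_k, f⟩ / √(1 + k²)`; see `toTheta` for the inclusion. -/
abbrev Theta : Type := lp (fun _ : ℕ => ℂ) 2

theorem memℓp_thetaCoord (f : Signal) :
    Memℓp (fun k : ℕ => inner ℂ (hermiteL2 k) f / ((√(1 + (k : ℝ) ^ 2) : ℝ) : ℂ)) 2 := by
  apply memℓp_gen
  have hs' : Summable (fun k : ℕ => ‖f‖ ^ 2 * (1 / ((k + 1 : ℕ) : ℝ) ^ 2 * 2)) :=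
    (((summable_nat_add_iff 1).mpr
      (Real.summable_one_div_nat_pow.mpr (one_lt_two))).mul_right 2).mul_left _
  refine Summable.of_nonneg_of_le (fun k => by positivity) (fun k => ?_) hs'
  have hin : ‖inner ℂ (hermiteL2 k) f‖ ≤ ‖f‖ := by
    simpa [norm_hermiteL2] using norm_inner_le_norm (𝕜 := ℂ) (hermiteL2 k) f
  have hsq : √(1 + (k : ℝ) ^ 2) ^ 2 = 1 + (k : ℝ) ^ 2 := Real.sq_sqrt (by positivity)
  simp only [ENNReal.toReal_ofNat, Real.rpow_ofNat]
  rw [norm_div, div_pow, Complex.norm_real, Real.norm_of_nonneg (Real.sqrt_nonneg _), hsq,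
    div_eq_mul_inv]
  refine mul_le_mul (by gcongr) ?_ (by positivity) (by positivity)
  rw [inv_le_iff_one_le_mul₀ (by positivity)]
  push_cast
  rw [one_div, mul_assoc, inv_mul_eq_div, le_div_iff₀ (by positivity)]
  nlinarith [sq_nonneg ((k : ℝ) - 1)]

/-- The inclusion of `L²(ℝ, ℂ)` into its completion `Θ`. -/
def toTheta (f : Signal) : Theta :=
  ⟨fun k => inner ℂ (hermiteL2 k) f / ((√(1 + (k : ℝ) ^ 2) : ℝ) : ℂ), memℓp_thetaCoord f⟩

/-! ### The Bargmann transform -/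

/-- The Bargmann transform of `f ∈ L²(ℝ, ℂ)`:
`π^{-1/4} e^{-z²/2} ∫ conj (f x) e^{√2 x z - x²/2} dx`. -/
def bargmann (f : Signal) (z : ℂ) : ℂ :=
  Complex.exp (-z ^ 2 / 2) / ((Real.pi ^ (1 / 4 : ℝ) : ℝ) : ℂ) *
    ∫ x : ℝ, (starRingEnd ℂ) (f x) *
      Complex.exp (((√2 : ℝ) : ℂ) * (x : ℂ) * z - (x : ℂ) ^ 2 / 2)

/-- The extension by continuity of the Bargmann transform from `L²(ℝ, ℂ)` to `Θ`: the value at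
`θ` is the limit of `bargmann f z` as `f ∈ L²(ℝ, ℂ)` tends to `θ` in `Θ`. -/
def bargmannTheta (θ : Theta) (z : ℂ) : ℂ :=
  limUnder (comap toTheta (𝓝 θ)) (fun f : Signal => bargmann f z)

/-! ### Complex Gaussian sequences, white noise, Gaussian analytic functions -/

/-- The law `N_ℂ(0,1)` of `(X + i Y) / √2` with `X, Y` independent real standard Gaussians. -/
def stdComplexGaussian : Measure ℂ :=
  ((gaussianReal 0 1).prod (gaussianReal 0 1)).map
    (fun p : ℝ × ℝ => ((p.1 : ℂ) + (p.2 : ℂ) * Complex.I) / ((√2 : ℝ) : ℂ))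

/-- `a 0, a 1, …` are i.i.d. `N_ℂ(0,1)` random variables. -/
structure IsIIDStdComplexGaussian {Ω : Type*} [MeasurableSpace Ω] (a : ℕ → Ω → ℂ)
    (P : Measure Ω) : Prop where
  hasLaw : ∀ k, HasLaw (a k) stdComplexGaussian P
  indep : iIndepFun a P

/-- The white noise `ξ = ∑_k a_k f_k` associated with the Hermite basis, the series being taken
in `Θ`. -/
def whiteNoise {Ω : Type*} (a : ℕ → Ω → ℂ) (ω : Ω) : Theta :=
  ∑' k, a k ω • toTheta (hermiteL2 k)

/-- The random series `∑_k a_k Ψ_k(z)`. -/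
def gaf {Ω : Type*} (Ψ : ℕ → ℂ → ℂ) (a : ℕ → Ω → ℂ) (ω : Ω) (z : ℂ) : ℂ :=
  limUnder atTop (fun n : ℕ => ∑ k ∈ Finset.range n, a k ω * Ψ k z)

/-- The condition on the coefficient functions of a Gaussian analytic function on `ℂ`: they are
entire, and `sup_{z ∈ K} ∑_k |Ψ_k(z)|² < ∞` for every compact `K`. -/
def IsGAFCoeff (Ψ : ℕ → ℂ → ℂ) : Prop :=
  (∀ k, Differentiable ℂ (Ψ k)) ∧
    ∀ K : Set ℂ, IsCompact K →
      ∃ C : ℝ, ∀ z ∈ K, Summable (fun k => ‖Ψ k z‖ ^ 2) ∧ ∑' k, ‖Ψ k z‖ ^ 2 ≤ C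

/-- The coefficient functions `√k! / (k - N)! z^k` for `k ≥ N` (and `0` for `k < N`)
of the `N`-th planar Gaussian analytic function. -/
def planarCoeff (N k : ℕ) (z : ℂ) : ℂ :=
  if N ≤ k then (((√(k.factorial : ℝ)) / ((k - N).factorial : ℝ) : ℝ) : ℂ) * z ^ k else 0

/-! ### Zeros, critical points, point processes -/

/-- The random zeros of the random function `F`: its zeros, without the points at which `F`
vanishes almost surely. -/
def randomZeros {Ω : Type*} [MeasurableSpace Ω] (P : Measure Ω) (F : Ω → ℂ → ℂ) (ω : Ω) : Set ℂ :=
  {z | F ω z = 0 ∧ ¬ ∀ᵐ ω' ∂P, F ω' z = 0}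

/-- The critical points of a function on `ℂ`. -/
def criticalPoints (g : ℂ → ℂ) : Set ℂ := {z | deriv g z = 0}

/-- The counting measure `∑_{x ∈ S} δ_x` of a set of points. The law of a random point
configuration is the law of this random measure. -/
def pointMeasure (S : Set ℂ) : Measure ℂ := Measure.sum (fun x : S => Measure.dirac (x : ℂ))

/-- `ρ` is the first intensity of the random set of points `Z`: for every bounded compactly
supported measurable `ψ`, `∫ ψ dρ = E [∑_{x ∈ Z} ψ x]`. -/
def IsFirstIntensity {Ω : Type*} [MeasurableSpace Ω] (P : Measure Ω) (Z : Ω → Set ℂ)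
    (ρ : Measure ℂ) : Prop :=
  ∀ ψ : ℂ → ℝ, Measurable ψ → (∃ C : ℝ, ∀ z, |ψ z| ≤ C) → HasCompactSupport ψ →
    Integrable (fun ω => ∑' x : Z ω, ψ x) P ∧
      ∫ z, ψ z ∂ρ = ∫ ω, (∑' x : Z ω, ψ x) ∂P

/-- The measure `(1/π) (1 + 1/(1+|z|²)²) d²z` on `ℂ`. -/
def criticalIntensity : Measure ℂ :=
  (volume : Measure ℂ).withDensity
    (fun z => ENNReal.ofReal (1 / Real.pi * (1 + 1 / (1 + ‖z‖ ^ 2) ^ 2)))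

end

end BargmannNoise

open BargmannNoise

namespace BargmannNoise

/-! By the generating function of the Hermite polynomials, the Bargmann kernel is `∑ z^k/√k! ·
f_k(x)`, so the transform sends `f_k` to `z^k/√k!` and, being conjugate linear, sends the white
noise to `∑ conj(a_k) z^k/√k!`. The conjugates are again i.i.d. standard complex Gaussians. Hence
the critical points are the zeros of the Gaussian analytic function with coefficient functions
`criticalCoeff`. Multiplying these by `z` gives `planarCoeff 1`, and a deterministic entire factor
only adds zeros that are almost sure, hence not random (`ae_seqZeros_mul`). This is the equality of
laws.

For the intensity, let `K` be the covariance kernel. The value at `z` has the law of `√K(z,z)` times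
a standard Gaussian, so `E log|F(z)| = ½ log K(z,z) + const`. Taking expectations in Jensen's
formula gives the integral of `log⁺(R/|z - c|)` against the mean zero measure: it is the circle
average of `½ log K(z,z)` minus its value at `c` (`lintegral_log_meanZeros`). Jensen counts
multiplicities and the point measure does not, so simplicity of the zeros is needed. It follows from
Sard's theorem applied to one coefficient with the others frozen (`ae_deriv_seqGaf_ne_zero`). As `R
→ 0` these potentials determine the measure (`eq_withDensity_of_potential`). For `K(z,z) = (1 +
|z|²) e^{|z|²}` a second order expansion gives the stated density.

The characterization is Calabi rigidity. If two Gaussian analytic functions have the same first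
intensity, Jensen's formula gives the mean value property for `½ log K₁(z,z) - ½ log K₂(z,z)` on
small circles inside the region where neither variance vanishes. This function is real analytic
there, hence harmonic, hence locally the real part of a holomorphic `h`, and polarization gives
`K₁(z,u) = g(z) conj(g(u)) K₂(z,u)` with `g = e^h`. Eliminating `g` by cross-multiplication with a
base point `w` yields an identity that extends to all of `ℂ²` (`gafKernel_identity`). It says that
`K₂(·,w)√K₁(w,w)` times the first function and `K₁(·,w)√K₂(w,w)` times the second have the same
kernel, hence the same law. Neither factor changes the random zeros. -/

/-! ### Orthogonality of the Hermite functions and the Bargmann transform on `Θ`. -/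

/-- Integration by parts, since `(H_n e^{-x²})' = -H_{n+1} e^{-x²}`. -/
theorem integral_hermitePoly_succ_mul (n : ℕ) (q : Polynomial ℝ) :
    ∫ x : ℝ, (hermitePoly (n + 1) * q).eval x * Real.exp (-x ^ 2) =
      ∫ x : ℝ, (hermitePoly n * Polynomial.derivative q).eval x * Real.exp (-x ^ 2) := by
  have key := integral_mul_deriv_eq_deriv_mul_of_integrable
    (u := fun x => q.eval x)
    (v := fun x => (hermitePoly n).eval x * Real.exp (-x ^ 2))
    (u' := fun x => (Polynomial.derivative q).eval x)
    (v' := fun x => ((Polynomial.derivative (hermitePoly n) -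
      2 * Polynomial.X * hermitePoly n).eval x * Real.exp (-x ^ 2)))
    (fun x _ => q.hasDerivAt x)
    (fun x _ => hasDerivAt_poly_gauss _ x)
    ((integrable_poly_gauss (q * (Polynomial.derivative (hermitePoly n) -
      2 * Polynomial.X * hermitePoly n))).congr
        (ae_of_all _ fun x => by simp only [Polynomial.eval_mul, Pi.mul_apply]; ring))
    ((integrable_poly_gauss (Polynomial.derivative q * hermitePoly n)).congr
        (ae_of_all _ fun x => by simp only [Polynomial.eval_mul, Pi.mul_apply]; ring))
    ((integrable_poly_gauss (q * hermitePoly n)).congr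
        (ae_of_all _ fun x => by simp only [Polynomial.eval_mul, Pi.mul_apply]; ring))
  have e : Polynomial.derivative (hermitePoly n) - 2 * Polynomial.X * hermitePoly n =
      -hermitePoly (n + 1) := by rw [hermitePoly_succ]; ring
  rw [e] at key
  have e1 : ∀ x : ℝ, (hermitePoly (n + 1) * q).eval x * Real.exp (-x ^ 2) =
      -(q.eval x * ((-hermitePoly (n + 1)).eval x * Real.exp (-x ^ 2))) := by
    intro x; simp; ring
  simp_rw [e1]
  rw [integral_neg, key, neg_neg]
  refine integral_congr_ae (ae_of_all _ fun x => ?_)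
  simp; ring

/-- Each integration by parts lowers both indices by one, until the derivative falls on `H_0 = 1`.
-/
theorem integral_hermitePoly_mul_of_ne {m n : ℕ} (h : m ≠ n) :
    ∫ x : ℝ, (hermitePoly m * hermitePoly n).eval x * Real.exp (-x ^ 2) = 0 := by
  induction m generalizing n with
  | zero =>
    obtain ⟨n, rfl⟩ := Nat.exists_eq_succ_of_ne_zero h.symm
    rw [mul_comm, Nat.succ_eq_add_one, integral_hermitePoly_succ_mul]
    simp [hermitePoly]
  | succ m ih =>
    cases n with
    | zero => rw [integral_hermitePoly_succ_mul]; simp [hermitePoly]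
    | succ n =>
      rw [integral_hermitePoly_succ_mul, derivative_hermitePoly]
      have : ∀ x : ℝ, (hermitePoly m * (2 * ((n : Polynomial ℝ) + 1) * hermitePoly n)).eval x *
          Real.exp (-x ^ 2) = (2 * ((n : ℝ) + 1)) *
            ((hermitePoly m * hermitePoly n).eval x * Real.exp (-x ^ 2)) := by
        intro x; simp; ring
      simp_rw [this]
      rw [integral_const_mul, ih (by omega), mul_zero]

theorem integral_hermiteFun_mul_of_ne {m n : ℕ} (h : m ≠ n) :
    ∫ x : ℝ, hermiteFun m x * hermiteFun n x = 0 := by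
  have e : ∀ x : ℝ, hermiteFun m x * hermiteFun n x =
      ((√(√Real.pi * 2 ^ m * (m.factorial : ℝ)))⁻¹ * (√(√Real.pi * 2 ^ n * (n.factorial : ℝ)))⁻¹) *
        ((hermitePoly m * hermitePoly n).eval x * Real.exp (-x ^ 2)) := by
    intro x
    have h : Real.exp (-x ^ 2) = Real.exp (-x ^ 2 / 2) * Real.exp (-x ^ 2 / 2) := by
      rw [← Real.exp_add]; congr 1; ring
    rw [hermiteFun, hermiteFun, hermiteH_eq_eval, hermiteH_eq_eval, h, Polynomial.eval_mul]
    ring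
  simp_rw [e]
  rw [integral_const_mul, integral_hermitePoly_mul_of_ne h, mul_zero]

theorem inner_hermiteL2_of_ne {m n : ℕ} (h : m ≠ n) :
    inner ℂ (hermiteL2 m) (hermiteL2 n) = (0 : ℂ) := by
  rw [L2.inner_def, ← Complex.ofReal_zero, ← integral_hermiteFun_mul_of_ne h,
    ← integral_complex_ofReal]
  refine integral_congr_ae ?_
  filter_upwards [(memLp_hermiteFun n).coeFn_toLp, (memLp_hermiteFun m).coeFn_toLp] with x hx hy
  rw [hermiteL2, hermiteL2, hx, hy, RCLike.inner_apply, Complex.conj_ofReal]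
  push_cast
  ring

theorem inner_hermiteL2 (m n : ℕ) :
    inner ℂ (hermiteL2 m) (hermiteL2 n) = if m = n then (1 : ℂ) else 0 := by
  split_ifs with h
  · subst h
    rw [inner_self_eq_norm_sq_to_K, norm_hermiteL2]
    simp
  · exact inner_hermiteL2_of_ne h

/-- Differentiation in `t` acts on the polynomial factor by `p ↦ 2Xp - p'`, the recursion defining
`hermitePoly`. Iterating from `p = 1` makes `H_n(x)` the `n`-th Taylor coefficient, up to `n!`, of
`e^{2xt - t²}` at `t = 0`. -/
theorem hasDerivAt_hermite_generating (p : Polynomial ℝ) (x : ℝ) (t : ℂ) :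
    HasDerivAt (fun t : ℂ => (p.map (algebraMap ℝ ℂ)).eval ((x : ℂ) - t) *
        Complex.exp (2 * x * t - t ^ 2))
      (((2 * Polynomial.X * p - Polynomial.derivative p).map (algebraMap ℝ ℂ)).eval ((x : ℂ) - t) *
        Complex.exp (2 * x * t - t ^ 2)) t := by
  have h1 : HasDerivAt (fun t : ℂ => (x : ℂ) - t) (-1) t := by
    simpa using (hasDerivAt_id t).const_sub (x : ℂ)
  have h2 := ((p.map (algebraMap ℝ ℂ)).hasDerivAt ((x : ℂ) - t)).comp t h1
  have h3 : HasDerivAt (fun t : ℂ => 2 * (x : ℂ) * t - t ^ 2) (2 * (x : ℂ) - 2 * t) t := by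
    simpa using ((hasDerivAt_id t).const_mul (2 * (x : ℂ))).fun_sub (hasDerivAt_pow 2 t)
  refine (h2.mul h3.cexp).congr_deriv ?_
  simp only [Function.comp_apply, Polynomial.map_sub, Polynomial.map_mul, Polynomial.map_ofNat,
    Polynomial.map_X, Polynomial.derivative_map, Polynomial.eval_sub, Polynomial.eval_mul,
    Polynomial.eval_ofNat, Polynomial.eval_X]
  ring

theorem iteratedDeriv_hermite_generating (x : ℝ) (n : ℕ) :
    iteratedDeriv n (fun t : ℂ => Complex.exp (2 * x * t - t ^ 2)) =
      fun t => ((hermitePoly n).map (algebraMap ℝ ℂ)).eval ((x : ℂ) - t) *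
        Complex.exp (2 * x * t - t ^ 2) := by
  induction n with
  | zero => funext t; simp [hermitePoly]
  | succ n ih =>
    funext t
    rw [iteratedDeriv_succ, ih, (hasDerivAt_hermite_generating _ x t).deriv, hermitePoly_succ]

theorem hasSum_hermite_generating (x : ℝ) (t : ℂ) :
    HasSum (fun n : ℕ => t ^ n / n.factorial * (hermiteH n x : ℂ))
      (Complex.exp (2 * x * t - t ^ 2)) := by
  have hd : Differentiable ℂ (fun t : ℂ => Complex.exp (2 * x * t - t ^ 2)) := by fun_prop
  refine (Complex.hasSum_taylorSeries_of_entire hd 0 t).congr_fun fun n => ?_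
  rw [iteratedDeriv_hermite_generating, hermiteH_eq_eval]
  simp only [sub_zero, smul_eq_mul, mul_zero]
  rw [← Complex.coe_algebraMap, Polynomial.eval_map_algebraMap, Polynomial.aeval_algebraMap_apply]
  simp
  ring

/-- The kernel of the Bargmann transform. -/
noncomputable def bargmannKernel (z : ℂ) (x : ℝ) : ℂ :=
  Complex.exp (-z ^ 2 / 2) / ((Real.pi ^ (1 / 4 : ℝ) : ℝ) : ℂ) *
    Complex.exp (((√2 : ℝ) : ℂ) * (x : ℂ) * z - (x : ℂ) ^ 2 / 2)

theorem bargmann_eq_integral (f : Signal) (z : ℂ) :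
    bargmann f z = ∫ x : ℝ, (starRingEnd ℂ) (f x) * bargmannKernel z x := by
  rw [bargmann, ← integral_const_mul]
  congr 1
  funext x
  rw [bargmannKernel]
  ring

/-- The function `z^k / √k!`. -/
noncomputable def fockBasis (k : ℕ) (z : ℂ) : ℂ := z ^ k / ((√(k.factorial : ℝ) : ℝ) : ℂ)

theorem norm_fockBasis (k : ℕ) (z : ℂ) : ‖fockBasis k z‖ = ‖z‖ ^ k / √(k.factorial : ℝ) := by
  rw [fockBasis, norm_div, norm_pow, Complex.norm_real, Real.norm_of_nonneg (Real.sqrt_nonneg _)]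

/-- The Hermite generating function at `t = z/√2`, multiplied by `e^{-x²/2}/π^{1/4}`. -/
theorem hasSum_fockBasis_mul_hermiteFun (z : ℂ) (x : ℝ) :
    HasSum (fun k => fockBasis k z * (hermiteFun k x : ℂ)) (bargmannKernel z x) := by
  have h2 : ((√2 : ℝ) : ℂ) ^ 2 = 2 := by
    rw [← Complex.ofReal_pow, Real.sq_sqrt (by norm_num)]; simp
  have h20 : ((√2 : ℝ) : ℂ) ≠ 0 := by
    simp
  have hpi : ((√(√Real.pi) : ℝ) : ℂ) ≠ 0 := by
    simp [Real.sqrt_ne_zero', Real.pi_pos]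
  have hp4 : Real.pi ^ (1 / 4 : ℝ) = √(√Real.pi) := by
    rw [Real.sqrt_eq_rpow, Real.sqrt_eq_rpow, ← Real.rpow_mul Real.pi_pos.le]; norm_num
  have h := (hasSum_hermite_generating x (z / ((√2 : ℝ) : ℂ))).mul_left
    (Complex.exp (-(x : ℂ) ^ 2 / 2) / ((√(√Real.pi) : ℝ) : ℂ))
  have e : (Complex.exp (-(x : ℂ) ^ 2 / 2) / ((√(√Real.pi) : ℝ) : ℂ)) *
      Complex.exp (2 * x * (z / ((√2 : ℝ) : ℂ)) - (z / ((√2 : ℝ) : ℂ)) ^ 2) =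
      bargmannKernel z x := by
    rw [bargmannKernel, hp4, div_mul_eq_mul_div, div_mul_eq_mul_div, ← Complex.exp_add,
      ← Complex.exp_add]
    congr 2
    rw [div_pow, h2]
    field_simp
    linear_combination (-(2 * z * x)) * h2
  rw [e] at h
  refine h.congr_fun fun k => ?_
  rw [fockBasis, hermiteFun, Real.sqrt_mul (by positivity), Real.sqrt_mul (by positivity), div_pow]
  have hk : ((√(k.factorial : ℝ) : ℝ) : ℂ) * ((√(k.factorial : ℝ) : ℝ) : ℂ) = k.factorial := by
    rw [← Complex.ofReal_mul, Real.mul_self_sqrt (by positivity)]; simp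
  have hk0 : ((√(k.factorial : ℝ) : ℝ) : ℂ) ≠ 0 := by
    simp [Nat.factorial_ne_zero]
  have h2k : √((2 : ℝ) ^ k) = √2 ^ k := by
    rw [Real.sqrt_eq_iff_mul_self_eq (by positivity) (by positivity), ← mul_pow,
      Real.mul_self_sqrt (by norm_num)]
  rw [h2k, ← hk]
  push_cast
  field_simp

theorem summable_pow_div_sqrt_factorial (r : ℝ) :
    Summable (fun k : ℕ => r ^ k / √(k.factorial : ℝ)) := by
  refine Summable.of_norm_bounded
    -- Comparison with a geometric series: `(4r²)^k/k! ≤ e^{4r²}`, and the square root leaves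
    -- `2^{-k}`.
    (g := fun k : ℕ => √(Real.exp (4 * r ^ 2)) * (1 / 2 : ℝ) ^ k)
    ((summable_geometric_of_lt_one (by norm_num) (by norm_num)).mul_left _) fun k => ?_
  have h : (4 * r ^ 2) ^ k / (k.factorial : ℝ) ≤ Real.exp (4 * r ^ 2) :=
    Real.pow_div_factorial_le_exp _ (by positivity) k
  have h2 := Real.sqrt_le_sqrt h
  rw [Real.sqrt_div (by positivity)] at h2
  have h3 : √((4 * r ^ 2) ^ k) = 2 ^ k * |r| ^ k := by
    rw [Real.sqrt_eq_iff_mul_self_eq (by positivity) (by positivity), ← mul_pow, ← mul_pow]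
    congr 1
    have := sq_abs r
    nlinarith
  rw [h3] at h2
  rw [norm_div, norm_pow, Real.norm_eq_abs, Real.norm_of_nonneg (Real.sqrt_nonneg _), div_pow,
    one_pow]
  calc |r| ^ k / √(k.factorial : ℝ) = (2 ^ k * |r| ^ k / √(k.factorial : ℝ)) * (1 / 2 ^ k) := by
        field_simp
    _ ≤ _ := by gcongr

/-- The pointwise expansion of the kernel is upgraded to an expansion in `L²`. The series converges
absolutely in norm, a subsequence of partial sums converges almost everywhere, and the pointwise
limit is already known. -/
theorem hasSum_fockBasis_smul_hermiteL2 (z : ℂ) :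
    ∃ g : Signal, HasSum (fun k => fockBasis k z • hermiteL2 k) g ∧
      ∀ᵐ x : ℝ, g x = bargmannKernel z x := by
  have hs : Summable (fun k => fockBasis k z • hermiteL2 k) := by
    refine Summable.of_norm ?_
    simp_rw [norm_smul, norm_hermiteL2, mul_one, norm_fockBasis]
    exact summable_pow_div_sqrt_factorial _
  obtain ⟨g, hg⟩ := hs
  refine ⟨g, hg, ?_⟩
  have ht := hg.tendsto_sum_nat
  obtain ⟨ns, hns, hae⟩ := (tendstoInMeasure_of_tendsto_Lp ht).exists_seq_tendsto_ae
  have hpart : ∀ n : ℕ, ∀ᵐ x : ℝ, (∑ k ∈ Finset.range n, fockBasis k z • hermiteL2 k : Signal) x =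
      ∑ k ∈ Finset.range n, fockBasis k z * (hermiteFun k x : ℂ) := by
    intro n
    induction n with
    | zero => filter_upwards [Lp.coeFn_zero ℂ 2 (volume : Measure ℝ)] with x hx; simp
    | succ n ih =>
      rw [Finset.sum_range_succ]
      filter_upwards [ih, Lp.coeFn_add (∑ k ∈ Finset.range n, fockBasis k z • hermiteL2 k : Signal)
        (fockBasis n z • hermiteL2 n), Lp.coeFn_smul (fockBasis n z) (hermiteL2 n),
        (memLp_hermiteFun n).coeFn_toLp] with x h1 h2 h3 h4
      rw [h2, Pi.add_apply, h1, h3, Finset.sum_range_succ, Pi.smul_apply, hermiteL2, h4,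
        smul_eq_mul]
  filter_upwards [hae, ae_all_iff.mpr hpart] with x h1 h2
  simp_rw [h2] at h1
  exact tendsto_nhds_unique h1
    ((hasSum_fockBasis_mul_hermiteFun z x).tendsto_sum_nat.comp hns.tendsto_atTop)

/-- The `L²` expansion of the kernel paired with `f`. The conjugate in the transform is the one
carried by the first slot of `inner`. -/
theorem hasSum_bargmann (f : Signal) (z : ℂ) :
    HasSum (fun k => fockBasis k z * inner ℂ f (hermiteL2 k)) (bargmann f z) := by
  obtain ⟨g, hg, hgx⟩ := hasSum_fockBasis_smul_hermiteL2 z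
  have h := hg.mapL (innerSL ℂ f)
  have e : innerSL ℂ f g = bargmann f z := by
    rw [innerSL_apply_apply, L2.inner_def, bargmann_eq_integral]
    refine integral_congr_ae ?_
    filter_upwards [hgx] with x hx
    rw [hx, RCLike.inner_apply, mul_comm]
  rw [e] at h
  refine h.congr_fun fun k => ?_
  simp

theorem one_add_sq_le_four_pow (k : ℕ) : 1 + (k : ℝ) ^ 2 ≤ 4 ^ k := by
  induction k with
  | zero => simp
  | succ k ih =>
    push_cast
    rw [pow_succ (4 : ℝ) k]
    nlinarith [sq_nonneg ((k : ℝ) - 1), (Nat.cast_nonneg k : (0 : ℝ) ≤ k)]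

theorem sqrt_one_add_sq_le_two_pow (k : ℕ) : √(1 + (k : ℝ) ^ 2) ≤ 2 ^ k := by
  rw [Real.sqrt_le_left (by positivity), ← pow_mul, mul_comm k 2, pow_mul]
  norm_num
  exact one_add_sq_le_four_pow k

theorem sqrt_one_add_sq_ne_zero (k : ℕ) : ((√(1 + (k : ℝ) ^ 2) : ℝ) : ℂ) ≠ 0 := by
  have : 0 < √(1 + (k : ℝ) ^ 2) := by positivity
  exact_mod_cast this.ne'

/-- The weight `√(1+k²)` undoes the division in the coordinates of `Θ`. It is harmless against
`1/√k!`, so evaluation of the transform at `z` is a bounded functional on `Θ`. -/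
theorem memℓp_thetaKernel (z : ℂ) :
    Memℓp (fun k : ℕ => ((√(1 + (k : ℝ) ^ 2) : ℝ) : ℂ) * fockBasis k z) 2 := by
  apply memℓp_gen
  refine Summable.of_nonneg_of_le (fun k => by positivity) (fun k => ?_)
    (Real.summable_pow_div_factorial (4 * ‖z‖ ^ 2))
  simp only [ENNReal.toReal_ofNat, Real.rpow_ofNat]
  rw [norm_mul, mul_pow, norm_fockBasis, Complex.norm_real,
    Real.norm_of_nonneg (Real.sqrt_nonneg _), Real.sq_sqrt (by positivity), div_pow,
    Real.sq_sqrt (by positivity), mul_pow, ← mul_div_assoc, ← pow_mul, ← pow_mul, mul_comm k 2]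
  gcongr
  exact one_add_sq_le_four_pow k

/-- The element of `Θ` representing the value at `z` of the extended Bargmann transform. -/
noncomputable def thetaKernel (z : ℂ) : Theta := ⟨_, memℓp_thetaKernel z⟩

theorem toTheta_apply (f : Signal) (k : ℕ) :
    toTheta f k = inner ℂ (hermiteL2 k) f / ((√(1 + (k : ℝ) ^ 2) : ℝ) : ℂ) := rfl

theorem hasSum_inner_thetaKernel (θ : Theta) (z : ℂ) :
    HasSum (fun k => (starRingEnd ℂ) (θ k) * (((√(1 + (k : ℝ) ^ 2) : ℝ) : ℂ) * fockBasis k z))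
      (inner ℂ θ (thetaKernel z)) := by
  refine (lp.hasSum_inner θ (thetaKernel z)).congr_fun fun k => ?_
  rw [RCLike.inner_apply, mul_comm]
  rfl

theorem bargmann_eq_inner (f : Signal) (z : ℂ) :
    bargmann f z = inner ℂ (toTheta f) (thetaKernel z) := by
  refine (hasSum_bargmann f z).unique ((hasSum_inner_thetaKernel _ z).congr_fun fun k => ?_)
  rw [toTheta_apply, map_div₀, Complex.conj_ofReal, inner_conj_symm]
  have := sqrt_one_add_sq_ne_zero k
  field_simp

theorem toTheta_sum_smul (s : Finset ℕ) (c : ℕ → ℂ) :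
    toTheta (∑ k ∈ s, c k • hermiteL2 k) = ∑ k ∈ s, c k • toTheta (hermiteL2 k) := by
  induction s using Finset.induction_on with
  | empty => ext j; simp [toTheta_apply]
  | insert i s hi ih =>
    rw [Finset.sum_insert hi, Finset.sum_insert hi, ← ih]
    ext j
    change toTheta _ j = c i * toTheta (hermiteL2 i) j + toTheta (∑ k ∈ s, c k • hermiteL2 k) j
    simp only [toTheta_apply, inner_add_right, inner_smul_right, add_div, mul_div_assoc]

theorem toTheta_hermiteL2 (k : ℕ) :
    toTheta (hermiteL2 k) = lp.single 2 k (1 / ((√(1 + (k : ℝ) ^ 2) : ℝ) : ℂ)) := by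
  ext j
  rw [toTheta_apply, inner_hermiteL2, lp.single_apply]
  by_cases h : j = k
  · subst h; simp
  · simp [h]

/-- Density of `L²(ℝ, ℂ)` in `Θ`, through finite Hermite sums. It makes the limit defining
`bargmannTheta` unique. -/
theorem neBot_comap_toTheta (θ : Theta) : (comap toTheta (𝓝 θ)).NeBot := by
  rw [comap_neBot_iff]
  have h : HasSum (fun k => lp.single 2 k (θ k) : ℕ → Theta) θ :=
    lp.hasSum_single (by norm_num) θ
  intro t ht
  obtain ⟨n, hn⟩ := (h.tendsto_sum_nat.eventually_mem ht).exists
  refine ⟨∑ k ∈ Finset.range n, (θ k * ((√(1 + (k : ℝ) ^ 2) : ℝ) : ℂ)) • hermiteL2 k, ?_⟩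
  rw [toTheta_sum_smul]
  convert hn using 2 with k
  rw [toTheta_hermiteL2, ← lp.single_smul]
  congr 1
  have := sqrt_one_add_sq_ne_zero k
  simp [this]

theorem tendsto_bargmann_comap (θ : Theta) (z : ℂ) :
    Tendsto (fun f : Signal => bargmann f z) (comap toTheta (𝓝 θ))
      (𝓝 (inner ℂ θ (thetaKernel z))) := by
  simp_rw [bargmann_eq_inner]
  have hc : Continuous (fun θ : Theta => inner ℂ θ (thetaKernel z)) := by fun_prop
  exact (hc.tendsto θ).comp tendsto_comap

theorem bargmannTheta_eq_inner (θ : Theta) (z : ℂ) :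
    bargmannTheta θ z = inner ℂ θ (thetaKernel z) :=
  haveI := neBot_comap_toTheta θ
  (tendsto_bargmann_comap θ z).limUnder_eq

theorem hasSum_bargmannTheta (θ : Theta) (z : ℂ) :
    HasSum (fun k => (starRingEnd ℂ) (θ k) * (((√(1 + (k : ℝ) ^ 2) : ℝ) : ℂ) * fockBasis k z))
      (bargmannTheta θ z) := by
  rw [bargmannTheta_eq_inner]
  exact hasSum_inner_thetaKernel θ z

/-- A summable bound uniform on a disc. It yields holomorphy of the extended transform and its
termwise differentiation. -/
theorem norm_bargmannTheta_term_le (θ : Theta) (R : ℝ) (k : ℕ) (z : ℂ) (hz : ‖z‖ ≤ R) :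
    ‖(starRingEnd ℂ) (θ k) * (((√(1 + (k : ℝ) ^ 2) : ℝ) : ℂ) * fockBasis k z)‖ ≤
      ‖θ‖ * ((2 * R) ^ k / √(k.factorial : ℝ)) := by
  rw [norm_mul, RCLike.norm_conj, norm_mul, norm_fockBasis, Complex.norm_real,
    Real.norm_of_nonneg (Real.sqrt_nonneg _), ← mul_div_assoc, mul_pow]
  gcongr
  · exact lp.norm_apply_le_norm (by norm_num) θ k
  · exact sqrt_one_add_sq_le_two_pow k

theorem differentiable_fockBasis (k : ℕ) : Differentiable ℂ (fockBasis k) := by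
  unfold fockBasis; fun_prop

/-- The derivative of `z^k / √k!`, written so as to vanish for `k = 0`. -/
noncomputable def criticalCoeff (k : ℕ) (z : ℂ) : ℂ :=
  (k : ℂ) * z ^ (k - 1) / ((√(k.factorial : ℝ) : ℝ) : ℂ)

theorem deriv_fockBasis (k : ℕ) (z : ℂ) : deriv (fockBasis k) z = criticalCoeff k z := by
  unfold fockBasis criticalCoeff
  simp

theorem differentiable_bargmannTheta (θ : Theta) : Differentiable ℂ (bargmannTheta θ) := by
  intro z
  have e : bargmannTheta θ = fun z => ∑' k, (starRingEnd ℂ) (θ k) *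
      (((√(1 + (k : ℝ) ^ 2) : ℝ) : ℂ) * fockBasis k z) :=
    funext fun z => (hasSum_bargmannTheta θ z).tsum_eq.symm
  rw [e]
  have hd := differentiable_fockBasis
  refine (Complex.differentiableOn_tsum_of_summable_norm
    ((summable_pow_div_sqrt_factorial (2 * (‖z‖ + 1))).mul_left ‖θ‖)
    (fun k => by have := hd k; fun_prop) Metric.isOpen_ball (fun k w hw =>
      norm_bargmannTheta_term_le θ (‖z‖ + 1) k w (mem_ball_zero_iff.mp hw).le)
    ).differentiableAt (Metric.isOpen_ball.mem_nhds (mem_ball_zero_iff.mpr (by linarith)))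

theorem hasSum_deriv_bargmannTheta (θ : Theta) (z : ℂ) :
    HasSum (fun k => (starRingEnd ℂ) (θ k) * (((√(1 + (k : ℝ) ^ 2) : ℝ) : ℂ) * criticalCoeff k z))
      (deriv (bargmannTheta θ) z) := by
  have e : bargmannTheta θ = fun z => ∑' k, (starRingEnd ℂ) (θ k) *
      (((√(1 + (k : ℝ) ^ 2) : ℝ) : ℂ) * fockBasis k z) :=
    funext fun z => (hasSum_bargmannTheta θ z).tsum_eq.symm
  rw [e]
  have hd := differentiable_fockBasis
  refine (Complex.hasSum_deriv_of_summable_norm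
    ((summable_pow_div_sqrt_factorial (2 * (‖z‖ + 1))).mul_left ‖θ‖)
    (fun k => by have := hd k; fun_prop) Metric.isOpen_ball (fun k w hw =>
      norm_bargmannTheta_term_le θ (‖z‖ + 1) k w (mem_ball_zero_iff.mp hw).le)
    (mem_ball_zero_iff.mpr (by linarith : ‖z‖ < ‖z‖ + 1))).congr_fun fun k => ?_
  rw [deriv_const_mul_field, deriv_const_mul_field, deriv_fockBasis]

theorem hasSum_whiteNoise {Ω : Type*} {a : ℕ → Ω → ℂ} {ω : Ω}
    (h : Memℓp (fun k : ℕ => a k ω / ((√(1 + (k : ℝ) ^ 2) : ℝ) : ℂ)) 2) :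
    HasSum (fun k => a k ω • toTheta (hermiteL2 k)) (⟨_, h⟩ : Theta) := by
  refine (lp.hasSum_single (E := fun _ : ℕ => ℂ) (p := 2) (by norm_num) ⟨_, h⟩).congr_fun
    fun k => ?_
  rw [toTheta_hermiteL2, ← lp.single_smul]
  congr 1
  simp [div_eq_mul_inv]

theorem hasSum_deriv_bargmannTheta_whiteNoise {Ω : Type*} {a : ℕ → Ω → ℂ} {ω : Ω}
    (h : Memℓp (fun k : ℕ => a k ω / ((√(1 + (k : ℝ) ^ 2) : ℝ) : ℂ)) 2) (z : ℂ) :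
    HasSum (fun k => (starRingEnd ℂ) (a k ω) * criticalCoeff k z)
      (deriv (bargmannTheta (whiteNoise a ω)) z) := by
  rw [whiteNoise, (hasSum_whiteNoise h).tsum_eq]
  refine (hasSum_deriv_bargmannTheta _ z).congr_fun fun k => ?_
  change _ = (starRingEnd ℂ) (a k ω / ((√(1 + (k : ℝ) ^ 2) : ℝ) : ℂ)) * _
  rw [map_div₀, Complex.conj_ofReal]
  have := sqrt_one_add_sq_ne_zero k
  field_simp

end BargmannNoise

/-! ### Almost sure convergence of series with independent centred coefficients. -/

namespace BargmannNoise

theorem measurable_stdComplexGaussian_map :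
    Measurable (fun p : ℝ × ℝ => ((p.1 : ℂ) + (p.2 : ℂ) * Complex.I) / ((√2 : ℝ) : ℂ)) := by
  fun_prop

instance : IsProbabilityMeasure stdComplexGaussian :=
  Measure.isProbabilityMeasure_map measurable_stdComplexGaussian_map.aemeasurable

theorem memLp_id_stdComplexGaussian : MemLp id 2 stdComplexGaussian := by
  have h : MemLp (fun x : ℝ => x) 2 (gaussianReal 0 1) := memLp_id_gaussianReal' 2 (by simp)
  have h1 : MemLp (fun p : ℝ × ℝ => (p.1 : ℂ)) 2 ((gaussianReal 0 1).prod (gaussianReal 0 1)) :=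
    (h.comp_measurePreserving measurePreserving_fst).ofReal
  have h2 : MemLp (fun p : ℝ × ℝ => (p.2 : ℂ)) 2 ((gaussianReal 0 1).prod (gaussianReal 0 1)) :=
    (h.comp_measurePreserving measurePreserving_snd).ofReal
  rw [stdComplexGaussian, memLp_map_measure_iff (by fun_prop) (by fun_prop)]
  refine ((h1.add (h2.mul_const Complex.I)).mul_const (((√2 : ℝ) : ℂ)⁻¹)).congr_norm
    (by fun_prop) (ae_of_all _ fun p => ?_)
  simp [div_eq_mul_inv]

theorem integral_id_stdComplexGaussian : ∫ z, z ∂stdComplexGaussian = 0 := by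
  have h : Integrable (fun x : ℝ => x) (gaussianReal 0 1) :=
    (memLp_id_gaussianReal' 1 (by simp)).integrable le_rfl
  have h1 : Integrable (fun p : ℝ × ℝ => (p.1 : ℂ)) ((gaussianReal 0 1).prod (gaussianReal 0 1)) :=
    (measurePreserving_fst.integrable_comp_of_integrable h).ofReal
  have h2 : Integrable (fun p : ℝ × ℝ => (p.2 : ℂ)) ((gaussianReal 0 1).prod (gaussianReal 0 1)) :=
    (measurePreserving_snd.integrable_comp_of_integrable h).ofReal
  rw [stdComplexGaussian, integral_map (by fun_prop) (by fun_prop), integral_div,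
    integral_add h1 (h2.mul_const _), integral_mul_const]
  have e1 : ∫ p : ℝ × ℝ, (p.1 : ℂ) ∂((gaussianReal 0 1).prod (gaussianReal 0 1)) = 0 := by
    rw [integral_complex_ofReal, integral_fun_fst (fun x : ℝ => x)]
    simp
  have e2 : ∫ p : ℝ × ℝ, (p.2 : ℂ) ∂((gaussianReal 0 1).prod (gaussianReal 0 1)) = 0 := by
    rw [integral_complex_ofReal, integral_fun_snd (fun x : ℝ => x)]
    simp
  rw [e1, e2]
  simp

theorem stronglyMeasurable_sum_smul {Ω H : Type*} [NormedAddCommGroup H] [NormedSpace ℂ H]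
    {c : ℕ → Ω → ℂ} {m : MeasurableSpace Ω} (s : Finset ℕ)
    (hc : ∀ k ∈ s, StronglyMeasurable[m] (c k)) (v : ℕ → H) :
    StronglyMeasurable[m] (fun ω => ∑ k ∈ s, c k ω • v k) :=
  Finset.stronglyMeasurable_fun_sum s fun k hk => (hc k hk).smul_const (v k)

section Maximal

variable {Ω : Type*} [MeasurableSpace Ω] {P : Measure Ω}
  {H : Type*} [NormedAddCommGroup H] [InnerProductSpace ℂ H] {c : ℕ → Ω → ℂ}

theorem memLp_sum_smul (hL : ∀ k, MemLp (c k) 2 P) (v : ℕ → H) (s : Finset ℕ) :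
    MemLp (fun ω => ∑ k ∈ s, c k ω • v k) 2 P :=
  memLp_finsetSum s fun k _ => by
    have h := (hL k)
    refine MemLp.of_le_mul (c := ‖v k‖) h (h.1.smul_const (v k)) (ae_of_all _ fun ω => ?_)
    rw [norm_smul, mul_comm]

/-- The cross term vanishes on an event of the past: `c (m + 1)` is centred and independent of the
natural filtration at time `m`. That filtration sees `c 0, …, c m`, which is why the adapted sum
runs over `range (m + 1)`. -/
theorem setIntegral_norm_sq_sum_succ (hc : ∀ k, StronglyMeasurable (c k)) (hi : iIndepFun c P)
    (hL : ∀ k, MemLp (c k) 2 P) (h0 : ∀ k, ∫ ω, c k ω ∂P = 0) (v : ℕ → H) (m : ℕ) {A : Set Ω}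
    (hA : MeasurableSet[Filtration.natural c hc m] A) :
    ∫ ω in A, ‖∑ k ∈ Finset.range (m + 2), c k ω • v k‖ ^ 2 ∂P =
      ∫ ω in A, ‖∑ k ∈ Finset.range (m + 1), c k ω • v k‖ ^ 2 ∂P +
        ‖v (m + 1)‖ ^ 2 * ∫ ω in A, ‖c (m + 1) ω‖ ^ 2 ∂P := by
  set T : Ω → H := fun ω => ∑ k ∈ Finset.range (m + 1), c k ω • v k with hT
  have hA' : MeasurableSet A := (Filtration.natural c hc).le m _ hA
  have hadp : ∀ k ∈ Finset.range (m + 1), StronglyMeasurable[Filtration.natural c hc m] (c k) :=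
    fun k hk => (Filtration.stronglyAdapted_natural hc k).mono
      ((Filtration.natural c hc).mono (by simpa [Nat.lt_succ_iff] using hk))
  have hTm : StronglyMeasurable[Filtration.natural c hc m] T := stronglyMeasurable_sum_smul _ hadp v
  have hTL : MemLp T 2 P := memLp_sum_smul hL v _
  set W : Ω → ℂ := A.indicator (fun ω => inner ℂ (T ω) (v (m + 1))) with hW
  have hWm : StronglyMeasurable[Filtration.natural c hc m] W :=
    (hTm.inner stronglyMeasurable_const).indicator hA
  have hind : IndepFun (c (m + 1)) W P := by
    refine indep_of_indep_of_le_right (hi.indep_comap_natural_of_lt hc (Nat.lt_succ_self m)) ?_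
    exact hWm.measurable.comap_le
  have hzero : ∫ ω, c (m + 1) ω * W ω ∂P = 0 := by
    rw [hind.integral_fun_mul_eq_mul_integral (hL _).1
      (hWm.mono ((Filtration.natural c hc).le m)).aestronglyMeasurable, h0, zero_mul]
  have hTi : Integrable (fun ω => inner ℂ (T ω) (c (m + 1) ω • v (m + 1))) P := by
    have h2 : MemLp (fun ω => inner ℂ (T ω) (v (m + 1))) 2 P :=
      MemLp.of_le_mul (c := ‖v (m + 1)‖) hTL (hTL.1.inner aestronglyMeasurable_const)
        (ae_of_all _ fun ω => by rw [mul_comm]; exact norm_inner_le_norm _ _)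
    simp_rw [inner_smul_right]
    exact (hL _).integrable_mul h2
  have hcross : ∫ ω in A, RCLike.re (inner ℂ (T ω) (c (m + 1) ω • v (m + 1))) ∂P = 0 := by
    rw [integral_re hTi.restrict, ← integral_indicator hA']
    have : A.indicator (fun ω => inner ℂ (T ω) (c (m + 1) ω • v (m + 1))) =
        fun ω => c (m + 1) ω * W ω := by
      funext ω
      by_cases hω : ω ∈ A <;> simp [hW, hω]
    rw [this, hzero]
    simp
  have hexp : ∀ ω, ‖∑ k ∈ Finset.range (m + 2), c k ω • v k‖ ^ 2 = ‖T ω‖ ^ 2 +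
      2 * RCLike.re (inner ℂ (T ω) (c (m + 1) ω • v (m + 1))) +
        ‖v (m + 1)‖ ^ 2 * ‖c (m + 1) ω‖ ^ 2 := by
    intro ω
    rw [Finset.sum_range_succ, norm_add_sq (𝕜 := ℂ), norm_smul]
    ring
  simp_rw [hexp]
  have i1 : Integrable (fun ω => ‖T ω‖ ^ 2) P := hTL.integrable_norm_pow (by norm_num)
  have i3 : Integrable (fun ω => ‖c (m + 1) ω‖ ^ 2) P := (hL _).integrable_norm_pow (by norm_num)
  have i2 : Integrable (fun ω => 2 * RCLike.re (inner ℂ (T ω) (c (m + 1) ω • v (m + 1)))) P :=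
    hTi.re.const_mul 2
  have i12 : Integrable (fun ω => ‖T ω‖ ^ 2 +
      2 * RCLike.re (inner ℂ (T ω) (c (m + 1) ω • v (m + 1)))) P := i1.add i2
  rw [integral_add i12.restrict (i3.restrict.const_mul _),
    integral_add i1.restrict i2.restrict, integral_const_mul, hcross,
    integral_const_mul]
  ring

theorem integral_norm_sq_sum_le {s : ℝ} (hc : ∀ k, StronglyMeasurable (c k)) (hi : iIndepFun c P)
    (hL : ∀ k, MemLp (c k) 2 P) (h0 : ∀ k, ∫ ω, c k ω ∂P = 0)
    (hs : ∀ k, ∫ ω, ‖c k ω‖ ^ 2 ∂P = s) (v : ℕ → H) (m : ℕ) :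
    ∫ ω, ‖∑ k ∈ Finset.range (m + 1), c k ω • v k‖ ^ 2 ∂P =
      s * ∑ k ∈ Finset.range (m + 1), ‖v k‖ ^ 2 := by
  induction m with
  | zero => simp [norm_smul, mul_pow, integral_mul_const, hs]
  | succ m ih =>
    have := setIntegral_norm_sq_sum_succ hc hi hL h0 v m (A := Set.univ) MeasurableSet.univ
    simp only [Measure.restrict_univ] at this
    rw [this, ih, hs, Finset.sum_range_succ _ (m + 1)]
    ring

variable [IsProbabilityMeasure P]

/-- Kolmogorov's inequality in an inner product space: the squared norms of the partial sums form a
submartingale, and Doob's maximal inequality gives a bound independent of the horizon. -/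
theorem measure_exists_le_norm_sq_sum_le {s : ℝ} (hc : ∀ k, StronglyMeasurable (c k))
    (hi : iIndepFun c P) (hL : ∀ k, MemLp (c k) 2 P) (h0 : ∀ k, ∫ ω, c k ω ∂P = 0)
    (hs : ∀ k, ∫ ω, ‖c k ω‖ ^ 2 ∂P = s) (v : ℕ → H) (hv : Summable (fun k => ‖v k‖ ^ 2))
    (ε : NNReal) :
    ε * P {ω | ∃ m, (ε : ℝ) ≤ ‖∑ k ∈ Finset.range (m + 1), c k ω • v k‖ ^ 2} ≤
      ENNReal.ofReal (s * ∑' k, ‖v k‖ ^ 2) := by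
  have hs0 : 0 ≤ s := by rw [← hs 0]; positivity
  set Y : ℕ → Ω → ℝ := fun m ω => ‖∑ k ∈ Finset.range (m + 1), c k ω • v k‖ ^ 2 with hY
  have hYi : ∀ m, Integrable (Y m) P := fun m =>
    (memLp_sum_smul hL v _).integrable_norm_pow (by norm_num)
  have hsub : Submartingale Y (Filtration.natural c hc) P := by
    refine submartingale_of_setIntegral_le_succ (fun m => ?_) hYi fun m A hA => ?_
    · have hadp : ∀ k ∈ Finset.range (m + 1),
          StronglyMeasurable[Filtration.natural c hc m] (c k) :=
        fun k hk => (Filtration.stronglyAdapted_natural hc k).mono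
          ((Filtration.natural c hc).mono (by simpa [Nat.lt_succ_iff] using hk))
      exact (stronglyMeasurable_sum_smul _ hadp v).norm.pow 2
    · rw [hY, setIntegral_norm_sq_sum_succ hc hi hL h0 v m hA]
      have : 0 ≤ ‖v (m + 1)‖ ^ 2 * ∫ ω in A, ‖c (m + 1) ω‖ ^ 2 ∂P := by positivity
      simpa using this
  have hbound : ∀ N, ε * P {ω | ∃ m ≤ N, (ε : ℝ) ≤ Y m ω} ≤
      ENNReal.ofReal (s * ∑' k, ‖v k‖ ^ 2) := by
    intro N
    have hset : {ω | ∃ m ≤ N, (ε : ℝ) ≤ Y m ω} = {ω | (ε : ℝ) ≤ (Finset.range (N + 1)).sup'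
        Finset.nonempty_range_add_one fun k => Y k ω} := by
      ext ω
      simp [Finset.le_sup'_iff]
    rw [hset]
    refine (maximal_ineq hsub (fun m ω => by positivity) N).trans (ENNReal.ofReal_le_ofReal ?_)
    refine (setIntegral_le_integral (hYi N) (ae_of_all _ fun ω => by positivity)).trans ?_
    rw [hY, integral_norm_sq_sum_le hc hi hL h0 hs v N]
    gcongr
    exact hv.sum_le_tsum _ fun k _ => by positivity
  have hU : {ω | ∃ m, (ε : ℝ) ≤ Y m ω} = ⋃ N, {ω | ∃ m ≤ N, (ε : ℝ) ≤ Y m ω} := by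
    ext ω
    simp only [Set.mem_ofPred_eq, Set.mem_iUnion]
    exact ⟨fun ⟨m, hm⟩ => ⟨m, m, le_rfl, hm⟩, fun ⟨_, m, _, hm⟩ => ⟨m, hm⟩⟩
  rw [hU, Monotone.measure_iUnion, ENNReal.mul_iSup]
  · exact iSup_le hbound
  · exact fun N N' hN ω ⟨m, hm, h⟩ => ⟨m, hm.trans hN, h⟩

/-- A series with independent centred coefficients and square summable directions in an inner
product space has almost surely Cauchy partial sums. -/
theorem ae_cauchySeq_sum_smul {s : ℝ} (hc : ∀ k, StronglyMeasurable (c k))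
    (hi : iIndepFun c P) (hL : ∀ k, MemLp (c k) 2 P) (h0 : ∀ k, ∫ ω, c k ω ∂P = 0)
    (hs : ∀ k, ∫ ω, ‖c k ω‖ ^ 2 ∂P = s) (v : ℕ → H) (hv : Summable (fun k => ‖v k‖ ^ 2)) :
    ∀ᵐ ω ∂P, CauchySeq (fun n => ∑ k ∈ Finset.range n, c k ω • v k) := by
  have htail : ∀ (ε : NNReal), 0 < ε → ∀ᵐ ω ∂P, ∃ n, ∀ m,
      ‖∑ k ∈ Finset.range (m + 1), c (k + n) ω • v (k + n)‖ ^ 2 < ε := by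
    intro ε hε
    rw [ae_iff]
    push Not
    -- The event that every tail exceeds `ε` lies in the event for each single tail, whose bound
    -- tends to zero with the tail of `∑ ‖v k‖²`.
    have hle : ∀ n, ε * P {ω | ∀ n, ∃ m,
        (ε : ℝ) ≤ ‖∑ k ∈ Finset.range (m + 1), c (k + n) ω • v (k + n)‖ ^ 2} ≤
          ENNReal.ofReal (s * ∑' k, ‖v (k + n)‖ ^ 2) := by
      intro n
      refine le_trans ?_ (measure_exists_le_norm_sq_sum_le (c := fun k => c (k + n))
        (fun k => hc _) (hi.precomp (add_left_injective n)) (fun k => hL _) (fun k => h0 _)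
        (fun k => hs _) (fun k => v (k + n)) ((summable_nat_add_iff n).mpr hv) ε)
      gcongr
      intro h
      exact h n
    have hlim : Tendsto (fun n => ENNReal.ofReal (s * ∑' k, ‖v (k + n)‖ ^ 2)) atTop (𝓝 0) := by
      have := (tendsto_sum_nat_add (fun k => ‖v k‖ ^ 2)).const_mul s
      rw [mul_zero] at this
      simpa using ENNReal.tendsto_ofReal this
    have h := ge_of_tendsto' hlim hle
    simpa [hε.ne'] using h
  have hall : ∀ᵐ ω ∂P, ∀ j : ℕ, ∃ n, ∀ m,
      ‖∑ k ∈ Finset.range (m + 1), c (k + n) ω • v (k + n)‖ ^ 2 <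
        (((1 / ((j : ℝ) + 1)) ^ 2).toNNReal : ℝ) :=
    ae_all_iff.mpr fun j => htail _ (Real.toNNReal_pos.mpr (by positivity))
  filter_upwards [hall] with ω hω
  rw [Metric.cauchySeq_iff']
  intro ε hε
  obtain ⟨j, hj⟩ := exists_nat_one_div_lt hε
  obtain ⟨n, hn⟩ := hω j
  refine ⟨n, fun m hm => ?_⟩
  obtain ⟨i, rfl⟩ := Nat.exists_eq_add_of_le hm
  rw [dist_eq_norm, Finset.sum_range_add, add_sub_cancel_left]
  cases i with
  | zero => simpa using hε
  | succ i =>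
    have h := hn i
    rw [Real.coe_toNNReal _ (by positivity)] at h
    have h2 := lt_of_pow_lt_pow_left₀ 2 (by positivity) h
    simp_rw [add_comm _ n] at h2
    exact h2.trans hj

end Maximal

/-- The law of an i.i.d. sequence of standard complex Gaussians. -/
noncomputable def seqLaw : Measure (ℕ → ℂ) := Measure.infinitePi fun _ => stdComplexGaussian

instance : IsProbabilityMeasure seqLaw := by unfold seqLaw; infer_instance

theorem IsIIDStdComplexGaussian.aemeasurable {Ω : Type*} [MeasurableSpace Ω] {a : ℕ → Ω → ℂ}
    {P : Measure Ω} (ha : IsIIDStdComplexGaussian a P) : AEMeasurable (fun ω k => a k ω) P :=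
  aemeasurable_pi_iff.2 fun k => (ha.hasLaw k).aemeasurable

/-- This moves every almost sure statement and every law to one canonical product space, so the
different probability spaces of the theorem need no separate treatment. -/
theorem IsIIDStdComplexGaussian.map_eq {Ω : Type*} [MeasurableSpace Ω] {a : ℕ → Ω → ℂ}
    {P : Measure Ω} (ha : IsIIDStdComplexGaussian a P) :
    P.map (fun ω k => a k ω) = seqLaw := by
  rw [ha.indep.map_fun_eq_infinitePi_map₀ ha.aemeasurable, seqLaw]
  simp_rw [fun k => (ha.hasLaw k).map_eq]

theorem measurePreserving_eval_seqLaw (k : ℕ) :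
    MeasurePreserving (fun x : ℕ → ℂ => x k) seqLaw stdComplexGaussian :=
  measurePreserving_eval_infinitePi (fun _ => stdComplexGaussian) k

theorem iIndepFun_eval_seqLaw : iIndepFun (fun k (x : ℕ → ℂ) => x k) seqLaw :=
  iIndepFun_infinitePi (P := fun _ : ℕ => stdComplexGaussian) (X := fun _ z => z)
    fun _ => measurable_id

theorem memLp_eval_seqLaw (k : ℕ) : MemLp (fun x : ℕ → ℂ => x k) 2 seqLaw :=
  memLp_id_stdComplexGaussian.comp_measurePreserving (measurePreserving_eval_seqLaw k)

theorem integral_eval_seqLaw (k : ℕ) : ∫ x : ℕ → ℂ, x k ∂seqLaw = 0 := by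
  rw [← integral_id_stdComplexGaussian, ← (measurePreserving_eval_seqLaw k).map_eq,
    integral_map (measurable_pi_apply k).aemeasurable (by fun_prop)]

theorem integral_norm_sq_eval_seqLaw (k : ℕ) :
    ∫ x : ℕ → ℂ, ‖x k‖ ^ 2 ∂seqLaw = ∫ z, ‖z‖ ^ 2 ∂stdComplexGaussian := by
  rw [← (measurePreserving_eval_seqLaw k).map_eq, integral_map (measurable_pi_apply k).aemeasurable (by fun_prop)]

theorem ae_cauchySeq_sum_smul_seqLaw {H : Type*} [NormedAddCommGroup H] [InnerProductSpace ℂ H]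
    (v : ℕ → H) (hv : Summable (fun k => ‖v k‖ ^ 2)) :
    ∀ᵐ x ∂seqLaw, CauchySeq (fun n => ∑ k ∈ Finset.range n, x k • v k) :=
  ae_cauchySeq_sum_smul (fun k => (measurable_pi_apply k).stronglyMeasurable)
    iIndepFun_eval_seqLaw memLp_eval_seqLaw integral_eval_seqLaw integral_norm_sq_eval_seqLaw v hv

end BargmannNoise

/-! ### Locally uniform convergence of the random series. -/

namespace BargmannNoise

theorem norm_circleAverage_le {f : ℂ → ℂ} {c : ℂ} {R : ℝ} :
    ‖Real.circleAverage f c R‖ ≤ Real.circleAverage (fun z => ‖f z‖) c R := by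
  rw [Real.circleAverage, Real.circleAverage, norm_smul, Real.norm_of_nonneg (by positivity),
    smul_eq_mul]
  gcongr
  exact intervalIntegral.norm_integral_le_integral_norm (by positivity)

/-- Cauchy's formula for `f²` on the circle of radius `R + 1`: the weight `z/(z - w)` has modulus at
most `R + 1` because `|z - w| ≥ 1`. Thus an `L²` bound on a circle controls the supremum on a
smaller disc, and convergence of Hilbert space valued series becomes uniform convergence. -/
theorem norm_sq_le_circleAverage {f : ℂ → ℂ} (hf : Differentiable ℂ f) {R : ℝ} (hR : 0 ≤ R) {w : ℂ}
    (hw : ‖w‖ ≤ R) :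
    ‖f w‖ ^ 2 ≤ (R + 1) * Real.circleAverage (fun z => ‖f z‖ ^ 2) 0 (R + 1) := by
  have hR1 : |R + 1| = R + 1 := abs_of_pos (by linarith)
  have hwR : w ∈ Metric.ball (0 : ℂ) |R + 1| := by
    rw [hR1, mem_ball_zero_iff]; linarith
  have h := DiffContOnCl.circleAverage_smul_div (f := fun z => f z ^ 2) (c := 0) (R := R + 1)
    (w := w) (hf.pow 2).diffContOnCl hwR
  have hne : ∀ z ∈ Metric.sphere (0 : ℂ) |R + 1|, 1 ≤ ‖z - w‖ := by
    intro z hz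
    rw [hR1, mem_sphere_zero_iff_norm] at hz
    have := norm_sub_norm_le z w
    linarith
  rw [← norm_pow, ← h]
  refine norm_circleAverage_le.trans ?_
  rw [← smul_eq_mul, ← Real.circleAverage_fun_smul]
  refine Real.circleAverage_mono (ContinuousOn.circleIntegrable' ?_)
    (Continuous.continuousOn (by have := hf.continuous; fun_prop)).circleIntegrable' ?_
  · have hc := hf.continuous
    refine ContinuousOn.norm (ContinuousOn.mul (ContinuousOn.div (by fun_prop) (by fun_prop) ?_)
      (by fun_prop))
    intro z hz h0
    have := hne z hz
    rw [h0, norm_zero] at this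
    linarith
  · intro z hz
    have h1 := hne z hz
    rw [hR1, mem_sphere_zero_iff_norm] at hz
    rw [norm_smul, norm_pow, norm_div, sub_zero, hz, smul_eq_mul]
    gcongr
    exact div_le_self (by linarith) h1

/-- Finite sums commute with the circle average, and the sums of `|Ψ_k|²` are bounded uniformly on
the circle. -/
theorem IsGAFCoeff.summable_circleAverage {Ψ : ℕ → ℂ → ℂ} (hΨ : IsGAFCoeff Ψ) (R : ℝ) :
    Summable (fun k => Real.circleAverage (fun z => ‖Ψ k z‖ ^ 2) 0 R) := by
  obtain ⟨C, hC⟩ := hΨ.2 (Metric.sphere 0 |R|) (isCompact_sphere 0 |R|)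
  have hci : ∀ k, CircleIntegrable (fun z => ‖Ψ k z‖ ^ 2) 0 R := fun k =>
    (Continuous.continuousOn (by have := (hΨ.1 k).continuous; fun_prop)).circleIntegrable'
  refine summable_of_sum_le (c := C)
    (fun k => Real.circleAverage_nonneg_of_nonneg fun z _ => by positivity) fun s => ?_
  rw [← Real.circleAverage_fun_sum fun k _ => hci k]
  refine Real.circleAverage_mono_on_of_le_circle ?_ fun z hz => ?_
  · exact (Continuous.continuousOn (by
      have := fun k => (hΨ.1 k).continuous
      fun_prop)).circleIntegrable'
  · exact ((hC z hz).1.sum_le_tsum s fun k _ => by positivity).trans (hC z hz).2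

/-- The coefficient functions of a Gaussian analytic function are square summable uniformly on
discs. -/
theorem IsGAFCoeff.exists_bound {Ψ : ℕ → ℂ → ℂ} (hΨ : IsGAFCoeff Ψ) (R : ℝ) :
    ∃ M : ℕ → ℝ, Summable M ∧ ∀ k z, ‖z‖ ≤ R → ‖Ψ k z‖ ^ 2 ≤ M k :=
  ⟨_, (hΨ.summable_circleAverage (|R| + 1)).mul_left (|R| + 1), fun k _ hz =>
    norm_sq_le_circleAverage (hΨ.1 k) (abs_nonneg R) (hz.trans (le_abs_self R))⟩

theorem IsGAFCoeff.summable {Ψ : ℕ → ℂ → ℂ} (hΨ : IsGAFCoeff Ψ) (z : ℂ) :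
    Summable (fun k => ‖Ψ k z‖ ^ 2) := by
  obtain ⟨C, hC⟩ := hΨ.2 {z} isCompact_singleton
  exact (hC z rfl).1

/-- The restriction of a continuous function to a circle, as an element of an `L²` space. -/
noncomputable def circleRestrict (R : ℝ) (f : ℂ → ℂ) (hf : Continuous f) :
    Lp ℂ 2 (volume.restrict (Set.uIoc 0 (2 * Real.pi))) :=
  MemLp.toLp (fun θ => f (circleMap 0 R θ)) (by
    obtain ⟨C, hC⟩ := (isCompact_sphere (0 : ℂ) |R|).exists_bound_of_continuousOn hf.continuousOn
    have : IsFiniteMeasure (volume.restrict (Set.uIoc 0 (2 * Real.pi))) := by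
      rw [Set.uIoc_of_le (by positivity)]; infer_instance
    exact MemLp.of_bound (by fun_prop) C (ae_of_all _ fun θ => hC _ (circleMap_mem_sphere' 0 R θ)))

theorem sum_smul_circleRestrict {Ψ : ℕ → ℂ → ℂ} (hΨ : ∀ k, Continuous (Ψ k)) (R : ℝ)
    (s : Finset ℕ) (x : ℕ → ℂ) :
    ∑ k ∈ s, x k • circleRestrict R (Ψ k) (hΨ k) =
      circleRestrict R (fun z => ∑ k ∈ s, x k * Ψ k z) (by fun_prop) := by
  induction s using Finset.induction_on with
  | empty => simp only [Finset.sum_empty]; exact (MemLp.toLp_zero _).symm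
  | insert i s hi ih =>
    rw [Finset.sum_insert hi, ih]
    simp_rw [Finset.sum_insert hi]
    rfl

/-- The factor `2π` appears because the `L²` space uses unnormalized arc parameter while the circle
average is normalized. -/
theorem norm_sq_circleRestrict (R : ℝ) (f : ℂ → ℂ) (hf : Continuous f) :
    ‖circleRestrict R f hf‖ ^ 2 =
      2 * Real.pi * Real.circleAverage (fun z => ‖f z‖ ^ 2) 0 R := by
  rw [← inner_self_eq_norm_sq (𝕜 := ℂ), L2.inner_def, Real.circleAverage, smul_eq_mul,
    mul_inv_cancel_left₀ (by positivity), intervalIntegral.integral_of_le (by positivity),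
    ← Set.uIoc_of_le (by positivity)]
  have : ∫ θ in Set.uIoc 0 (2 * Real.pi),
      inner ℂ (circleRestrict R f hf θ) (circleRestrict R f hf θ) =
      ∫ θ in Set.uIoc 0 (2 * Real.pi), ((‖f (circleMap 0 R θ)‖ ^ 2 : ℝ) : ℂ) := by
    refine integral_congr_ae ?_
    filter_upwards [MemLp.coeFn_toLp (μ := volume.restrict (Set.uIoc 0 (2 * Real.pi)))
      (f := fun θ => f (circleMap 0 R θ)) (p := 2) _] with θ hθ
    rw [circleRestrict, hθ, inner_self_eq_norm_sq_to_K]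
    push_cast
    rfl
  rw [this, integral_complex_ofReal]
  exact Complex.ofReal_re _

/-- The random series with coefficient functions `Ψ`, as a function of its coefficients. -/
noncomputable def seqGaf (Ψ : ℕ → ℂ → ℂ) (x : ℕ → ℂ) (z : ℂ) : ℂ :=
  gaf Ψ (fun k (x : ℕ → ℂ) => x k) x z

/-- The partial sums of the random series converge locally uniformly. -/
def SeqConverges (Ψ : ℕ → ℂ → ℂ) (x : ℕ → ℂ) : Prop :=
  ∃ F : ℂ → ℂ, TendstoLocallyUniformlyOn (fun n z => ∑ k ∈ Finset.range n, x k * Ψ k z) F atTop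
    Set.univ

theorem SeqConverges.of_tendsto {Ψ : ℕ → ℂ → ℂ} {x : ℕ → ℂ} {F : ℂ → ℂ}
    (h : TendstoLocallyUniformlyOn (fun n z => ∑ k ∈ Finset.range n, x k * Ψ k z) F atTop
      Set.univ) : seqGaf Ψ x = F :=
  funext fun z => (h.tendsto_at (Set.mem_univ z)).limUnder_eq

theorem SeqConverges.tendstoLocallyUniformlyOn {Ψ : ℕ → ℂ → ℂ} {x : ℕ → ℂ}
    (h : SeqConverges Ψ x) :
    TendstoLocallyUniformlyOn (fun n z => ∑ k ∈ Finset.range n, x k * Ψ k z) (seqGaf Ψ x) atTop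
      Set.univ := by
  obtain ⟨F, hF⟩ := h
  rwa [SeqConverges.of_tendsto hF]

theorem SeqConverges.tendsto {Ψ : ℕ → ℂ → ℂ} {x : ℕ → ℂ} (h : SeqConverges Ψ x) (z : ℂ) :
    Tendsto (fun n => ∑ k ∈ Finset.range n, x k * Ψ k z) atTop (𝓝 (seqGaf Ψ x z)) :=
  h.tendstoLocallyUniformlyOn.tendsto_at (Set.mem_univ z)

theorem SeqConverges.differentiable {Ψ : ℕ → ℂ → ℂ} {x : ℕ → ℂ} (h : SeqConverges Ψ x)
    (hΨ : ∀ k, Differentiable ℂ (Ψ k)) : Differentiable ℂ (seqGaf Ψ x) :=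
  differentiableOn_univ.mp (h.tendstoLocallyUniformlyOn.differentiableOn
    (Eventually.of_forall fun n => by fun_prop) isOpen_univ)

theorem uniformCauchySeqOn_of_cauchySeq_circleRestrict {Ψ : ℕ → ℂ → ℂ}
    (hΨ : ∀ k, Differentiable ℂ (Ψ k)) {R : ℝ} (hR : 0 ≤ R) {x : ℕ → ℂ}
    (h : CauchySeq (fun n => ∑ k ∈ Finset.range n,
      x k • circleRestrict (R + 1) (Ψ k) (hΨ k).continuous)) :
    UniformCauchySeqOn (fun n z => ∑ k ∈ Finset.range n, x k * Ψ k z) atTop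
      (Metric.closedBall 0 R) := by
  rw [Metric.uniformCauchySeqOn_iff]
  intro ε hε
  rw [Metric.cauchySeq_iff] at h
  obtain ⟨N, hN⟩ := h (ε / (R + 1)) (by positivity)
  refine ⟨N, fun m hm n hn z hz => ?_⟩
  have h1 := hN m hm n hn
  rw [sum_smul_circleRestrict fun k => (hΨ k).continuous,
    sum_smul_circleRestrict fun k => (hΨ k).continuous, dist_eq_norm] at h1
  set f : ℂ → ℂ := fun z => ∑ k ∈ Finset.range m, x k * Ψ k z - ∑ k ∈ Finset.range n, x k * Ψ k z
    with hf
  have hfd : Differentiable ℂ f := by fun_prop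
  have h2 : ‖circleRestrict (R + 1) f hfd.continuous‖ < ε / (R + 1) := h1
  have h3 := norm_sq_circleRestrict (R + 1) f hfd.continuous
  have h4 := norm_sq_le_circleAverage hfd hR (mem_closedBall_zero_iff.mp hz)
  rw [dist_eq_norm]
  change ‖f z‖ < ε
  -- The factor `2π ≥ 1` can be dropped here.
  have h5 : Real.circleAverage (fun z => ‖f z‖ ^ 2) 0 (R + 1) ≤
      ‖circleRestrict (R + 1) f hfd.continuous‖ ^ 2 := by
    rw [h3]
    have : 0 ≤ Real.circleAverage (fun z => ‖f z‖ ^ 2) 0 (R + 1) :=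
      Real.circleAverage_nonneg_of_nonneg fun z _ => by positivity
    nlinarith [Real.pi_gt_three]
  have h6 : ‖circleRestrict (R + 1) f hfd.continuous‖ ^ 2 < (ε / (R + 1)) ^ 2 := by gcongr
  refine lt_of_pow_lt_pow_left₀ 2 hε.le ?_
  calc ‖f z‖ ^ 2 ≤ (R + 1) * Real.circleAverage (fun z => ‖f z‖ ^ 2) 0 (R + 1) := h4
    _ ≤ (R + 1) * ‖circleRestrict (R + 1) f hfd.continuous‖ ^ 2 := by gcongr
    _ < (R + 1) * (ε / (R + 1)) ^ 2 := by gcongr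
    _ = ε ^ 2 / (R + 1) := by field_simp
    _ ≤ ε ^ 2 := div_le_self (by positivity) (by linarith)

/-- The Hilbert space convergence theorem is applied in `L²` of a circle, for countably many radii,
and each disc inherits uniform convergence from a larger circle. -/
theorem ae_seqConverges {Ψ : ℕ → ℂ → ℂ} (hΨ : IsGAFCoeff Ψ) :
    ∀ᵐ x ∂seqLaw, SeqConverges Ψ x := by
  have h : ∀ R : ℕ, ∀ᵐ x ∂seqLaw, CauchySeq (fun n => ∑ k ∈ Finset.range n,
      x k • circleRestrict ((R : ℝ) + 1) (Ψ k) (hΨ.1 k).continuous) := by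
    intro R
    refine ae_cauchySeq_sum_smul_seqLaw _ ?_
    simp_rw [norm_sq_circleRestrict]
    exact (hΨ.summable_circleAverage _).mul_left _
  filter_upwards [ae_all_iff.mpr h] with x hx
  have hu := fun R : ℕ =>
    uniformCauchySeqOn_of_cauchySeq_circleRestrict hΨ.1 (Nat.cast_nonneg R) (hx R)
  have hmem : ∀ z : ℂ, z ∈ Metric.ball (0 : ℂ) (⌊‖z‖⌋₊ + 1 : ℕ) := fun z => by
    rw [mem_ball_zero_iff]; exact_mod_cast Nat.lt_floor_add_one ‖z‖
  have hp : ∀ z, ∃ y, Tendsto (fun n => ∑ k ∈ Finset.range n, x k * Ψ k z) atTop (𝓝 y) := fun z =>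
    cauchySeq_tendsto_of_complete ((hu _).cauchySeq (Metric.ball_subset_closedBall (hmem z)))
  choose F hF using hp
  refine ⟨F, tendstoLocallyUniformlyOn_of_forall_exists_nhds fun z _ => ?_⟩
  exact ⟨Metric.ball (0 : ℂ) (⌊‖z‖⌋₊ + 1 : ℕ),
    mem_nhdsWithin_of_mem_nhds (Metric.isOpen_ball.mem_nhds (hmem z)),
    ((hu _).tendstoUniformlyOn_of_tendsto fun z _ => hF z).mono Metric.ball_subset_closedBall⟩

end BargmannNoise

/-! ### Gaussian laws of the values and their logarithmic moments. -/

namespace BargmannNoise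

/-- `Re(zw)` is a centred real Gaussian of variance `‖w‖²/2`, whence the constant `1/4`. -/
theorem charFun_stdComplexGaussian (w : ℂ) :
    ∫ z, Complex.exp (((z * w).re : ℂ) * Complex.I) ∂stdComplexGaussian =
      Complex.exp (-(‖w‖ ^ 2 : ℝ) / 4) := by
  have h2 : ((√2 : ℝ) : ℂ) ^ 2 = 2 := by
    rw [← Complex.ofReal_pow, Real.sq_sqrt (by norm_num)]; simp
  have h20 : ((√2 : ℝ) : ℂ) ≠ 0 := by simp
  rw [stdComplexGaussian, integral_map (by fun_prop) (by fun_prop)]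
  have e : ∀ p : ℝ × ℝ,
      Complex.exp (((((p.1 : ℂ) + (p.2 : ℂ) * Complex.I) / ((√2 : ℝ) : ℂ) * w).re : ℂ) * Complex.I) =
      Complex.exp (((w.re / √2 : ℝ) : ℂ) * p.1 * Complex.I) *
        Complex.exp (((-w.im / √2 : ℝ) : ℂ) * p.2 * Complex.I) := by
    intro p
    rw [← Complex.exp_add]
    congr 1
    have : (((p.1 : ℂ) + (p.2 : ℂ) * Complex.I) / ((√2 : ℝ) : ℂ) * w).re =
        (w.re / √2) * p.1 + (-w.im / √2) * p.2 := by
      rw [div_mul_eq_mul_div, Complex.div_ofReal_re, Complex.mul_re]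
      simp
      ring
    rw [this]
    push_cast
    ring
  simp_rw [e]
  rw [integral_prod_mul (fun x : ℝ => Complex.exp (((w.re / √2 : ℝ) : ℂ) * x * Complex.I))
    (fun x : ℝ => Complex.exp (((-w.im / √2 : ℝ) : ℂ) * x * Complex.I)), ← charFun_apply_real,
    ← charFun_apply_real, charFun_gaussianReal, charFun_gaussianReal, ← Complex.exp_add]
  congr 1
  rw [← Complex.normSq_eq_norm_sq, Complex.normSq_apply]
  push_cast
  rw [div_pow, div_pow, h2]
  ring

theorem integral_exp_sum_seqLaw (w : ℕ → ℂ) (n : ℕ) :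
    ∫ x : ℕ → ℂ, Complex.exp (((∑ k ∈ Finset.range n, x k * w k).re : ℂ) * Complex.I) ∂seqLaw =
      Complex.exp (-((∑ k ∈ Finset.range n, ‖w k‖ ^ 2 : ℝ) : ℂ) / 4) := by
  have hi : iIndepFun (fun (k : Fin n) (x : ℕ → ℂ) => x k) seqLaw :=
    iIndepFun_eval_seqLaw.precomp Fin.val_injective
  have h := iIndepFun.integral_fun_prod_comp (ι := Fin n) hi
    (f := fun k z => Complex.exp (((z * w k).re : ℂ) * Complex.I))
    (fun k => (measurable_pi_apply (k : ℕ)).aemeasurable) (fun k => by fun_prop)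
  have e : ∀ x : ℕ → ℂ, Complex.exp (((∑ k ∈ Finset.range n, x k * w k).re : ℂ) * Complex.I) =
      ∏ k : Fin n, Complex.exp (((x k * w k).re : ℂ) * Complex.I) := by
    intro x
    rw [← Complex.exp_sum, ← Finset.sum_mul, Finset.sum_range, Complex.re_sum]
    push_cast
    rfl
  simp_rw [e]
  rw [h]
  have e2 : ∀ k : ℕ, ∫ x : ℕ → ℂ, Complex.exp (((x k * w k).re : ℂ) * Complex.I) ∂seqLaw =
      Complex.exp (-(‖w k‖ ^ 2 : ℝ) / 4) := by
    intro k
    rw [← charFun_stdComplexGaussian, ← (measurePreserving_eval_seqLaw k).map_eq,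
      integral_map (measurable_pi_apply k).aemeasurable (by fun_prop)]
  simp_rw [e2]
  rw [← Complex.exp_sum, Finset.sum_range]
  congr 1
  push_cast
  rw [← Finset.sum_div, Finset.sum_neg_distrib]

theorem integral_exp_of_tendsto {w : ℕ → ℂ} (hw : Summable (fun k => ‖w k‖ ^ 2))
    {S : (ℕ → ℂ) → ℂ} (hS : ∀ᵐ x ∂seqLaw,
      Tendsto (fun n => ∑ k ∈ Finset.range n, x k * w k) atTop (𝓝 (S x))) :
    ∫ x, Complex.exp (((S x).re : ℂ) * Complex.I) ∂seqLaw =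
      Complex.exp (-((∑' k, ‖w k‖ ^ 2 : ℝ) : ℂ) / 4) := by
  refine tendsto_nhds_unique (tendsto_integral_of_dominated_convergence (fun _ => 1)
    (F := fun n x => Complex.exp (((∑ k ∈ Finset.range n, x k * w k).re : ℂ) * Complex.I))
    (fun n => ?_) (integrable_const 1) (fun n => ae_of_all _ fun x => ?_) ?_) ?_
  · have hm : Measurable fun x : ℕ → ℂ => ∑ k ∈ Finset.range n, x k * w k :=
      Finset.measurable_fun_sum _ fun k _ => (measurable_pi_apply k).mul_const _
    exact Measurable.aestronglyMeasurable (by fun_prop)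
  · rw [Complex.norm_exp_ofReal_mul_I]
  · filter_upwards [hS] with x hx
    have hc : Continuous fun z : ℂ => Complex.exp ((z.re : ℂ) * Complex.I) := by fun_prop
    exact (hc.tendsto _).comp hx
  · simp_rw [integral_exp_sum_seqLaw]
    have hc : Continuous fun t : ℝ => Complex.exp (-(t : ℂ) / 4) := by fun_prop
    exact (hc.tendsto _).comp hw.hasSum.tendsto_sum_nat

/-- The covariance kernel `∑_k Ψ_k(z) conj (Ψ_k(w))`. -/
noncomputable def gafKernel (Ψ : ℕ → ℂ → ℂ) (z w : ℂ) : ℂ :=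
  ∑' k, Ψ k z * (starRingEnd ℂ) (Ψ k w)

/-- The variance `∑_k |Ψ_k(z)|²`. -/
noncomputable def gafVar (Ψ : ℕ → ℂ → ℂ) (z : ℂ) : ℝ := ∑' k, ‖Ψ k z‖ ^ 2

theorem gafVar_nonneg (Ψ : ℕ → ℂ → ℂ) (z : ℂ) : 0 ≤ gafVar Ψ z :=
  tsum_nonneg fun k => by positivity

theorem gafKernel_self (Ψ : ℕ → ℂ → ℂ) (z : ℂ) : gafKernel Ψ z z = gafVar Ψ z := by
  rw [gafKernel, gafVar, Complex.ofReal_tsum]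
  congr 1
  funext k
  rw [Complex.mul_conj, Complex.normSq_eq_norm_sq]

theorem summable_mul_conj {u v : ℕ → ℂ} (hu : Summable (fun k => ‖u k‖ ^ 2))
    (hv : Summable (fun k => ‖v k‖ ^ 2)) : Summable (fun k => u k * (starRingEnd ℂ) (v k)) := by
  refine Summable.of_norm_bounded (hu.add hv) fun k => ?_
  rw [norm_mul, RCLike.norm_conj]
  nlinarith [sq_nonneg (‖u k‖ - ‖v k‖), sq_nonneg (‖u k‖), sq_nonneg (‖v k‖)]

theorem IsGAFCoeff.hasSum_kernel {Ψ : ℕ → ℂ → ℂ} (hΨ : IsGAFCoeff Ψ) (z w : ℂ) :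
    HasSum (fun k => Ψ k z * (starRingEnd ℂ) (Ψ k w)) (gafKernel Ψ z w) :=
  (summable_mul_conj (hΨ.summable z) (hΨ.summable w)).hasSum

theorem hasSum_norm_sq_linear_combination {Ψ : ℕ → ℂ → ℂ} (hΨ : IsGAFCoeff Ψ) {ι : Type*}
    (s : Finset ι) (t : ι → ℂ) (z : ι → ℂ) :
    HasSum (fun k => ((‖∑ i ∈ s, Ψ k (z i) * t i‖ ^ 2 : ℝ) : ℂ))
      (∑ i ∈ s, ∑ j ∈ s, gafKernel Ψ (z i) (z j) * (t i * (starRingEnd ℂ) (t j))) := by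
  have h := hasSum_sum (s := s) fun i _ => hasSum_sum (s := s) fun j _ =>
    (hΨ.hasSum_kernel (z i) (z j)).mul_right (t i * (starRingEnd ℂ) (t j))
  refine h.congr_fun fun k => ?_
  rw [← Complex.normSq_eq_norm_sq, ← Complex.mul_conj, map_sum, Finset.sum_mul_sum]
  refine Finset.sum_congr rfl fun i _ => Finset.sum_congr rfl fun j _ => ?_
  rw [map_mul]
  ring

/-- A linear combination of values is the series with coefficients `∑_i Ψ_k(z_i) t_i`, whose
variance is a quadratic form in the kernel. Consequently all finite-dimensional laws depend only on
`gafKernel`. -/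
theorem integral_exp_seqGaf {Ψ : ℕ → ℂ → ℂ} (hΨ : IsGAFCoeff Ψ) {ι : Type*}
    (s : Finset ι) (t : ι → ℂ) (z : ι → ℂ) :
    ∫ x, Complex.exp (((∑ i ∈ s, seqGaf Ψ x (z i) * t i).re : ℂ) * Complex.I) ∂seqLaw =
      Complex.exp
        (-(∑ i ∈ s, ∑ j ∈ s, gafKernel Ψ (z i) (z j) * (t i * (starRingEnd ℂ) (t j))) / 4) := by
  have hs := hasSum_norm_sq_linear_combination hΨ s t z
  rw [← hs.tsum_eq, ← Complex.ofReal_tsum]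
  refine integral_exp_of_tendsto (w := fun k => ∑ i ∈ s, Ψ k (z i) * t i)
    (Complex.hasSum_iff _ _ |>.1 hs).1.summable ?_
  filter_upwards [ae_seqConverges hΨ] with x hx
  have h := tendsto_finsetSum s fun i _ => (hx.tendsto (z i)).mul_const (t i)
  refine h.congr fun n => ?_
  simp_rw [Finset.sum_mul, Finset.mul_sum]
  rw [Finset.sum_comm]
  refine Finset.sum_congr rfl fun k _ => Finset.sum_congr rfl fun i _ => by ring

theorem aemeasurable_seqGaf {Ψ : ℕ → ℂ → ℂ} (hΨ : IsGAFCoeff Ψ) (z : ℂ) :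
    AEMeasurable (fun x => seqGaf Ψ x z) seqLaw := by
  refine aemeasurable_of_tendsto_metrizable_ae atTop
    (f := fun n x => ∑ k ∈ Finset.range n, x k * Ψ k z) (fun n => Measurable.aemeasurable
      (Finset.measurable_fun_sum _ fun k _ => (measurable_pi_apply k).mul_const _)) ?_
  filter_upwards [ae_seqConverges hΨ] with x hx using hx.tendsto z

/-- The value at `z` of a Gaussian analytic function is a complex Gaussian variable. -/
theorem map_seqGaf {Ψ : ℕ → ℂ → ℂ} (hΨ : IsGAFCoeff Ψ) (z : ℂ) :
    seqLaw.map (fun x => seqGaf Ψ x z) =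
      stdComplexGaussian.map (fun ζ => ((√(gafVar Ψ z) : ℝ) : ℂ) * ζ) := by
  have hm := aemeasurable_seqGaf hΨ z
  have := Measure.isProbabilityMeasure_map hm
  have : IsProbabilityMeasure (stdComplexGaussian.map (fun ζ => ((√(gafVar Ψ z) : ℝ) : ℂ) * ζ)) :=
    Measure.isProbabilityMeasure_map (by fun_prop)
  refine Measure.ext_of_charFun (funext fun t => ?_)
  rw [charFun_apply, charFun_apply, integral_map hm (by fun_prop),
    integral_map (by fun_prop) (by fun_prop)]
  have h1 := integral_exp_seqGaf hΨ {0} (fun _ : ℕ => (starRingEnd ℂ) t) (fun _ => z)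
  have h2 := charFun_stdComplexGaussian (((√(gafVar Ψ z) : ℝ) : ℂ) * (starRingEnd ℂ) t)
  simp only [Finset.sum_singleton] at h1
  have e1 : ∀ x : ℂ, inner ℝ x t = (x * (starRingEnd ℂ) t).re := fun x => by
    rw [Complex.inner, ← Complex.conj_re, map_mul, Complex.conj_conj, mul_comm]
  simp_rw [e1]
  rw [h1]
  simp_rw [fun x : ℂ => show ((√(gafVar Ψ z) : ℝ) : ℂ) * x * (starRingEnd ℂ) t =
    x * (((√(gafVar Ψ z) : ℝ) : ℂ) * (starRingEnd ℂ) t) by ring]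
  rw [h2, gafKernel_self, norm_mul, mul_pow, Complex.norm_real, RCLike.norm_conj,
    Real.norm_of_nonneg (Real.sqrt_nonneg _), Real.sq_sqrt (gafVar_nonneg _ _), Complex.conj_conj,
    mul_comm ((starRingEnd ℂ) t), Complex.mul_conj, Complex.normSq_eq_norm_sq]
  push_cast
  rfl

/-- Used twice: the value at a point of positive variance is almost surely nonzero, and Lebesgue
null sets of critical values are avoided. -/
theorem stdComplexGaussian_absolutelyContinuous : stdComplexGaussian ≪ volume := by
  have h1 : (gaussianReal 0 1).prod (gaussianReal 0 1) ≪ (volume : Measure (ℝ × ℝ)) :=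
    (gaussianReal_absolutelyContinuous 0 one_ne_zero).prod
      (gaussianReal_absolutelyContinuous 0 one_ne_zero)
  have h2 := h1.map (f := Complex.measurableEquivRealProd.symm) (by fun_prop)
  rw [Complex.volume_preserving_equiv_real_prod.symm.map_eq] at h2
  have h3 := h2.map (f := fun z : ℂ => ((√2 : ℝ) : ℂ)⁻¹ * z) (by fun_prop)
  rw [Measure.map_map (by fun_prop) (by fun_prop)] at h3
  have h4 : (volume : Measure ℂ).map (fun z : ℂ => ((√2 : ℝ) : ℂ)⁻¹ * z) ≪ volume := by
    have := Measure.map_addHaar_smul (volume : Measure ℂ) (r := (√2)⁻¹) (by simp)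
    have e : (fun z : ℂ => ((√2 : ℝ) : ℂ)⁻¹ * z) = ((√2)⁻¹ • · : ℂ → ℂ) := by
      funext z; simp
    rw [e, this]
    exact Measure.smul_absolutelyContinuous
  convert h3.trans h4 using 2
  rw [stdComplexGaussian]
  congr 1
  funext p
  have : Complex.measurableEquivRealProd.symm p = (p.1 : ℂ) + (p.2 : ℂ) * Complex.I :=
    Complex.mk_eq_add_mul_I _ _
  rw [Function.comp_apply, this, div_eq_inv_mul]

theorem gaussianReal_le_smul_volume :
    ∃ C : ENNReal, C ≠ ⊤ ∧ gaussianReal 0 1 ≤ C • (volume : Measure ℝ) := by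
  refine ⟨ENNReal.ofReal ((√(2 * Real.pi * 1))⁻¹), ENNReal.ofReal_ne_top, ?_⟩
  rw [gaussianReal_of_var_ne_zero _ one_ne_zero, ← withDensity_const]
  refine withDensity_mono (ae_of_all _ fun x => ENNReal.ofReal_le_ofReal ?_)
  rw [gaussianPDFReal]
  simp only [NNReal.coe_one]
  refine mul_le_of_le_one_right (by positivity) (Real.exp_le_one_iff.mpr ?_)
  rw [neg_div]
  have : 0 ≤ (x - 0) ^ 2 / (2 * 1) := by positivity
  linarith

/-- Near zero the Gaussian density is bounded and `log` is Lebesgue integrable; away from zero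
`|log|x|| ≤ |x|`. -/
theorem integrable_log_gaussianReal : Integrable Real.log (gaussianReal 0 1) := by
  obtain ⟨C, hC, hle⟩ := gaussianReal_le_smul_volume
  have h1 : Integrable ((Set.Icc (-1 : ℝ) 1).indicator Real.log) (gaussianReal 0 1) := by
    refine Integrable.mono_measure (Integrable.smul_measure ?_ hC) hle
    rw [integrable_indicator_iff measurableSet_Icc, integrableOn_Icc_iff_integrableOn_Ioc,
      ← intervalIntegrable_iff_integrableOn_Ioc_of_le (by norm_num)]
    exact intervalIntegral.intervalIntegrable_log'
  have h2 : Integrable (fun x : ℝ => x) (gaussianReal 0 1) :=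
    (memLp_id_gaussianReal' 1 (by simp)).integrable le_rfl
  refine (h1.norm.add h2.norm).mono' Real.measurable_log.aestronglyMeasurable
    (ae_of_all _ fun x => ?_)
  simp only [Pi.add_apply]
  by_cases hx : x ∈ Set.Icc (-1 : ℝ) 1
  · rw [Set.indicator_of_mem hx]
    have := norm_nonneg x
    linarith
  · have hx1 : 1 ≤ |x| := by
      by_contra h
      push Not at h
      exact hx ⟨by linarith [neg_abs_le x], by linarith [le_abs_self x]⟩
    rw [Set.indicator_of_notMem hx, norm_zero, zero_add, ← Real.log_abs, Real.norm_eq_abs,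
      abs_of_nonneg (Real.log_nonneg hx1), Real.norm_eq_abs]
    exact (Real.log_le_sub_one_of_pos (by linarith)).trans (by linarith)

theorem measurable_log_norm : Measurable fun z : ℂ => Real.log ‖z‖ :=
  Real.measurable_log.comp measurable_norm

/-- `log|ζ|` lies between `log|X| - log √2`, with `X` the first real Gaussian coordinate, and `|ζ|`.
-/
theorem integrable_log_norm_stdComplexGaussian :
    Integrable (fun z : ℂ => Real.log ‖z‖) stdComplexGaussian := by
  have hid : Integrable (fun z : ℂ => z) stdComplexGaussian :=
    memLp_id_stdComplexGaussian.integrable (by norm_num)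
  have hm := measurable_stdComplexGaussian_map
  rw [stdComplexGaussian, integrable_map_measure (by fun_prop) (by fun_prop)] at hid
  rw [stdComplexGaussian, integrable_map_measure measurable_log_norm.aestronglyMeasurable
    (by fun_prop)]
  have h1 : Integrable (fun p : ℝ × ℝ => Real.log p.1)
      ((gaussianReal 0 1).prod (gaussianReal 0 1)) :=
    measurePreserving_fst.integrable_comp_of_integrable integrable_log_gaussianReal
  have h0 : ∀ᵐ p : ℝ × ℝ ∂((gaussianReal 0 1).prod (gaussianReal 0 1)), p.1 ≠ 0 := by
    have : ∀ᵐ x : ℝ ∂(gaussianReal 0 1), x ≠ 0 :=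
      (gaussianReal_absolutelyContinuous 0 one_ne_zero).ae_le
        (compl_mem_ae_iff.mpr (measure_singleton 0))
    exact measurePreserving_fst.quasiMeasurePreserving.ae this
  refine ((h1.norm.add hid.norm).add (integrable_const (Real.log √2))).mono'
    (measurable_log_norm.comp hm).aestronglyMeasurable ?_
  filter_upwards [h0] with p hp
  simp only [Pi.add_apply, Function.comp_apply]
  set z : ℂ := ((p.1 : ℂ) + (p.2 : ℂ) * Complex.I) / ((√2 : ℝ) : ℂ) with hz
  have hzp : |p.1| / √2 ≤ ‖z‖ := by
    have h := Complex.abs_re_le_norm z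
    rw [hz, Complex.div_ofReal_re, abs_div, abs_of_nonneg (Real.sqrt_nonneg 2)] at h
    simpa [hz] using h
  have hp1 : 0 < |p.1| := abs_pos.mpr hp
  have hl := Real.log_le_log (by positivity) hzp
  rw [Real.log_div hp1.ne' (by simp), Real.log_abs] at hl
  have hu := Real.log_le_sub_one_of_pos (lt_of_lt_of_le (by positivity) hzp)
  have h2 : 0 ≤ Real.log √2 := Real.log_nonneg (by rw [Real.one_le_sqrt]; norm_num)
  have h3 := neg_abs_le (Real.log p.1)
  have h4 := abs_nonneg (Real.log p.1)
  have h5 := norm_nonneg z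
  rw [Real.norm_eq_abs, Real.norm_eq_abs, abs_le]
  constructor <;> linarith

theorem ae_ne_zero_stdComplexGaussian : ∀ᵐ z ∂stdComplexGaussian, z ≠ 0 :=
  stdComplexGaussian_absolutelyContinuous.ae_le (compl_mem_ae_iff.mpr (measure_singleton 0))

theorem ae_seqGaf_ne_zero {Ψ : ℕ → ℂ → ℂ} (hΨ : IsGAFCoeff Ψ) {z : ℂ} (hz : gafVar Ψ z ≠ 0) :
    ∀ᵐ x ∂seqLaw, seqGaf Ψ x z ≠ 0 := by
  have h : ∀ᵐ y ∂(seqLaw.map (fun x => seqGaf Ψ x z)), y ≠ 0 := by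
    rw [map_seqGaf hΨ, ae_map_iff (f := fun ζ => ((√(gafVar Ψ z) : ℝ) : ℂ) * ζ)
      (p := fun y => y ≠ 0) (by fun_prop) (measurableSet_singleton (0 : ℂ)).compl]
    filter_upwards [ae_ne_zero_stdComplexGaussian] with ζ hζ
    simp [hζ, Real.sqrt_ne_zero (gafVar_nonneg Ψ z), hz]
  exact ae_of_ae_map (aemeasurable_seqGaf hΨ z) h

/-- The value is `√(variance)` times a standard Gaussian `ζ`. The constant `E log|ζ|` does not
depend on the point and cancels in Jensen's formula. The bound on the absolute moment serves
Fubini's theorem on a circle. -/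
theorem integrable_log_norm_seqGaf {Ψ : ℕ → ℂ → ℂ} (hΨ : IsGAFCoeff Ψ) {z : ℂ}
    (hz : gafVar Ψ z ≠ 0) :
    Integrable (fun x => Real.log ‖seqGaf Ψ x z‖) seqLaw ∧
      ∫ x, Real.log ‖seqGaf Ψ x z‖ ∂seqLaw =
        Real.log (gafVar Ψ z) / 2 + ∫ ζ, Real.log ‖ζ‖ ∂stdComplexGaussian ∧
      ∫ x, |Real.log ‖seqGaf Ψ x z‖| ∂seqLaw ≤
        |Real.log (gafVar Ψ z)| / 2 + ∫ ζ, |Real.log ‖ζ‖| ∂stdComplexGaussian := by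
  have hm := aemeasurable_seqGaf hΨ z
  have hpos : 0 < gafVar Ψ z := lt_of_le_of_ne (gafVar_nonneg _ _) hz.symm
  have hlog : (fun ζ : ℂ => Real.log ‖((√(gafVar Ψ z) : ℝ) : ℂ) * ζ‖) =ᵐ[stdComplexGaussian]
      fun ζ => Real.log (gafVar Ψ z) / 2 + Real.log ‖ζ‖ := by
    filter_upwards [ae_ne_zero_stdComplexGaussian] with ζ hζ
    rw [norm_mul, Complex.norm_real, Real.norm_of_nonneg (Real.sqrt_nonneg _),
      Real.log_mul (Real.sqrt_ne_zero'.mpr hpos) (norm_ne_zero_iff.mpr hζ), Real.log_sqrt hpos.le]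
  have hint : Integrable (fun ζ : ℂ => Real.log (gafVar Ψ z) / 2 + Real.log ‖ζ‖)
      stdComplexGaussian := (integrable_const _).add integrable_log_norm_stdComplexGaussian
  have hlm : ∀ μ : Measure ℂ, AEStronglyMeasurable (fun y : ℂ => Real.log ‖y‖) μ := fun μ =>
    measurable_log_norm.aestronglyMeasurable
  refine ⟨?_, ?_, ?_⟩
  · change Integrable ((fun y : ℂ => Real.log ‖y‖) ∘ fun x => seqGaf Ψ x z) seqLaw
    rw [← integrable_map_measure (hlm _) hm, map_seqGaf hΨ,
      integrable_map_measure (hlm _) (by fun_prop)]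
    exact hint.congr hlog.symm
  · rw [← integral_map (f := fun y : ℂ => Real.log ‖y‖) hm (hlm _), map_seqGaf hΨ,
      integral_map (by fun_prop) (hlm _), integral_congr_ae hlog,
      integral_add (integrable_const _) integrable_log_norm_stdComplexGaussian]
    simp
  · rw [← integral_map (f := fun y : ℂ => |Real.log ‖y‖|) hm (hlm _).norm, map_seqGaf hΨ,
      integral_map (f := fun y : ℂ => |Real.log ‖y‖|) (by fun_prop) (hlm _).norm,
      integral_congr_ae (g := fun ζ => |Real.log (gafVar Ψ z) / 2 + Real.log ‖ζ‖|)
        (by filter_upwards [hlog] with ζ hζ; rw [hζ])]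
    refine (integral_mono hint.abs ((integrable_const (|Real.log (gafVar Ψ z)| / 2)).add
      integrable_log_norm_stdComplexGaussian.abs) fun ζ => ?_).trans_eq ?_
    · refine (abs_add_le _ _).trans_eq ?_
      rw [abs_div, abs_of_pos (two_pos : (0 : ℝ) < 2)]
      rfl
    · rw [Pi.add_def, integral_add (integrable_const _) integrable_log_norm_stdComplexGaussian.abs]
      simp

end BargmannNoise

namespace BargmannNoise

/-! ### Point measures and zero sets of entire functions -/

theorem lintegral_pointMeasure {S : Set ℂ} {g : ℂ → ENNReal} (hg : Measurable g) :
    ∫⁻ z, g z ∂pointMeasure S = ∑' z : S, g z := by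
  rw [pointMeasure, lintegral_sum_measure]
  simp_rw [lintegral_dirac' _ hg]

theorem pointMeasure_apply (S : Set ℂ) {B : Set ℂ} (hB : MeasurableSet B) :
    pointMeasure S B = ((S ∩ B).encard : ENNReal) := by
  rw [← lintegral_indicator_one hB, lintegral_pointMeasure (measurable_one.indicator hB),
    ← ENNReal.tsum_set_one, tsum_subtype S (B.indicator 1), tsum_subtype (S ∩ B) (fun _ => 1)]
  congr 1
  funext z
  by_cases h1 : z ∈ S <;> by_cases h2 : z ∈ B <;> simp [h1, h2]

theorem pointMeasure_inter (S : Set ℂ) {A : Set ℂ} (hA : MeasurableSet A) :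
    pointMeasure (S ∩ A) = (pointMeasure S).restrict A := by
  ext B hB
  rw [Measure.restrict_apply hB, pointMeasure_apply _ hB, pointMeasure_apply _ (hB.inter hA),
    Set.inter_assoc, Set.inter_comm A B]

/-- The entire functions that do not vanish identically, with the `σ`-algebra generated by the
evaluations. -/
abbrev EntireFun : Type := {f : ℂ → ℂ // Differentiable ℂ f ∧ ∃ z, f z ≠ 0}

/-- The zeros of a function on `ℂ`. -/
def zeroSet (f : ℂ → ℂ) : Set ℂ := {z | f z = 0}

theorem finite_zeroSet_inter {f : ℂ → ℂ} (hf : Differentiable ℂ f) (h0 : ∃ z, f z ≠ 0) {K : Set ℂ}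
    (hK : IsCompact K) : (zeroSet f ∩ K).Finite := by
  obtain ⟨w, hw⟩ := h0
  have h := AnalyticOnNhd.preimage_zero_mem_codiscrete (hf.differentiableOn.analyticOnNhd isOpen_univ)
    hw
  have h2 := hK.finite_sdiff_of_mem_codiscreteWithin (codiscreteWithin_mono (Set.subset_univ K) h)
  refine h2.subset fun z hz => ⟨hz.2, fun h3 => h3 hz.1⟩

theorem countable_zeroSet {f : ℂ → ℂ} (hf : Differentiable ℂ f) (h0 : ∃ z, f z ≠ 0) :
    (zeroSet f).Countable := by
  have : zeroSet f = ⋃ n : ℕ, zeroSet f ∩ Metric.closedBall 0 n := by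
    rw [← Set.inter_iUnion, Metric.iUnion_closedBall_nat, Set.inter_univ]
  rw [this]
  exact Set.countable_iUnion fun n =>
    (finite_zeroSet_inter hf h0 (isCompact_closedBall 0 (n : ℝ))).countable

/-- A countable family of closed discs shrinking to every point. -/
noncomputable def rationalBall (p : ℕ × ℕ) : Set ℂ :=
  Metric.closedBall (TopologicalSpace.denseSeq ℂ p.1) (1 / ((p.2 : ℝ) + 1))

theorem exists_rationalBall {z : ℂ} {V : Set ℂ} (hV : IsOpen V) (hz : z ∈ V) :
    ∃ p, z ∈ rationalBall p ∧ rationalBall p ⊆ V := by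
  obtain ⟨ε, hε, hball⟩ := Metric.isOpen_iff.mp hV z hz
  obtain ⟨n, hn⟩ := exists_nat_one_div_lt (half_pos hε)
  obtain ⟨i, hi⟩ := (TopologicalSpace.denseRange_denseSeq ℂ).exists_dist_lt z
    (Nat.one_div_pos_of_nat (α := ℝ) (n := n))
  refine ⟨(i, n), hi.le, fun w hw => hball ?_⟩
  have hw' : dist w (TopologicalSpace.denseSeq ℂ i) ≤ 1 / ((n : ℝ) + 1) := hw
  have := dist_triangle w (TopologicalSpace.denseSeq ℂ i) z
  rw [dist_comm z] at hi
  rw [Metric.mem_ball]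
  linarith

/-- By compactness the existence of a zero becomes a condition on countably many evaluations, hence
measurable. The target is a general normed group so that the criterion also applies to the pair
formed by a function and its derivative. -/
theorem exists_zero_closedBall_iff {E : Type*} [NormedAddCommGroup E] {f : ℂ → E}
    (hf : Continuous f) (q : ℂ) {r : ℝ} (hr : 0 < r) :
    (∃ z ∈ Metric.closedBall q r, f z = 0) ↔
      ∀ n : ℕ, ∃ i : ℕ, TopologicalSpace.denseSeq ℂ i ∈ Metric.ball q r ∧
        ‖f (TopologicalSpace.denseSeq ℂ i)‖ < 1 / ((n : ℝ) + 1) := by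
  constructor
  · rintro ⟨z, hz, hfz⟩ n
    have hO : IsOpen {w | ‖f w‖ < 1 / ((n : ℝ) + 1)} := isOpen_lt hf.norm continuous_const
    have hzO : z ∈ {w | ‖f w‖ < 1 / ((n : ℝ) + 1)} := by
      change ‖f z‖ < _
      rw [hfz, norm_zero]
      positivity
    rw [← closure_ball q hr.ne', mem_closure_iff] at hz
    obtain ⟨w, hw1, hw2⟩ := hz _ hO hzO
    obtain ⟨i, hi⟩ := (TopologicalSpace.denseRange_denseSeq ℂ).exists_mem_open
      (hO.inter Metric.isOpen_ball) ⟨w, hw1, hw2⟩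
    exact ⟨i, hi.2, hi.1⟩
  · intro h
    obtain ⟨z, hz, hmin⟩ := (isCompact_closedBall q r).exists_isMinOn
      (Metric.nonempty_closedBall.mpr hr.le) hf.norm.continuousOn
    refine ⟨z, hz, ?_⟩
    by_contra hne
    obtain ⟨n, hn⟩ := exists_nat_one_div_lt (norm_pos_iff.mpr hne)
    obtain ⟨i, hi1, hi2⟩ := h n
    have := hmin (Metric.ball_subset_closedBall hi1)
    simp only [Set.mem_ofPred_eq] at this
    linarith

theorem measurable_eval_entireFun (z : ℂ) : Measurable fun f : EntireFun => f.1 z :=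
  (measurable_pi_apply z).comp measurable_subtype_coe

/-- The event that an entire function has a zero in a disc. -/
def zeroHits (p : ℕ × ℕ) : Set EntireFun := {f | ∃ z ∈ rationalBall p, f.1 z = 0}

theorem measurableSet_zeroHits (p : ℕ × ℕ) : MeasurableSet (zeroHits p) := by
  have : zeroHits p = ⋂ n : ℕ, ⋃ i : ℕ, {f : EntireFun |
      TopologicalSpace.denseSeq ℂ i ∈ Metric.ball (TopologicalSpace.denseSeq ℂ p.1)
        (1 / ((p.2 : ℝ) + 1)) ∧ ‖f.1 (TopologicalSpace.denseSeq ℂ i)‖ < 1 / ((n : ℝ) + 1)} := by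
    ext f
    simp only [Set.mem_iInter, Set.mem_iUnion]
    exact exists_zero_closedBall_iff f.2.1.continuous _ Nat.one_div_pos_of_nat
  rw [this]
  refine MeasurableSet.iInter fun n => MeasurableSet.iUnion fun i => ?_
  exact (MeasurableSet.const _).inter
    (measurableSet_lt (measurable_eval_entireFun _).norm measurable_const)

/-- The event that an entire function has a zero in each of a finite family of disjoint discs
contained in `U`. -/
def zeroHitsAll (U : Set ℂ) (s : Finset (ℕ × ℕ)) : Set EntireFun :=
  {f | (s : Set (ℕ × ℕ)).PairwiseDisjoint rationalBall ∧ ∀ p ∈ s, rationalBall p ⊆ U ∧ f ∈ zeroHits p}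

theorem measurableSet_zeroHitsAll (U : Set ℂ) (s : Finset (ℕ × ℕ)) :
    MeasurableSet (zeroHitsAll U s) := by
  have : zeroHitsAll U s =
      {f : EntireFun | (s : Set (ℕ × ℕ)).PairwiseDisjoint rationalBall} ∩
        ⋂ p ∈ s, {f : EntireFun | rationalBall p ⊆ U} ∩ zeroHits p := by
    ext f
    simp only [zeroHitsAll, Set.mem_inter_iff, Set.mem_iInter, Set.mem_ofPred_eq]
  rw [this]
  refine (MeasurableSet.const _).inter ?_
  exact Finset.measurableSet_biInter s fun p _ =>
    (MeasurableSet.const _).inter (measurableSet_zeroHits p)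

theorem card_le_encard_of_mem_zeroHitsAll {U : Set ℂ} {s : Finset (ℕ × ℕ)} {f : EntireFun}
    (h : f ∈ zeroHitsAll U s) : (s.card : ℕ∞) ≤ (zeroSet f.1 ∩ U).encard := by
  classical
  obtain ⟨hd, hs⟩ := h
  have hs' : ∀ p : s, ∃ z ∈ rationalBall p, f.1 z = 0 := fun p => (hs p p.2).2
  choose z hz hfz using hs'
  have hinj : Function.Injective z := by
    intro p q hpq
    by_contra hne
    have := hd p.2 q.2 (fun h => hne (Subtype.ext h))
    exact Set.disjoint_left.mp this (hz p) (hpq ▸ hz q)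
  have h1 : (s.card : ℕ∞) = (Set.range z).encard := by
    rw [← Set.image_univ, hinj.encard_image, Set.encard_univ]
    simp
  rw [h1]
  refine Set.encard_le_encard ?_
  rintro _ ⟨p, rfl⟩
  exact ⟨hfz p, (hs p p.2).1 (hz p)⟩

theorem exists_mem_zeroHitsAll {U : Set ℂ} (hU : IsOpen U) {f : EntireFun} {t : Finset ℂ}
    (ht : (t : Set ℂ) ⊆ zeroSet f.1 ∩ U) : ∃ s, f ∈ zeroHitsAll U s ∧ s.card = t.card := by
  classical
  obtain ⟨V, hV, hdisj⟩ := t.finite_toSet.t2_separation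
  have hp : ∀ z : t, ∃ p, (z : ℂ) ∈ rationalBall p ∧ rationalBall p ⊆ V z ∩ U := fun z =>
    exists_rationalBall ((hV z).2.inter hU) ⟨(hV z).1, (ht z.2).2⟩
  choose p hp1 hp2 using hp
  have hinj : Function.Injective p := by
    intro z w hzw
    by_contra hne
    have h2 := hdisj z.2 w.2 (fun h => hne (Subtype.ext h))
    exact Set.disjoint_left.mp h2 (hp2 z (hp1 z)).1 (hp2 w (hzw ▸ hp1 z)).1
  refine ⟨t.attach.image p, ⟨?_, ?_⟩, ?_⟩
  · intro a ha b hb hab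
    simp only [Finset.coe_image, Set.mem_image] at ha hb
    obtain ⟨z, _, rfl⟩ := ha
    obtain ⟨w, _, rfl⟩ := hb
    have hzw : (z : ℂ) ≠ w := fun h => hab (by rw [Subtype.ext h])
    exact (hdisj z.2 w.2 hzw).mono (fun _ hx => (hp2 z hx).1) (fun _ hx => (hp2 w hx).1)
  · intro a ha
    simp only [Finset.mem_image] at ha
    obtain ⟨z, _, rfl⟩ := ha
    exact ⟨fun _ hx => (hp2 z hx).2, z, hp1 z, (ht z.2).1⟩
  · rw [Finset.card_image_of_injective _ hinj, Finset.card_attach]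

/-- Finitely many distinct zeros in `U` can be separated by disjoint discs of the countable family
contained in `U`. So the number of zeros is the supremum over countably many measurable events. -/
theorem pointMeasure_zeroSet_open {U : Set ℂ} (hU : IsOpen U) (f : EntireFun) :
    pointMeasure (zeroSet f.1) U =
      ⨆ s : Finset (ℕ × ℕ), (zeroHitsAll U s).indicator (fun _ => (s.card : ENNReal)) f := by
  rw [pointMeasure_apply _ hU.measurableSet]
  apply le_antisymm
  · have key : ∀ m : ℕ, (m : ℕ∞) ≤ (zeroSet f.1 ∩ U).encard → (m : ENNReal) ≤
        ⨆ s : Finset (ℕ × ℕ), (zeroHitsAll U s).indicator (fun _ => (s.card : ENNReal)) f := by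
      intro m hm
      obtain ⟨t, ht, htm⟩ := Set.exists_subset_encard_eq hm
      have hfin : t.Finite := Set.finite_of_encard_eq_coe htm
      obtain ⟨s, hs, hc⟩ := exists_mem_zeroHitsAll hU (t := hfin.toFinset) (f := f) (by rwa [hfin.coe_toFinset])
      have hcard : s.card = m := by
        rw [hc]
        rw [hfin.encard_eq_coe_toFinset_card] at htm
        exact_mod_cast htm
      refine le_trans ?_ (le_iSup _ s)
      rw [Set.indicator_of_mem hs, hcard]
    by_cases hfin : (zeroSet f.1 ∩ U).Finite
    · rw [hfin.encard_eq_coe_toFinset_card]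
      exact key _ hfin.encard_eq_coe_toFinset_card.ge
    · have htop : (zeroSet f.1 ∩ U).encard = ⊤ := Set.encard_eq_top hfin
      rw [ENNReal.eq_top_of_forall_nnreal_le (x := ⨆ s : Finset (ℕ × ℕ),
        (zeroHitsAll U s).indicator (fun _ => (s.card : ENNReal)) f)]
      · exact le_top
      · intro r
        obtain ⟨m, hm⟩ := exists_nat_ge r
        refine le_trans ?_ (key m (by rw [htop]; exact le_top))
        exact_mod_cast hm
  · refine iSup_le fun s => ?_
    by_cases h : f ∈ zeroHitsAll U s
    · rw [Set.indicator_of_mem h]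
      exact_mod_cast card_le_encard_of_mem_zeroHitsAll h
    · rw [Set.indicator_of_notMem h]
      exact zero_le

theorem pointMeasure_zeroSet_lt_top (f : EntireFun) {K B : Set ℂ} (hK : IsCompact K)
    (hB : MeasurableSet B) (hBK : B ⊆ K) : pointMeasure (zeroSet f.1) B < ⊤ := by
  rw [pointMeasure_apply _ hB]
  have := ((finite_zeroSet_inter f.2.1 f.2.2 hK).subset (Set.inter_subset_inter_right _ hBK))
  rw [← this.cast_ncard_eq]
  exact ENNReal.coe_lt_top

/-- The zero set of a random entire function, as a random measure, is measurable. -/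
theorem measurable_pointMeasure_zeroSet :
    Measurable fun f : EntireFun => pointMeasure (zeroSet f.1) := by
  have hopen : ∀ U : Set ℂ, IsOpen U → Measurable fun f : EntireFun => pointMeasure (zeroSet f.1) U := by
    intro U hU
    simp_rw [pointMeasure_zeroSet_open hU]
    exact Measurable.iSup fun s => measurable_const.indicator (measurableSet_zeroHitsAll U s)
  -- The extension from open sets to Borel sets by a π-system needs finite measures. Restricting to
  -- balls provides them, as zeros do not accumulate.
  have hres : ∀ n : ℕ, Measurable fun f : EntireFun =>
      (pointMeasure (zeroSet f.1)).restrict (Metric.ball 0 n) := by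
    intro n
    have : ∀ f : EntireFun, IsFiniteMeasure ((pointMeasure (zeroSet f.1)).restrict
        (Metric.ball 0 n)) := fun f => ⟨by
      rw [Measure.restrict_apply_univ]
      exact pointMeasure_zeroSet_lt_top f (isCompact_closedBall 0 (n : ℝ)) measurableSet_ball
        Metric.ball_subset_closedBall⟩
    refine Measurable.measure_of_isPiSystem BorelSpace.measurable_eq
      isPiSystem_isOpen (fun U hU => ?_) ?_
    · have hU' : IsOpen U := hU
      simp_rw [Measure.restrict_apply hU'.measurableSet]
      exact hopen _ (hU'.inter Metric.isOpen_ball)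
    · simp_rw [Measure.restrict_apply_univ]
      exact hopen _ Metric.isOpen_ball
  refine Measure.measurable_of_measurable_coe _ fun B hB => ?_
  have h : ∀ f : EntireFun, pointMeasure (zeroSet f.1) B =
      ⨆ n : ℕ, (pointMeasure (zeroSet f.1)).restrict (Metric.ball 0 n) B := by
    intro f
    simp_rw [Measure.restrict_apply hB]
    rw [← Monotone.measure_iUnion, ← Set.inter_iUnion, Metric.iUnion_ball_nat, Set.inter_univ]
    exact fun m n hmn => Set.inter_subset_inter_right _ (Metric.ball_subset_ball (by exact_mod_cast hmn))
  simp_rw [h]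
  exact Measurable.iSup fun n => (Measure.measurable_coe hB).comp (hres n)

theorem measurable_restrict_measure {A : Set ℂ} (hA : MeasurableSet A) :
    Measurable fun μ : Measure ℂ => μ.restrict A := by
  refine Measure.measurable_of_measurable_coe _ fun B hB => ?_
  simp_rw [Measure.restrict_apply hB]
  exact Measure.measurable_coe (hB.inter hA)

end BargmannNoise

namespace BargmannNoise

/-! ### Laws of Gaussian analytic functions and of their random zeros -/

theorem IsGAFCoeff.gafVar_eq_zero_iff {Ψ : ℕ → ℂ → ℂ} (hΨ : IsGAFCoeff Ψ) (z : ℂ) :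
    gafVar Ψ z = 0 ↔ ∀ k, Ψ k z = 0 := by
  rw [gafVar, (hΨ.summable z).hasSum.tsum_eq, ← (hΨ.summable z).hasSum_iff,
    hasSum_zero_iff_of_nonneg fun k => by positivity]
  simp [funext_iff]

theorem seqGaf_eq_zero {Ψ : ℕ → ℂ → ℂ} {z : ℂ} (h : ∀ k, Ψ k z = 0) (x : ℕ → ℂ) :
    seqGaf Ψ x z = 0 := by
  simp only [seqGaf, gaf, h, mul_zero, Finset.sum_const_zero]
  exact tendsto_const_nhds.limUnder_eq

/-- The random zeros of the Gaussian analytic function with coefficient functions `Ψ`, as a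
function of its coefficients. -/
def seqZeros (Ψ : ℕ → ℂ → ℂ) (x : ℕ → ℂ) : Set ℂ :=
  zeroSet (seqGaf Ψ x) ∩ {z | gafVar Ψ z ≠ 0}

/-- A point is an almost sure zero exactly when the variance vanishes there. The set of removed
points is therefore deterministic and read off the kernel, and it is the same on every probability
space. -/
theorem randomZeros_gaf {Ω : Type*} [MeasurableSpace Ω] {Q : Measure Ω} [IsProbabilityMeasure Q]
    {c : ℕ → Ω → ℂ} (hc : IsIIDStdComplexGaussian c Q) {Ψ : ℕ → ℂ → ℂ} (hΨ : IsGAFCoeff Ψ)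
    (ω : Ω) : randomZeros Q (gaf Ψ c) ω = seqZeros Ψ (fun k => c k ω) := by
  ext z
  refine and_congr Iff.rfl (not_congr ⟨fun h => ?_, fun h => ?_⟩)
  · by_contra hz
    have h2 : ∀ᵐ ω ∂Q, seqGaf Ψ (fun k => c k ω) z ≠ 0 := by
      refine ae_of_ae_map (p := fun x => seqGaf Ψ x z ≠ 0) hc.aemeasurable ?_
      rw [hc.map_eq]
      exact ae_seqGaf_ne_zero hΨ hz
    obtain ⟨ω', h3, h4⟩ := (h.and h2).exists
    exact h4 h3
  · exact ae_of_all _ fun ω' => seqGaf_eq_zero ((hΨ.gafVar_eq_zero_iff z).mp h) _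

theorem measurableSet_gafVar_ne_zero {Ψ : ℕ → ℂ → ℂ} (hΨ : IsGAFCoeff Ψ) :
    MeasurableSet {z | gafVar Ψ z ≠ 0} := by
  have : {z | gafVar Ψ z ≠ 0} = ⋃ k, {z | Ψ k z ≠ 0} := by
    ext z
    simp [hΨ.gafVar_eq_zero_iff]
  rw [this]
  exact (isOpen_iUnion fun k => isOpen_ne_fun (hΨ.1 k).continuous continuous_const).measurableSet

/-- A Gaussian analytic function as a measurable random element of the space of entire functions. -/
theorem exists_entireFun_version {Ψ : ℕ → ℂ → ℂ} (hΨ : IsGAFCoeff Ψ) {w : ℂ}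
    (hw : gafVar Ψ w ≠ 0) :
    ∃ G : (ℕ → ℂ) → EntireFun, Measurable G ∧
      ∀ᵐ x ∂seqLaw, SeqConverges Ψ x ∧ (G x).1 = seqGaf Ψ x := by
  classical
  have hA : ∀ᵐ x ∂seqLaw, SeqConverges Ψ x ∧ seqGaf Ψ x w ≠ 0 :=
    (ae_seqConverges hΨ).and (ae_seqGaf_ne_zero hΨ hw)
  -- A measurable null set containing all bad samples. There the function is replaced by the
  -- constant `1`, which keeps the values in `EntireFun` and the map measurable.
  set N := toMeasurable seqLaw {x | SeqConverges Ψ x ∧ seqGaf Ψ x w ≠ 0}ᶜ with hN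
  have hNm : MeasurableSet N := measurableSet_toMeasurable _ _
  have hN0 : seqLaw N = 0 := by rw [hN, measure_toMeasurable]; exact hA
  have hgood : ∀ x, x ∉ N → SeqConverges Ψ x ∧ seqGaf Ψ x w ≠ 0 := fun x hx => by
    by_contra h
    exact hx (subset_toMeasurable _ _ h)
  let G : (ℕ → ℂ) → EntireFun := fun x =>
    if hx : x ∈ N then ⟨fun _ => 1, differentiable_const 1, 0, one_ne_zero⟩
    else ⟨seqGaf Ψ x, (hgood x hx).1.differentiable hΨ.1, w, (hgood x hx).2⟩
  have hG1 : ∀ x ∈ N, (G x).1 = fun _ => 1 := fun x hx => by simp [G, hx]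
  have hG2 : ∀ x ∉ N, (G x).1 = seqGaf Ψ x := fun x hx => by simp [G, hx]
  refine ⟨G, ?_, ?_⟩
  · have hm : Measurable fun x => (G x).1 := by
      refine measurable_pi_iff.mpr fun z => ?_
      refine measurable_of_tendsto_metrizable
        (f := fun n x => if x ∈ N then 1 else ∑ k ∈ Finset.range n, x k * Ψ k z)
        (fun n => Measurable.ite hNm measurable_const
          (Finset.measurable_fun_sum _ fun k _ => (measurable_pi_apply k).mul_const _))
        (tendsto_pi_nhds.mpr fun x => ?_)
      by_cases hx : x ∈ N
      · simp [hx, hG1]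
      · simpa [hx, hG2] using (hgood x hx).1.tendsto z
    exact hm.subtype_mk (h := fun x => (G x).2)
  · filter_upwards [measure_eq_zero_iff_ae_notMem.mp hN0] with x hx
    exact ⟨(hgood x hx).1, hG2 x hx⟩

theorem aemeasurable_pointMeasure_seqZeros {Ψ : ℕ → ℂ → ℂ} (hΨ : IsGAFCoeff Ψ) {w : ℂ}
    (hw : gafVar Ψ w ≠ 0) : AEMeasurable (fun x => pointMeasure (seqZeros Ψ x)) seqLaw := by
  obtain ⟨G, hGm, hG⟩ := exists_entireFun_version hΨ hw
  refine ⟨fun x => (pointMeasure (zeroSet (G x).1)).restrict {z | gafVar Ψ z ≠ 0},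
    (measurable_restrict_measure (measurableSet_gafVar_ne_zero hΨ)).comp
      (measurable_pointMeasure_zeroSet.comp hGm), ?_⟩
  filter_upwards [hG] with x hx
  rw [hx.2, seqZeros, pointMeasure_inter _ (measurableSet_gafVar_ne_zero hΨ)]

/-- Equality of finite-dimensional laws, by comparing characteristic functionals on the real dual of
`ℂ^I`. -/
theorem map_restrict_eq_of_kernel_eq {Ψ₁ Ψ₂ : ℕ → ℂ → ℂ} (h₁ : IsGAFCoeff Ψ₁) (h₂ : IsGAFCoeff Ψ₂)
    (hK : ∀ z w, gafKernel Ψ₁ z w = gafKernel Ψ₂ z w) (I : Finset ℂ)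
    {G₁ G₂ : (ℕ → ℂ) → EntireFun} (hm₁ : Measurable G₁) (hm₂ : Measurable G₂)
    (hG₁ : ∀ᵐ x ∂seqLaw, SeqConverges Ψ₁ x ∧ (G₁ x).1 = seqGaf Ψ₁ x)
    (hG₂ : ∀ᵐ x ∂seqLaw, SeqConverges Ψ₂ x ∧ (G₂ x).1 = seqGaf Ψ₂ x) :
    seqLaw.map (fun x (i : I) => (G₁ x).1 i) = seqLaw.map (fun x (i : I) => (G₂ x).1 i) := by
  classical
  have key : ∀ {Ψ : ℕ → ℂ → ℂ} {G : (ℕ → ℂ) → EntireFun} (_ : IsGAFCoeff Ψ) (_ : Measurable G)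
      (_ : ∀ᵐ x ∂seqLaw, SeqConverges Ψ x ∧ (G x).1 = seqGaf Ψ x) (L : StrongDual ℝ (I → ℂ)),
      charFunDual (seqLaw.map (fun x (i : I) => (G x).1 i)) L = Complex.exp
        (-(∑ i : I, ∑ j : I, gafKernel Ψ i j *
          (((L (Pi.single i 1) : ℂ) - L (Pi.single i Complex.I) * Complex.I) * (starRingEnd ℂ)
            ((L (Pi.single j 1) : ℂ) - L (Pi.single j Complex.I) * Complex.I))) / 4) := by
    intro Ψ G hΨ hm hG L
    have hm' : Measurable (fun x (i : I) => (G x).1 i) :=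
      measurable_pi_iff.mpr fun i => (measurable_eval_entireFun _).comp hm
    rw [charFunDual_apply, integral_map hm'.aemeasurable (by fun_prop),
      ← integral_exp_seqGaf hΨ Finset.univ
        (fun i : I => (L (Pi.single i 1) : ℂ) - L (Pi.single i Complex.I) * Complex.I)
        (fun i => (i : ℂ))]
    refine integral_congr_ae ?_
    filter_upwards [hG] with x hx
    rw [hx.2]
    -- A real-linear functional on `ℂ^I` is `v ↦ Re ∑ v_i t_i` with `t_i = L(e_i) - i L(i e_i)`.
    have hL : ∀ v : I → ℂ, L v = (∑ i, v i *
        ((L (Pi.single i 1) : ℂ) - L (Pi.single i Complex.I) * Complex.I)).re := by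
      intro v
      have hv : v = ∑ i, Pi.single i (v i) := by
        simpa using (Finset.univ_sum_single v).symm
      conv_lhs => rw [hv]
      rw [map_sum, Complex.re_sum]
      refine Finset.sum_congr rfl fun i _ => ?_
      have h1 : (Pi.single i (v i) : I → ℂ) =
          (v i).re • (Pi.single i (1 : ℂ) : I → ℂ) +
            (v i).im • (Pi.single i Complex.I : I → ℂ) := by
        rw [← Pi.single_smul, ← Pi.single_smul, ← Pi.single_add]
        congr 1
        simp [Complex.re_add_im]
      rw [h1, map_add, map_smul, map_smul]
      simp
    rw [hL]
  have i₁ : Measurable (fun x (i : I) => (G₁ x).1 i) :=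
    measurable_pi_iff.mpr fun i => (measurable_eval_entireFun _).comp hm₁
  have i₂ : Measurable (fun x (i : I) => (G₂ x).1 i) :=
    measurable_pi_iff.mpr fun i => (measurable_eval_entireFun _).comp hm₂
  have := Measure.isProbabilityMeasure_map (μ := seqLaw) i₁.aemeasurable
  have := Measure.isProbabilityMeasure_map (μ := seqLaw) i₂.aemeasurable
  refine Measure.ext_of_charFunDual (funext fun L => ?_)
  rw [key h₁ hm₁ hG₁, key h₂ hm₂ hG₂]
  simp_rw [hK]

/-- Gaussian analytic functions with the same covariance kernel have the same law. -/
theorem map_entireFun_eq_of_kernel_eq {Ψ₁ Ψ₂ : ℕ → ℂ → ℂ} (h₁ : IsGAFCoeff Ψ₁)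
    (h₂ : IsGAFCoeff Ψ₂) (hK : ∀ z w, gafKernel Ψ₁ z w = gafKernel Ψ₂ z w)
    {G₁ G₂ : (ℕ → ℂ) → EntireFun} (hm₁ : Measurable G₁) (hm₂ : Measurable G₂)
    (hG₁ : ∀ᵐ x ∂seqLaw, SeqConverges Ψ₁ x ∧ (G₁ x).1 = seqGaf Ψ₁ x)
    (hG₂ : ∀ᵐ x ∂seqLaw, SeqConverges Ψ₂ x ∧ (G₂ x).1 = seqGaf Ψ₂ x) :
    seqLaw.map G₁ = seqLaw.map G₂ := by
  have hv₁ : Measurable fun x => (G₁ x).1 := measurable_subtype_coe.comp hm₁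
  have hv₂ : Measurable fun x => (G₂ x).1 := measurable_subtype_coe.comp hm₂
  -- A finite measure on the product `σ`-algebra is determined by its finite-dimensional marginals.
  have hpi : seqLaw.map (fun x => (G₁ x).1) = seqLaw.map (fun x => (G₂ x).1) := by
    have := Measure.isProbabilityMeasure_map (μ := seqLaw) hv₂.aemeasurable
    have hI : ∀ I : Finset ℂ, IsFiniteMeasure
        ((seqLaw.map (fun x => (G₂ x).1)).map I.restrict) := fun I => by infer_instance
    refine IsProjectiveLimit.unique
      (P := fun I : Finset ℂ => (seqLaw.map (fun x => (G₂ x).1)).map I.restrict)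
      (fun I => ?_) fun I => rfl
    change _ = (seqLaw.map (fun x => (G₂ x).1)).map I.restrict
    rw [Measure.map_map (Finset.measurable_restrict I) hv₁,
      Measure.map_map (Finset.measurable_restrict I) hv₂]
    exact map_restrict_eq_of_kernel_eq h₁ h₂ hK I hm₁ hm₂ hG₁ hG₂
  ext B hB
  obtain ⟨B', hB', rfl⟩ := hB
  have := congrArg (fun μ => μ B') hpi
  simp only [Measure.map_apply hv₁ hB', Measure.map_apply hv₂ hB'] at this
  rw [Measure.map_apply hm₁ (measurable_subtype_coe hB'),
    Measure.map_apply hm₂ (measurable_subtype_coe hB')]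
  exact this

theorem gafVar_eq_of_kernel_eq {Ψ₁ Ψ₂ : ℕ → ℂ → ℂ}
    (hK : ∀ z w, gafKernel Ψ₁ z w = gafKernel Ψ₂ z w) (z : ℂ) : gafVar Ψ₁ z = gafVar Ψ₂ z := by
  have := hK z z
  rw [gafKernel_self, gafKernel_self] at this
  exact_mod_cast this

theorem map_pointMeasure_seqZeros_eq {Ψ₁ Ψ₂ : ℕ → ℂ → ℂ} (h₁ : IsGAFCoeff Ψ₁)
    (h₂ : IsGAFCoeff Ψ₂) (hK : ∀ z w, gafKernel Ψ₁ z w = gafKernel Ψ₂ z w) {w : ℂ}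
    (hw : gafVar Ψ₁ w ≠ 0) :
    seqLaw.map (fun x => pointMeasure (seqZeros Ψ₁ x)) =
      seqLaw.map (fun x => pointMeasure (seqZeros Ψ₂ x)) := by
  obtain ⟨G₁, hm₁, hG₁⟩ := exists_entireFun_version h₁ hw
  obtain ⟨G₂, hm₂, hG₂⟩ := exists_entireFun_version h₂ (gafVar_eq_of_kernel_eq hK w ▸ hw)
  have hA := measurableSet_gafVar_ne_zero h₁
  have hN : Measurable fun f : EntireFun =>
      (pointMeasure (zeroSet f.1)).restrict {z | gafVar Ψ₁ z ≠ 0} :=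
    (measurable_restrict_measure hA).comp measurable_pointMeasure_zeroSet
  have e₁ : (fun x => pointMeasure (seqZeros Ψ₁ x)) =ᵐ[seqLaw]
      (fun f : EntireFun => (pointMeasure (zeroSet f.1)).restrict {z | gafVar Ψ₁ z ≠ 0}) ∘ G₁ := by
    filter_upwards [hG₁] with x hx
    rw [Function.comp_apply, hx.2, seqZeros, pointMeasure_inter _ hA]
  have e₂ : (fun x => pointMeasure (seqZeros Ψ₂ x)) =ᵐ[seqLaw]
      (fun f : EntireFun => (pointMeasure (zeroSet f.1)).restrict {z | gafVar Ψ₁ z ≠ 0}) ∘ G₂ := by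
    filter_upwards [hG₂] with x hx
    simp_rw [Function.comp_apply, hx.2, seqZeros, ← gafVar_eq_of_kernel_eq hK]
    rw [pointMeasure_inter _ hA]
  rw [Measure.map_congr e₁, Measure.map_congr e₂, ← Measure.map_map hN hm₁,
    ← Measure.map_map hN hm₂, map_entireFun_eq_of_kernel_eq h₁ h₂ hK hm₁ hm₂ hG₁ hG₂]

theorem IsGAFCoeff.mul {Ψ : ℕ → ℂ → ℂ} (hΨ : IsGAFCoeff Ψ) {g : ℂ → ℂ} (hg : Differentiable ℂ g) :
    IsGAFCoeff (fun k z => g z * Ψ k z) := by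
  refine ⟨fun k => hg.mul (hΨ.1 k), fun K hK => ?_⟩
  obtain ⟨C, hC⟩ := hΨ.2 K hK
  obtain ⟨D, hD⟩ := hK.exists_bound_of_continuousOn hg.continuous.continuousOn
  refine ⟨D ^ 2 * C, fun z hz => ?_⟩
  simp_rw [norm_mul, mul_pow]
  refine ⟨(hC z hz).1.mul_left _, ?_⟩
  rw [tsum_mul_left]
  have h0 : 0 ≤ ∑' k, ‖Ψ k z‖ ^ 2 := tsum_nonneg fun k => by positivity
  gcongr
  · exact hD z hz
  · exact (hC z hz).2

theorem gafVar_mul (Ψ : ℕ → ℂ → ℂ) (g : ℂ → ℂ) (z : ℂ) :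
    gafVar (fun k z => g z * Ψ k z) z = ‖g z‖ ^ 2 * gafVar Ψ z := by
  simp_rw [gafVar, norm_mul, mul_pow]
  rw [tsum_mul_left]

theorem gafKernel_mul (Ψ : ℕ → ℂ → ℂ) (g : ℂ → ℂ) (z w : ℂ) :
    gafKernel (fun k z => g z * Ψ k z) z w =
      g z * (starRingEnd ℂ) (g w) * gafKernel Ψ z w := by
  simp_rw [gafKernel, map_mul]
  rw [← tsum_mul_left]
  congr 1
  funext k
  ring

theorem seqGaf_mul {Ψ : ℕ → ℂ → ℂ} (g : ℂ → ℂ) {x : ℕ → ℂ} (hx : SeqConverges Ψ x) (z : ℂ) :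
    seqGaf (fun k z => g z * Ψ k z) x z = g z * seqGaf Ψ x z := by
  refine Tendsto.limUnder_eq (((hx.tendsto z).const_mul (g z)).congr fun n => ?_)
  rw [Finset.mul_sum]
  refine Finset.sum_congr rfl fun k _ => by ring

/-- Multiplying a Gaussian analytic function by a deterministic entire function does not change its
random zeros. -/
theorem ae_seqZeros_mul {Ψ : ℕ → ℂ → ℂ} (hΨ : IsGAFCoeff Ψ) {g : ℂ → ℂ} (hg : Differentiable ℂ g)
    (h0 : ∃ z, g z ≠ 0) :
    ∀ᵐ x ∂seqLaw, seqZeros (fun k z => g z * Ψ k z) x = seqZeros Ψ x := by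
  -- At a zero of `g` the product has variance zero, so that point is discarded. The original
  -- function almost surely has no random zero there either, as `g` has only countably many zeros.
  have h : ∀ᵐ x ∂seqLaw, ∀ z ∈ zeroSet g, gafVar Ψ z ≠ 0 → seqGaf Ψ x z ≠ 0 := by
    rw [ae_ball_iff (countable_zeroSet hg h0)]
    intro z _
    by_cases hz : gafVar Ψ z = 0
    · simp [hz]
    · filter_upwards [ae_seqGaf_ne_zero hΨ hz] with x hx _ using hx
  filter_upwards [h, ae_seqConverges hΨ] with x hx hc
  ext z
  simp only [seqZeros, zeroSet, Set.mem_inter_iff, Set.mem_ofPred_eq, seqGaf_mul g hc, gafVar_mul]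
  by_cases hgz : g z = 0
  · have := hx z hgz
    simp only [hgz, norm_zero]
    norm_num
    tauto
  · simp [hgz]

end BargmannNoise

namespace BargmannNoise

/-! ### The random zeros are simple -/

/-- Resampling the coordinate `j` preserves the law. By Fubini it can be treated as a fresh Gaussian
variable with all other coordinates frozen. -/
theorem measurePreserving_update_seqLaw (j : ℕ) :
    MeasurePreserving (fun p : (ℕ → ℂ) × ℂ => Function.update p.1 j p.2)
      (seqLaw.prod stdComplexGaussian) seqLaw := by
  have hm : Measurable (fun p : (ℕ → ℂ) × ℂ => Function.update p.1 j p.2) := by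
    refine measurable_pi_iff.mpr fun i => ?_
    rcases eq_or_ne i j with rfl | hij
    · simpa using measurable_snd
    · simp only [ne_eq, hij, not_false_eq_true, Function.update_of_ne]
      exact (measurable_pi_apply i).comp measurable_fst
  refine ⟨hm, Measure.eq_infinitePi _ fun s t ht => ?_⟩
  rw [Measure.map_apply hm (MeasurableSet.pi s.countable_toSet fun i _ => ht i)]
  by_cases hj : j ∈ s
  · have : (fun p : (ℕ → ℂ) × ℂ => Function.update p.1 j p.2) ⁻¹' ((s : Set ℕ).pi t) =
        (((s.erase j : Finset ℕ) : Set ℕ).pi t) ×ˢ t j := by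
      ext p
      simp only [Set.mem_preimage, Set.mem_pi, Set.mem_prod, Finset.mem_coe, Finset.mem_erase]
      constructor
      · intro h
        refine ⟨fun i hi => ?_, by simpa using h j hj⟩
        simpa [hi.1] using h i hi.2
      · rintro ⟨h1, h2⟩ i hi
        rcases eq_or_ne i j with rfl | hij
        · simpa using h2
        · simpa [hij] using h1 i ⟨hij, hi⟩
    rw [this, Measure.prod_prod, seqLaw, Measure.infinitePi_pi _ fun i _ => ht i,
      ← Finset.mul_prod_erase s _ hj, mul_comm]
  · have : (fun p : (ℕ → ℂ) × ℂ => Function.update p.1 j p.2) ⁻¹' ((s : Set ℕ).pi t) =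
        ((s : Set ℕ).pi t) ×ˢ Set.univ := by
      ext p
      simp only [Set.mem_preimage, Set.mem_pi, Set.mem_prod, Finset.mem_coe, Set.mem_univ, and_true]
      refine forall₂_congr fun i hi => ?_
      have hij : i ≠ j := fun h => hj (h ▸ hi)
      simp [hij]
    rw [this, Measure.prod_prod, seqLaw, Measure.infinitePi_pi _ fun i _ => ht i, measure_univ,
      mul_one]

theorem seqLaw_eq_zero_of_update (j : ℕ) {B : Set (ℕ → ℂ)} (hB : NullMeasurableSet B seqLaw)
    (h : ∀ᵐ x ∂seqLaw, ∀ᵐ t ∂stdComplexGaussian, Function.update x j t ∉ B) : seqLaw B = 0 := by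
  obtain ⟨B', -, hB', hBB'⟩ := hB.exists_measurable_superset_ae_eq
  have hmp := measurePreserving_update_seqLaw j
  have h1 : ∀ᵐ p ∂(seqLaw.prod stdComplexGaussian),
      (Function.update p.1 j p.2 ∈ B' ↔ Function.update p.1 j p.2 ∈ B) := by
    have := hmp.quasiMeasurePreserving.ae hBB'
    filter_upwards [this] with p hp using iff_of_eq hp
  have h2 := Measure.ae_ae_of_ae_prod h1
  rw [← measure_congr hBB', ← hmp.measure_preimage hB'.nullMeasurableSet,
    Measure.measure_prod_null (hmp.measurable hB')]
  filter_upwards [h, h2] with x hx hx2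
  change stdComplexGaussian _ = 0
  rw [measure_eq_zero_iff_ae_notMem]
  filter_upwards [hx, hx2] with t ht ht2 h3
  exact ht (ht2.mp h3)

theorem seqGaf_update {Ψ : ℕ → ℂ → ℂ} {x : ℕ → ℂ} (hx : SeqConverges Ψ x) (j : ℕ) (t z : ℂ) :
    seqGaf Ψ (Function.update x j t) z = seqGaf Ψ x z + (t - x j) * Ψ j z := by
  refine Tendsto.limUnder_eq (((hx.tendsto z).add_const ((t - x j) * Ψ j z)).congr' ?_)
  filter_upwards [eventually_gt_atTop j] with n hn
  have hj := Finset.mem_range.mpr hn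
  rw [← Finset.add_sum_erase _ _ hj, ← Finset.add_sum_erase _ _ hj, Function.update_self]
  have : ∑ k ∈ (Finset.range n).erase j, Function.update x j t k * Ψ k z =
      ∑ k ∈ (Finset.range n).erase j, x k * Ψ k z :=
    Finset.sum_congr rfl fun k hk => by rw [Function.update_of_ne (Finset.ne_of_mem_erase hk)]
  rw [this]
  ring

theorem SeqConverges.tendsto_deriv {Ψ : ℕ → ℂ → ℂ} {x : ℕ → ℂ} (h : SeqConverges Ψ x)
    (hΨ : ∀ k, Differentiable ℂ (Ψ k)) (z : ℂ) :
    Tendsto (fun n => ∑ k ∈ Finset.range n, x k * deriv (Ψ k) z) atTop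
      (𝓝 (deriv (seqGaf Ψ x) z)) := by
  have := (h.tendstoLocallyUniformlyOn.deriv (Eventually.of_forall fun n => by fun_prop)
    isOpen_univ).tendsto_at (Set.mem_univ z)
  refine this.congr fun n => ?_
  rw [Function.comp_apply, deriv_fun_sum fun k _ => ((hΨ k).const_mul _).differentiableAt]
  exact Finset.sum_congr rfl fun k _ => deriv_const_mul _ (hΨ k).differentiableAt

theorem aemeasurable_deriv_seqGaf {Ψ : ℕ → ℂ → ℂ} (hΨ : IsGAFCoeff Ψ) (z : ℂ) :
    AEMeasurable (fun x => deriv (seqGaf Ψ x) z) seqLaw := by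
  refine aemeasurable_of_tendsto_metrizable_ae atTop
    (f := fun n x => ∑ k ∈ Finset.range n, x k * deriv (Ψ k) z) (fun n => Measurable.aemeasurable
      (Finset.measurable_fun_sum _ fun k _ => (measurable_pi_apply k).mul_const _)) ?_
  filter_upwards [ae_seqConverges hΨ] with x hx using hx.tendsto_deriv hΨ.1 z

/-- The event that a Gaussian analytic function has a multiple zero in a disc. -/
def multipleZeroHits (Ψ : ℕ → ℂ → ℂ) (p : ℕ × ℕ) : Set (ℕ → ℂ) :=
  {x | ∃ z ∈ rationalBall p, seqGaf Ψ x z = 0 ∧ deriv (seqGaf Ψ x) z = 0}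

theorem nullMeasurableSet_multipleZeroHits {Ψ : ℕ → ℂ → ℂ} (hΨ : IsGAFCoeff Ψ) (p : ℕ × ℕ) :
    NullMeasurableSet (multipleZeroHits Ψ p) seqLaw := by
  have hmeas : NullMeasurableSet (⋂ n : ℕ, ⋃ i : ℕ, {x : ℕ → ℂ |
      TopologicalSpace.denseSeq ℂ i ∈ Metric.ball (TopologicalSpace.denseSeq ℂ p.1)
        (1 / ((p.2 : ℝ) + 1)) ∧ ‖(seqGaf Ψ x (TopologicalSpace.denseSeq ℂ i),
          deriv (seqGaf Ψ x) (TopologicalSpace.denseSeq ℂ i))‖ < 1 / ((n : ℝ) + 1)}) seqLaw := by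
    refine NullMeasurableSet.iInter fun n => NullMeasurableSet.iUnion fun i => ?_
    rw [Set.ofPred_and]
    refine NullMeasurableSet.inter (MeasurableSet.const _).nullMeasurableSet
      (nullMeasurableSet_lt ?_ aemeasurable_const)
    exact ((aemeasurable_seqGaf hΨ _).prodMk (aemeasurable_deriv_seqGaf hΨ _)).norm
  refine hmeas.congr ?_
  filter_upwards [ae_seqConverges hΨ] with x hx
  refine propext ?_
  have hd := hx.differentiable hΨ.1
  have hc : Continuous fun z => (seqGaf Ψ x z, deriv (seqGaf Ψ x) z) :=
    hd.continuous.prodMk (hd.contDiff (n := 1)).continuous_deriv_one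
  have := exists_zero_closedBall_iff hc (TopologicalSpace.denseSeq ℂ p.1)
    (Nat.one_div_pos_of_nat (α := ℝ) (n := p.2))
  simp only [Prod.mk_eq_zero] at this
  change x ∈ (⋂ n : ℕ, ⋃ i : ℕ, _) ↔ x ∈ multipleZeroHits Ψ p
  simp only [Set.mem_iInter, Set.mem_iUnion]
  exact this.symm

/-- Sard's theorem: the critical values of `h` form a Lebesgue null set, which an absolutely
continuous variable almost surely misses. -/
theorem ae_forall_critical_ne {h : ℂ → ℂ} {U : Set ℂ} (hU : IsOpen U)
    (hh : DifferentiableOn ℂ h U) :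
    ∀ᵐ t ∂stdComplexGaussian, ∀ z ∈ U, h z = t → deriv h z ≠ 0 := by
  refine stdComplexGaussian_absolutelyContinuous.ae_le ?_
  have key := addHaar_image_eq_zero_of_det_fderivWithin_eq_zero volume
    (s := {z | z ∈ U ∧ deriv h z = 0}) (f := h) (f' := fun _ => 0)
    (fun z hz => by
      have h1 : HasDerivAt h (deriv h z) z :=
        ((hh z hz.1).differentiableAt (hU.mem_nhds hz.1)).hasDerivAt
      rw [hz.2] at h1
      have h2 := h1.hasFDerivAt.restrictScalars ℝ
      have h3 : (ContinuousLinearMap.toSpanSingleton ℂ (0 : ℂ)).restrictScalars ℝ =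
          (0 : ℂ →L[ℝ] ℂ) := by ext; simp
      rw [h3] at h2
      exact h2.hasFDerivWithinAt)
    (fun z _ => by
      rw [ContinuousLinearMap.det]
      simp)
  filter_upwards [measure_eq_zero_iff_ae_notMem.mp key] with t ht z hz hzt hd
  exact ht ⟨z, ⟨hz, hd⟩, hzt⟩

/-- Replacing the coefficient `x j` by `t` turns `F` into `F + (t - x j) Ψ_j`. Where `Ψ_j ≠ 0`, a
multiple zero of this function makes `t` a critical value of `x j - F/Ψ_j`. -/
theorem seqLaw_multipleZeroHits {Ψ : ℕ → ℂ → ℂ} (hΨ : IsGAFCoeff Ψ) {p : ℕ × ℕ} {j : ℕ}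
    (hp : rationalBall p ⊆ {z | Ψ j z ≠ 0}) : seqLaw (multipleZeroHits Ψ p) = 0 := by
  refine seqLaw_eq_zero_of_update j (nullMeasurableSet_multipleZeroHits hΨ p) ?_
  filter_upwards [ae_seqConverges hΨ] with x hx
  have hd := hx.differentiable hΨ.1
  have hU : IsOpen {z | Ψ j z ≠ 0} := isOpen_ne_fun (hΨ.1 j).continuous continuous_const
  have hder : ∀ z ∈ {z | Ψ j z ≠ 0}, HasDerivAt (fun z => x j - seqGaf Ψ x z / Ψ j z)
      (-((deriv (seqGaf Ψ x) z * Ψ j z - seqGaf Ψ x z * deriv (Ψ j) z) / Ψ j z ^ 2)) z :=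
    fun z hz => ((hd z).hasDerivAt.div ((hΨ.1 j) z).hasDerivAt hz).const_sub _
  filter_upwards [ae_forall_critical_ne hU
    fun z hz => (hder z hz).differentiableAt.differentiableWithinAt] with t ht
  rintro ⟨z, hz, h1, h2⟩
  have hz' := hp hz
  have h3 : seqGaf Ψ (Function.update x j t) = fun z => seqGaf Ψ x z + (t - x j) * Ψ j z :=
    funext fun z => seqGaf_update hx j t z
  have h4 : HasDerivAt (seqGaf Ψ (Function.update x j t))
      (deriv (seqGaf Ψ x) z + (t - x j) * deriv (Ψ j) z) z := by
    rw [h3]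
    exact (hd z).hasDerivAt.add (((hΨ.1 j) z).hasDerivAt.const_mul _)
  rw [h4.deriv] at h2
  rw [h3] at h1
  have h5 : Ψ j z ≠ 0 := hz'
  have h6 : x j - seqGaf Ψ x z / Ψ j z = t := by
    field_simp
    linear_combination -h1
  refine ht z hz' h6 ?_
  rw [(hder z hz').deriv, neg_eq_zero, div_eq_zero_iff]
  left
  linear_combination Ψ j z * h2 - deriv (Ψ j) z * h1

/-- The random zeros of a Gaussian analytic function are almost surely simple. -/
theorem ae_deriv_seqGaf_ne_zero {Ψ : ℕ → ℂ → ℂ} (hΨ : IsGAFCoeff Ψ) :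
    ∀ᵐ x ∂seqLaw, ∀ z, gafVar Ψ z ≠ 0 → seqGaf Ψ x z = 0 → deriv (seqGaf Ψ x) z ≠ 0 := by
  have h : ∀ᵐ x ∂seqLaw, ∀ (p : ℕ × ℕ) (j : ℕ), rationalBall p ⊆ {z | Ψ j z ≠ 0} →
      x ∉ multipleZeroHits Ψ p := by
    simp_rw [ae_all_iff]
    exact fun p j hp => measure_eq_zero_iff_ae_notMem.mp (seqLaw_multipleZeroHits hΨ hp)
  filter_upwards [h] with x hx z hz h1 h2
  rw [ne_eq, hΨ.gafVar_eq_zero_iff] at hz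
  push Not at hz
  obtain ⟨j, hj⟩ := hz
  obtain ⟨p, hp1, hp2⟩ := exists_rationalBall
    (isOpen_ne_fun (hΨ.1 j).continuous continuous_const) hj
  exact hx p j hp2 ⟨z, hp1, h1, h2⟩

end BargmannNoise

namespace BargmannNoise

/-! ### Jensen's formula for random zeros -/

/-- Jensen's formula for an entire function with simple zeros in a disc. -/
theorem lintegral_log_pointMeasure {f : ℂ → ℂ} (hf : Differentiable ℂ f) {c : ℂ} (hc : f c ≠ 0)
    {R : ℝ} (hR : 0 < R) {S : Set ℂ}
    (hS : ∀ z ∈ Metric.closedBall c R, z ∈ S ↔ f z = 0)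
    (hsimple : ∀ z ∈ Metric.closedBall c R, f z = 0 → deriv f z ≠ 0) :
    ∫⁻ z, ENNReal.ofReal (Real.log (R / ‖z - c‖)) ∂pointMeasure S =
        ENNReal.ofReal (Real.circleAverage (fun z => Real.log ‖f z‖) c R - Real.log ‖f c‖) ∧
      0 ≤ Real.circleAverage (fun z => Real.log ‖f z‖) c R - Real.log ‖f c‖ := by
  have habs : |R| = R := abs_of_pos hR
  have han : AnalyticOnNhd ℂ f (Metric.closedBall c |R|) := fun z _ => hf.analyticAt z
  rw [AnalyticOnNhd.circleAverage_log_norm hR.ne' han hc, add_sub_cancel_right, habs]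
  rw [habs] at han
  have hfin := finite_zeroSet_inter hf ⟨c, hc⟩ (isCompact_closedBall c R)
  set T := hfin.toFinset with hT
  have hTmem : ∀ z, z ∈ T ↔ f z = 0 ∧ z ∈ Metric.closedBall c R := fun z => by
    rw [hT, Set.Finite.mem_toFinset]; rfl
  -- Simplicity of the zeros makes the divisor in Jensen's formula the indicator of the zero set.
  have hdiv : ∀ z ∈ Metric.closedBall c R,
      MeromorphicOn.divisor f (Metric.closedBall c R) z = if f z = 0 then 1 else 0 := by
    intro z hz
    rw [MeromorphicOn.divisor_apply han.meromorphicOn hz,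
      (hf.analyticAt z).meromorphicOrderAt_eq]
    split_ifs with h0
    · rw [(hf.analyticAt z).analyticOrderAt_eq_one_of_zero_deriv_ne_zero h0 (hsimple z hz h0)]
      rfl
    · rw [(hf.analyticAt z).analyticOrderAt_eq_zero.mpr h0]
      rfl
  have hsum : ∑ᶠ u, ((MeromorphicOn.divisor f (Metric.closedBall c R) u : ℤ) : ℝ) *
      Real.log (R * ‖c - u‖⁻¹) = ∑ u ∈ T, Real.log (R / ‖u - c‖) := by
    rw [finsum_eq_sum_of_support_subset (s := T)]
    · refine Finset.sum_congr rfl fun u hu => ?_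
      obtain ⟨h1, h2⟩ := (hTmem u).mp hu
      rw [hdiv u h2, if_pos h1, norm_sub_rev, div_eq_mul_inv]
      simp
    · intro u hu
      rw [Function.mem_support] at hu
      have hub : u ∈ Metric.closedBall c R := by
        by_contra hub
        rw [Function.locallyFinsuppWithin.apply_eq_zero_of_notMem _ hub] at hu
        simp at hu
      rw [hdiv u hub] at hu
      refine (hTmem u).mpr ⟨?_, hub⟩
      by_contra h
      simp [h] at hu
  have hnonneg : ∀ u ∈ T, 0 ≤ Real.log (R / ‖u - c‖) := by
    intro u hu
    obtain ⟨h1, h2⟩ := (hTmem u).mp hu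
    have h3 : 0 < ‖u - c‖ := norm_pos_iff.mpr (sub_ne_zero.mpr fun h => hc (h ▸ h1))
    exact Real.log_nonneg ((one_le_div h3).mpr (by simpa [dist_eq_norm] using h2))
  refine ⟨?_, hsum ▸ Finset.sum_nonneg hnonneg⟩
  have hm : Measurable fun z : ℂ => ENNReal.ofReal (Real.log (R / ‖z - c‖)) :=
    (Real.measurable_log.comp (by fun_prop)).ennreal_ofReal
  rw [hsum, ENNReal.ofReal_sum_of_nonneg hnonneg, lintegral_pointMeasure hm,
    tsum_subtype S fun z => ENNReal.ofReal (Real.log (R / ‖z - c‖)), tsum_eq_sum (s := T)]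
  · refine Finset.sum_congr rfl fun u hu => ?_
    obtain ⟨h1, h2⟩ := (hTmem u).mp hu
    exact Set.indicator_of_mem ((hS u h2).mpr h1) _
  -- Outside the disc the logarithm is nonpositive and is truncated to zero by `ENNReal.ofReal`.
  · intro u hu
    rw [Set.indicator_apply_eq_zero]
    intro huS
    have hub : u ∉ Metric.closedBall c R := fun h => hu ((hTmem u).mpr ⟨(hS u h).mp huS, h⟩)
    have h3 : R < ‖u - c‖ := by simpa [dist_eq_norm] using hub
    exact ENNReal.ofReal_of_nonpos
      (Real.log_nonpos (by positivity) ((div_le_one (hR.trans h3)).mpr h3.le))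

theorem continuous_gafVar {Ψ : ℕ → ℂ → ℂ} (hΨ : IsGAFCoeff Ψ) : Continuous (gafVar Ψ) := by
  refine continuous_iff_continuousAt.mpr fun z => ?_
  obtain ⟨M, hM, hle⟩ := hΨ.exists_bound (‖z‖ + 1)
  have h : ContinuousOn (gafVar Ψ) (Metric.closedBall 0 (‖z‖ + 1)) :=
    continuousOn_tsum (fun k => ((hΨ.1 k).continuous.norm.pow 2).continuousOn) hM
      fun k w hw => by
        rw [Real.norm_of_nonneg (by positivity)]
        exact hle k w (mem_closedBall_zero_iff.mp hw)
  exact h.continuousAt (mem_of_superset (Metric.isOpen_ball.mem_nhds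
    (mem_ball_zero_iff.mpr (lt_add_one ‖z‖))) Metric.ball_subset_closedBall)

theorem aemeasurable_log_norm_seqGaf_circleMap {Ψ : ℕ → ℂ → ℂ} (hΨ : IsGAFCoeff Ψ) (c : ℂ) (R : ℝ)
    (μ : Measure ℝ) [SFinite μ] :
    AEMeasurable (fun p : (ℕ → ℂ) × ℝ => Real.log ‖seqGaf Ψ p.1 (circleMap c R p.2)‖)
      (seqLaw.prod μ) := by
  have h : AEMeasurable (fun p : (ℕ → ℂ) × ℝ => seqGaf Ψ p.1 (circleMap c R p.2))
      (seqLaw.prod μ) := by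
    refine aemeasurable_of_tendsto_metrizable_ae atTop
      (f := fun n p => ∑ k ∈ Finset.range n, p.1 k * Ψ k (circleMap c R p.2))
      (fun n => Measurable.aemeasurable (Finset.measurable_fun_sum _ fun k _ =>
        ((measurable_pi_apply k).comp measurable_fst).mul ?_)) ?_
    · have := (hΨ.1 k).continuous
      exact (this.comp (continuous_circleMap c R)).measurable.comp measurable_snd
    · filter_upwards [Measure.quasiMeasurePreserving_fst.ae (ae_seqConverges hΨ)] with p hp
      exact hp.tendsto _
  exact measurable_log_norm.comp_aemeasurable h

/-- Fubini between the expectation and the circle average. The variance is continuous and nonzero on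
the circle, so the logarithmic moments are uniformly controlled there. -/
theorem integral_circleAverage_log_norm_seqGaf {Ψ : ℕ → ℂ → ℂ} (hΨ : IsGAFCoeff Ψ) {c : ℂ} {R : ℝ}
    (hR : 0 < R) (hv : ∀ z ∈ Metric.closedBall c R, gafVar Ψ z ≠ 0) :
    Integrable (fun x => Real.circleAverage (fun z => Real.log ‖seqGaf Ψ x z‖) c R) seqLaw ∧
      ∫ x, Real.circleAverage (fun z => Real.log ‖seqGaf Ψ x z‖) c R ∂seqLaw =
        Real.circleAverage (fun z => Real.log (gafVar Ψ z) / 2) c R +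
          ∫ ζ, Real.log ‖ζ‖ ∂stdComplexGaussian := by
  have hpi : (0 : ℝ) ≤ 2 * Real.pi := by positivity
  have hv' : ∀ θ, gafVar Ψ (circleMap c R θ) ≠ 0 := fun θ =>
    hv _ (Metric.sphere_subset_closedBall (circleMap_mem_sphere c hR.le θ))
  set μ : Measure ℝ := volume.restrict (Set.Ioc 0 (2 * Real.pi)) with hμ
  have hm := aemeasurable_log_norm_seqGaf_circleMap hΨ c R μ
  have hcont : Continuous fun θ => Real.log (gafVar Ψ (circleMap c R θ)) :=
    ((continuous_gafVar hΨ).comp (continuous_circleMap c R)).log hv'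
  have hint : Integrable
      (fun p : (ℕ → ℂ) × ℝ => Real.log ‖seqGaf Ψ p.1 (circleMap c R p.2)‖) (seqLaw.prod μ) := by
    rw [integrable_prod_iff' hm.aestronglyMeasurable]
    refine ⟨ae_of_all _ fun θ => (integrable_log_norm_seqGaf hΨ (hv' θ)).1, ?_⟩
    have hb : Integrable (fun θ => |Real.log (gafVar Ψ (circleMap c R θ))| / 2 +
        ∫ ζ, |Real.log ‖ζ‖| ∂stdComplexGaussian) μ := by
      have : Continuous fun θ => |Real.log (gafVar Ψ (circleMap c R θ))| / 2 +
          ∫ ζ, |Real.log ‖ζ‖| ∂stdComplexGaussian := by fun_prop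
      exact (this.intervalIntegrable 0 (2 * Real.pi)).1
    refine hb.mono' hm.aestronglyMeasurable.norm.prod_swap.integral_prod_right'
      (ae_of_all _ fun θ => ?_)
    rw [Real.norm_of_nonneg (integral_nonneg fun _ => norm_nonneg _)]
    exact (integrable_log_norm_seqGaf hΨ (hv' θ)).2.2
  have havg : ∀ g : ℂ → ℝ, Real.circleAverage g c R =
      (2 * Real.pi)⁻¹ * ∫ θ, g (circleMap c R θ) ∂μ := fun g => by
    rw [Real.circleAverage, intervalIntegral.integral_of_le hpi, smul_eq_mul]
  simp_rw [havg]
  refine ⟨hint.integral_prod_left.const_mul _, ?_⟩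
  rw [integral_const_mul, integral_integral_swap hint]
  simp_rw [fun θ => (integrable_log_norm_seqGaf hΨ (hv' θ)).2.1]
  rw [integral_add ((hcont.div_const 2).intervalIntegrable 0 (2 * Real.pi)).1
    (integrable_const _), integral_const, mul_add]
  congr 1
  simp only [measureReal_restrict_apply_univ, Real.volume_real_Ioc, sub_zero, smul_eq_mul]
  rw [max_eq_left hpi]
  field_simp

/-- The mean of the counting measure of the random zeros. -/
noncomputable def meanZeros (Ψ : ℕ → ℂ → ℂ) : Measure ℂ :=
  seqLaw.bind (fun x => pointMeasure (seqZeros Ψ x))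

/-- Jensen's formula for the mean of the counting measure of the random zeros. -/
theorem lintegral_log_meanZeros {Ψ : ℕ → ℂ → ℂ} (hΨ : IsGAFCoeff Ψ) {c : ℂ} {R : ℝ}
    (hR : 0 < R) (hv : ∀ z ∈ Metric.closedBall c R, gafVar Ψ z ≠ 0) :
    ∫⁻ z, ENNReal.ofReal (Real.log (R / ‖z - c‖)) ∂meanZeros Ψ =
        ENNReal.ofReal (Real.circleAverage (fun z => Real.log (gafVar Ψ z) / 2) c R -
          Real.log (gafVar Ψ c) / 2) ∧
      0 ≤ Real.circleAverage (fun z => Real.log (gafVar Ψ z) / 2) c R -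
        Real.log (gafVar Ψ c) / 2 := by
  have hc := hv c (Metric.mem_closedBall_self hR.le)
  have hm : Measurable fun z : ℂ => ENNReal.ofReal (Real.log (R / ‖z - c‖)) :=
    (Real.measurable_log.comp (by fun_prop)).ennreal_ofReal
  obtain ⟨h1, h2⟩ := integral_circleAverage_log_norm_seqGaf hΨ hR hv
  obtain ⟨h3, h4, -⟩ := integrable_log_norm_seqGaf hΨ hc
  have key : ∀ᵐ x ∂seqLaw,
      ∫⁻ z, ENNReal.ofReal (Real.log (R / ‖z - c‖)) ∂pointMeasure (seqZeros Ψ x) =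
        ENNReal.ofReal (Real.circleAverage (fun z => Real.log ‖seqGaf Ψ x z‖) c R -
          Real.log ‖seqGaf Ψ x c‖) ∧
      0 ≤ Real.circleAverage (fun z => Real.log ‖seqGaf Ψ x z‖) c R -
          Real.log ‖seqGaf Ψ x c‖ := by
    filter_upwards [ae_seqConverges hΨ, ae_seqGaf_ne_zero hΨ hc, ae_deriv_seqGaf_ne_zero hΨ]
      with x hx hxc hs
    exact lintegral_log_pointMeasure (hx.differentiable hΨ.1) hxc hR
      (fun z hz => ⟨fun h => h.1, fun h => ⟨h, hv z hz⟩⟩) fun z hz => hs z (hv z hz)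
  -- Both terms contain the mean of `log|ζ|` for a standard Gaussian `ζ`, and it cancels in the
  -- difference.
  have hE : ∫ x, (Real.circleAverage (fun z => Real.log ‖seqGaf Ψ x z‖) c R -
      Real.log ‖seqGaf Ψ x c‖) ∂seqLaw =
      Real.circleAverage (fun z => Real.log (gafVar Ψ z) / 2) c R -
        Real.log (gafVar Ψ c) / 2 := by
    rw [integral_sub h1 h3, h2, h4]
    ring
  rw [← hE]
  refine ⟨?_, integral_nonneg_of_ae (key.mono fun x hx => hx.2)⟩
  rw [meanZeros, Measure.lintegral_bind (aemeasurable_pointMeasure_seqZeros hΨ hc) hm.aemeasurable,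
    lintegral_congr_ae (key.mono fun x hx => hx.1)]
  exact (ofReal_integral_eq_lintegral_ofReal (h1.sub h3) (key.mono fun x hx => hx.2)).symm

end BargmannNoise

namespace BargmannNoise

/-! ### First intensities -/

theorem tsum_subtype_eq_sum_of_eq_zero {M : Type*} [AddCommMonoid M] [TopologicalSpace M]
    [T2Space M] {S K : Set ℂ} (hf : (S ∩ K).Finite) {g : ℂ → M} (hg : ∀ z ∉ K, g z = 0) :
    ∑' x : S, g x = ∑ z ∈ hf.toFinset, g z := by
  rw [tsum_subtype S g, tsum_eq_sum (s := hf.toFinset)]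
  · refine Finset.sum_congr rfl fun z hz => Set.indicator_of_mem ?_ _
    exact (hf.mem_toFinset.mp hz).1
  · intro z hz
    rw [Set.indicator_apply_eq_zero]
    intro hzS
    exact hg z fun hzK => hz (hf.mem_toFinset.mpr ⟨hzS, hzK⟩)

theorem tsum_eq_lintegral_pointMeasure_sub {S K : Set ℂ} (hf : (S ∩ K).Finite) {ψ : ℂ → ℝ}
    (hm : Measurable ψ) (hψ : ∀ z ∉ K, ψ z = 0) :
    ∫⁻ z, ENNReal.ofReal (ψ z) ∂pointMeasure S < ⊤ ∧
    ∫⁻ z, ENNReal.ofReal (-ψ z) ∂pointMeasure S < ⊤ ∧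
    ∑' x : S, ψ x = (∫⁻ z, ENNReal.ofReal (ψ z) ∂pointMeasure S).toReal -
      (∫⁻ z, ENNReal.ofReal (-ψ z) ∂pointMeasure S).toReal := by
  rw [lintegral_pointMeasure hm.ennreal_ofReal,
    lintegral_pointMeasure (g := fun z => ENNReal.ofReal (-ψ z)) hm.neg.ennreal_ofReal,
    tsum_subtype_eq_sum_of_eq_zero hf hψ,
    tsum_subtype_eq_sum_of_eq_zero hf (g := fun z => ENNReal.ofReal (ψ z))
      fun z hz => by simp [hψ z hz],
    tsum_subtype_eq_sum_of_eq_zero hf (g := fun z => ENNReal.ofReal (-ψ z))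
      fun z hz => by simp [hψ z hz]]
  refine ⟨ENNReal.sum_lt_top.mpr fun _ _ => ENNReal.ofReal_lt_top,
    ENNReal.sum_lt_top.mpr fun _ _ => ENNReal.ofReal_lt_top, ?_⟩
  rw [ENNReal.toReal_sum fun _ _ => ENNReal.ofReal_ne_top,
    ENNReal.toReal_sum fun _ _ => ENNReal.ofReal_ne_top, ← Finset.sum_sub_distrib]
  refine Finset.sum_congr rfl fun z _ => ?_
  rw [ENNReal.toReal_ofReal', ENNReal.toReal_ofReal', max_zero_sub_eq_self]

section FirstIntensity

variable {Ω : Type*} [MeasurableSpace Ω] {P : Measure Ω} {Z : Ω → Set ℂ} {ρ : Measure ℂ}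

/-- Campbell's formula for positive functions is the definition of `bind`. Splitting `ψ` into
positive and negative parts, both with finite integral, gives the signed version. -/
theorem isFirstIntensity_of_bind_eq [IsFiniteMeasureOnCompacts ρ]
    (hfin : ∀ᵐ ω ∂P, ∀ K : Set ℂ, IsCompact K → (Z ω ∩ K).Finite)
    (hm : AEMeasurable (fun ω => pointMeasure (Z ω)) P)
    (h : P.bind (fun ω => pointMeasure (Z ω)) = ρ) : IsFirstIntensity P Z ρ := by
  rintro ψ hψm ⟨C, hC⟩ hψc
  have hψi : Integrable ψ ρ := by
    have : IntegrableOn ψ (tsupport ψ) ρ := by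
      have := hψc.isCompact.measure_lt_top (μ := ρ)
      exact Measure.integrableOn_of_bounded (M := C) this.ne hψm.aestronglyMeasurable
        (ae_of_all _ hC)
    rwa [integrableOn_iff_integrable_of_support_subset (subset_tsupport ψ)] at this
  have key : ∀ φ : ℂ → ℝ, Measurable φ → Integrable φ ρ →
      AEMeasurable (fun ω => ∫⁻ z, ENNReal.ofReal (φ z) ∂pointMeasure (Z ω)) P ∧
      ∫⁻ ω, ∫⁻ z, ENNReal.ofReal (φ z) ∂pointMeasure (Z ω) ∂P = ∫⁻ z, ENNReal.ofReal (φ z) ∂ρ ∧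
      ∫⁻ ω, ∫⁻ z, ENNReal.ofReal (φ z) ∂pointMeasure (Z ω) ∂P ≠ ⊤ := by
    intro φ hφ hi
    have e : ∫⁻ ω, ∫⁻ z, ENNReal.ofReal (φ z) ∂pointMeasure (Z ω) ∂P =
        ∫⁻ z, ENNReal.ofReal (φ z) ∂ρ := by
      rw [← h, Measure.lintegral_bind hm hφ.ennreal_ofReal.aemeasurable]
    exact ⟨(Measure.measurable_lintegral hφ.ennreal_ofReal).comp_aemeasurable hm, e,
      e ▸ (hi.lintegral_lt_top).ne⟩
  obtain ⟨m1, e1, t1⟩ := key ψ hψm hψi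
  obtain ⟨m2, e2, t2⟩ := key (fun z => -ψ z) hψm.neg hψi.neg
  have hae : (fun ω => ∑' x : Z ω, ψ x) =ᵐ[P] fun ω =>
      (∫⁻ z, ENNReal.ofReal (ψ z) ∂pointMeasure (Z ω)).toReal -
      (∫⁻ z, ENNReal.ofReal (-ψ z) ∂pointMeasure (Z ω)).toReal := by
    filter_upwards [hfin] with ω hω
    exact (tsum_eq_lintegral_pointMeasure_sub (hω _ hψc.isCompact) hψm
      fun z hz => image_eq_zero_of_notMem_tsupport hz).2.2
  have i1 := integrable_toReal_of_lintegral_ne_top m1 t1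
  have i2 := integrable_toReal_of_lintegral_ne_top m2 t2
  refine ⟨(i1.sub i2).congr hae.symm, ?_⟩
  rw [integral_congr_ae hae, integral_sub i1 i2, integral_toReal m1 (ae_lt_top' m1 t1),
    integral_toReal m2 (ae_lt_top' m2 t2), e1, e2,
    integral_eq_lintegral_pos_part_sub_lintegral_neg_part hψi]

/-- Indicators of bounded Borel sets are admissible test functions, and a locally finite measure is
determined by its values on bounded open sets. -/
theorem bind_eq_of_isFirstIntensity [IsFiniteMeasureOnCompacts ρ]
    (hfin : ∀ᵐ ω ∂P, ∀ K : Set ℂ, IsCompact K → (Z ω ∩ K).Finite)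
    (hm : AEMeasurable (fun ω => pointMeasure (Z ω)) P)
    (h : IsFirstIntensity P Z ρ) : P.bind (fun ω => pointMeasure (Z ω)) = ρ := by
  have key : ∀ (B K : Set ℂ), MeasurableSet B → IsCompact K → B ⊆ K →
      P.bind (fun ω => pointMeasure (Z ω)) B = ρ B := by
    intro B K hB hK hBK
    have hout : ∀ z ∉ K, B.indicator (1 : ℂ → ℝ) z = 0 := fun z hz =>
      Set.indicator_of_notMem (fun h => hz (hBK h)) _
    have hmeas : Measurable (B.indicator (1 : ℂ → ℝ)) := measurable_one.indicator hB
    obtain ⟨hi, he⟩ := h (B.indicator 1) hmeas ⟨1, fun z => by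
      by_cases hz : z ∈ B <;> simp [hz]⟩ (HasCompactSupport.intro hK hout)
    have hpt : ∀ᵐ ω ∂P, ENNReal.ofReal (∑' x : Z ω, B.indicator (1 : ℂ → ℝ) x) =
        pointMeasure (Z ω) B ∧ 0 ≤ ∑' x : Z ω, B.indicator (1 : ℂ → ℝ) x := by
      filter_upwards [hfin] with ω hω
      obtain ⟨a1, -, a3⟩ := tsum_eq_lintegral_pointMeasure_sub (hω K hK) hmeas hout
      have b1 : ∀ z, ENNReal.ofReal (B.indicator (1 : ℂ → ℝ) z) = B.indicator 1 z := fun z => by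
        by_cases hz : z ∈ B <;> simp [hz]
      have b2 : ∀ z, ENNReal.ofReal (-B.indicator (1 : ℂ → ℝ) z) = 0 := fun z => by
        by_cases hz : z ∈ B <;> simp [hz]
      simp_rw [b1] at a1 a3
      simp_rw [b2] at a3
      rw [lintegral_indicator_one hB] at a1 a3
      rw [lintegral_zero, ENNReal.toReal_zero, sub_zero] at a3
      rw [a3, ENNReal.ofReal_toReal a1.ne]
      exact ⟨rfl, ENNReal.toReal_nonneg⟩
    have hfinB : ρ B ≠ ⊤ := ((measure_mono hBK).trans_lt hK.measure_lt_top).ne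
    rw [Measure.bind_apply hB hm, ← lintegral_congr_ae (hpt.mono fun _ h => h.1),
      ← ofReal_integral_eq_lintegral_ofReal hi (hpt.mono fun _ h => h.2), ← he,
      integral_indicator_one hB, measureReal_def, ENNReal.ofReal_toReal hfinB]
  have : IsFiniteMeasureOnCompacts (P.bind (fun ω => pointMeasure (Z ω))) :=
    ⟨fun K hK => (key K K hK.measurableSet hK subset_rfl).trans_lt hK.measure_lt_top⟩
  refine Measure.OuterRegular.ext_isOpen_isBounded fun U hU hb => ?_
  exact key U _ hU.measurableSet hb.isCompact_closure subset_closure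

end FirstIntensity

/-! ### Measures with prescribed logarithmic potentials -/

/-- Layer cake: for `t > 0` the set where `log(R/|z - c|) > t` is the punctured disc of radius `R
e^{-t}`, of area `πR² e^{-2t}`. The value `πR²/2` is the total mass of the potential kernel, used
below as a mollifier. -/
theorem lintegral_log_div_norm {R : ℝ} (hR : 0 < R) (c : ℂ) :
    ∫⁻ z, ENNReal.ofReal (Real.log (R / ‖z - c‖)) = ENNReal.ofReal (Real.pi * R ^ 2 / 2) := by
  have h1 : ∫⁻ z : ℂ, ENNReal.ofReal (Real.log (R / ‖z - c‖)) =
      ∫⁻ z : ℂ, ENNReal.ofReal (Real.log (R / ‖z‖)) :=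
    lintegral_sub_right_eq_self (fun z : ℂ => ENNReal.ofReal (Real.log (R / ‖z‖))) c
  have hm : Measurable fun z : ℂ => Real.log (R / ‖z‖) :=
    Real.measurable_log.comp (by fun_prop)
  have h2 : ∀ z : ℂ, ENNReal.ofReal (Real.log (R / ‖z‖)) =
      ENNReal.ofReal (max (Real.log (R / ‖z‖)) 0) := fun z => by simp [ENNReal.ofReal_max]
  rw [h1]
  simp_rw [h2]
  rw [lintegral_eq_lintegral_meas_lt (f := fun z : ℂ => max (Real.log (R / ‖z‖)) 0) _
    (ae_of_all _ fun z => le_max_right _ _) (hm.max measurable_const).aemeasurable]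
  have h3 : ∀ t ∈ Set.Ioi (0 : ℝ), volume {z : ℂ | t < max (Real.log (R / ‖z‖)) 0} =
      ENNReal.ofReal (Real.pi * R ^ 2 * Real.exp (-2 * t)) := by
    intro t ht
    have ht0 : 0 < t := ht
    have : {z : ℂ | t < max (Real.log (R / ‖z‖)) 0} =
        Metric.ball 0 (R * Real.exp (-t)) \ {0} := by
      ext z
      simp only [Set.mem_ofPred_eq, lt_max_iff, not_lt.mpr ht0.le, or_false, Set.mem_sdiff,
        mem_ball_zero_iff, Set.mem_singleton_iff]
      by_cases hz : z = 0
      · simp [hz, ht0.le]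
      · have hz' : 0 < ‖z‖ := norm_pos_iff.mpr hz
        rw [Real.lt_log_iff_exp_lt (by positivity), lt_div_iff₀ hz', Real.exp_neg,
          ← div_eq_mul_inv, lt_div_iff₀ (Real.exp_pos t), mul_comm]
        simp [hz]
    rw [this, measure_sdiff_null (measure_singleton 0), Complex.volume_ball,
      ← ENNReal.ofReal_pow (by positivity), ← ENNReal.ofReal_coe_nnreal, ← ENNReal.ofReal_mul
        (by positivity), NNReal.coe_real_pi, mul_pow, ← Real.exp_nat_mul]
    congr 1
    push_cast
    ring_nf
  rw [setLIntegral_congr_fun measurableSet_Ioi h3, ← ofReal_integral_eq_lintegral_ofReal]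
  · rw [integral_const_mul, integral_exp_mul_Ioi (by norm_num)]
    congr 1
    simp
    ring
  · exact (integrableOn_exp_mul_Ioi (by norm_num) 0).const_mul _
  · exact ae_of_all _ fun t => by positivity

end BargmannNoise

namespace BargmannNoise

theorem measurable_uncurry_log_div_norm (R : ℝ) :
    Measurable (Function.uncurry fun z c : ℂ => ENNReal.ofReal (Real.log (R / ‖z - c‖))) :=
  (Real.measurable_log.comp (by fun_prop)).ennreal_ofReal

/-- With `R = e` the kernel is at least `1` on the punctured unit disc. The centre escapes because
`log (R / 0) = 0` by convention. -/
theorem isLocallyFiniteMeasure_of_potential {N : Measure ℂ} {J : ℂ → ℝ → ℝ}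
    (hJ : ∀ c, ∀ R > 0, ∫⁻ z, ENNReal.ofReal (Real.log (R / ‖z - c‖)) ∂N =
      ENNReal.ofReal (J c R)) : IsLocallyFiniteMeasure N := by
  have hsphere : ∀ c : ℂ, N (Metric.ball c 1 \ {c}) < ⊤ := by
    intro c
    have h := hJ c (Real.exp 1) (Real.exp_pos 1)
    have h2 : N (Metric.ball c 1 \ {c}) ≤ ENNReal.ofReal (J c (Real.exp 1)) := by
      rw [← h, ← lintegral_indicator_one (Metric.isOpen_ball.measurableSet.diff
        (measurableSet_singleton c))]
      refine lintegral_mono fun z => ?_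
      by_cases hz : z ∈ Metric.ball c 1 \ {c}
      swap
      · simp [Set.indicator_of_notMem hz]
      rw [Set.indicator_of_mem hz]
      have hz0 : 0 < ‖z - c‖ := norm_pos_iff.mpr (sub_ne_zero.mpr hz.2)
      have hz1 : ‖z - c‖ < 1 := by simpa [dist_eq_norm] using hz.1
      rw [Pi.one_apply, ← ENNReal.ofReal_one]
      refine ENNReal.ofReal_le_ofReal ?_
      rw [Real.le_log_iff_exp_le (by positivity), le_div_iff₀ hz0]
      nlinarith [Real.exp_pos 1]
    exact h2.trans_lt ENNReal.ofReal_lt_top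
  -- To include the centre, a small disc around `c` is placed inside the punctured unit disc around
  -- `c + 1/2`.
  refine ⟨fun c => ⟨Metric.ball c (1 / 4), Metric.ball_mem_nhds c (by norm_num), ?_⟩⟩
  refine (measure_mono (t := (Metric.ball (c + 1 / 2) 1 \ {c + 1 / 2})) ?_).trans_lt (hsphere _)
  intro z hz
  have hz' : ‖z - c‖ < 1 / 4 := by simpa [dist_eq_norm] using hz
  have e : z - (c + 1 / 2) = (z - c) - 1 / 2 := by ring
  have e2 : ‖(1 / 2 : ℂ)‖ = 1 / 2 := by norm_num
  refine ⟨?_, fun h => ?_⟩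
  · rw [Metric.mem_ball, dist_eq_norm, e]
    have := norm_sub_le (z - c) (1 / 2)
    linarith
  · rw [Set.mem_singleton_iff] at h
    rw [h, add_sub_cancel_left, e2] at hz'
    linarith

section Squeeze

variable {N : Measure ℂ} {D : ℂ → ℝ} {J : ℂ → ℝ → ℝ} {C : ℝ}

/-- Tonelli: integrating the potentials over the centres in `A` smooths the indicator of `A` by a
kernel supported at distance at most `R`. -/
theorem lintegral_setLIntegral_log_div_norm [SFinite N]
    (hJ : ∀ c, ∀ R > 0, ∫⁻ z, ENNReal.ofReal (Real.log (R / ‖z - c‖)) ∂N =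
      ENNReal.ofReal (J c R)) {R : ℝ} (hR : 0 < R) (A : Set ℂ) :
    ∫⁻ z, (∫⁻ c in A, ENNReal.ofReal (Real.log (R / ‖z - c‖))) ∂N =
      ∫⁻ c in A, ENNReal.ofReal (J c R) := by
  rw [lintegral_lintegral_swap (measurable_uncurry_log_div_norm R).aemeasurable]
  simp_rw [fun c => hJ c R hR]

theorem setLIntegral_density (hD : Continuous D) {R : ℝ} (A : Set ℂ) :
    ∫⁻ c in A, (ENNReal.ofReal (Real.pi * R ^ 2 / 2) * ENNReal.ofReal (D c) +
        ENNReal.ofReal (Real.pi * R ^ 2 / 2) * ENNReal.ofReal (C * R)) =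
      ENNReal.ofReal (Real.pi * R ^ 2 / 2) *
        (∫⁻ c in A, ENNReal.ofReal (D c)) +
          ENNReal.ofReal (Real.pi * R ^ 2 / 2) * (ENNReal.ofReal (C * R) * volume A) := by
  rw [lintegral_add_right _ measurable_const, lintegral_const_mul _
    hD.measurable.ennreal_ofReal, setLIntegral_const, mul_assoc]

/-- For `z ∈ K` the whole mass `πR²/2` of the kernel around `z` is carried by the `R`-thickening of
`K`, so averaging the potentials over that thickening dominates `N K`. -/
theorem measure_compact_le_of_potential [SFinite N] (hD : Continuous D) (hD0 : ∀ c, 0 ≤ D c)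
    (hJ : ∀ c, ∀ R > 0, ∫⁻ z, ENNReal.ofReal (Real.log (R / ‖z - c‖)) ∂N =
      ENNReal.ofReal (J c R)) {R : ℝ} (hR : 0 < R) (hC0 : 0 ≤ C)
    (hC : ∀ c, J c R ≤ Real.pi * R ^ 2 / 2 * (D c + C * R)) {K : Set ℂ} (hK : IsCompact K) :
    N K ≤ volume.withDensity (fun z => ENNReal.ofReal (D z)) (Metric.cthickening R K) +
      ENNReal.ofReal (C * R) * volume (Metric.cthickening R K) := by
  have hm0 : ENNReal.ofReal (Real.pi * R ^ 2 / 2) ≠ 0 := by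
    rw [ne_eq, ENNReal.ofReal_eq_zero, not_le]; positivity
  have hV : MeasurableSet (Metric.cthickening R K) := Metric.isClosed_cthickening.measurableSet
  rw [withDensity_apply _ hV, ← ENNReal.mul_le_mul_iff_right hm0 ENNReal.ofReal_ne_top, mul_add,
    ← setLIntegral_density hD]
  calc ENNReal.ofReal (Real.pi * R ^ 2 / 2) * N K
      = ∫⁻ z in K, ENNReal.ofReal (Real.pi * R ^ 2 / 2) ∂N := by rw [setLIntegral_const]
    _ ≤ ∫⁻ z in K, (∫⁻ c in Metric.cthickening R K, ENNReal.ofReal (Real.log (R / ‖z - c‖))) ∂N := by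
        refine setLIntegral_mono' hK.measurableSet fun z hz => ?_
        rw [← lintegral_log_div_norm hR z, ← lintegral_indicator hV]
        refine lintegral_mono fun c => ?_
        by_cases hc : c ∈ Metric.cthickening R K
        · rw [Set.indicator_of_mem hc, norm_sub_rev]
        · rw [Set.indicator_of_notMem hc]
          refine (ENNReal.ofReal_of_nonpos (Real.log_nonpos (by positivity) ?_)).le
          have h3 : R < ‖c - z‖ := by
            rw [← dist_eq_norm]
            by_contra! h
            exact hc (Metric.mem_cthickening_of_dist_le c z R K hz h)
          exact (div_le_one (hR.trans h3)).mpr h3.le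
    _ ≤ ∫⁻ z, (∫⁻ c in Metric.cthickening R K, ENNReal.ofReal (Real.log (R / ‖z - c‖))) ∂N :=
        setLIntegral_le_lintegral _ _
    _ = ∫⁻ c in Metric.cthickening R K, ENNReal.ofReal (J c R) :=
        lintegral_setLIntegral_log_div_norm hJ hR _
    _ ≤ _ := by
        refine lintegral_mono fun c => ?_
        rw [← ENNReal.ofReal_mul (by positivity), ← ENNReal.ofReal_mul (by positivity),
          ← ENNReal.ofReal_add (mul_nonneg (by positivity) (hD0 c)) (by positivity), ← mul_add]
        exact ENNReal.ofReal_le_ofReal (hC c)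

/-- The opposite estimate: centres in `K` only reach points of the `R`-thickening of `K`, contained
in `U`, and each such point receives at most the full mass `πR²/2`. -/
theorem le_measure_open_of_potential [SFinite N] (hD : Continuous D)
    (hJ : ∀ c, ∀ R > 0, ∫⁻ z, ENNReal.ofReal (Real.log (R / ‖z - c‖)) ∂N =
      ENNReal.ofReal (J c R)) {R : ℝ} (hR : 0 < R)
    (hC : ∀ c, Real.pi * R ^ 2 / 2 * (D c - C * R) ≤ J c R) {K U : Set ℂ} (hK : IsCompact K)
    (hKU : Metric.cthickening R K ⊆ U) (hU : IsOpen U) :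
    volume.withDensity (fun z => ENNReal.ofReal (D z)) K ≤
      N U + ENNReal.ofReal (C * R) * volume K := by
  have hm0 : ENNReal.ofReal (Real.pi * R ^ 2 / 2) ≠ 0 := by
    rw [ne_eq, ENNReal.ofReal_eq_zero, not_le]; positivity
  rw [withDensity_apply _ hK.measurableSet, ← ENNReal.mul_le_mul_iff_right hm0
    ENNReal.ofReal_ne_top, mul_add]
  calc ENNReal.ofReal (Real.pi * R ^ 2 / 2) * ∫⁻ c in K, ENNReal.ofReal (D c)
      = ∫⁻ c in K, ENNReal.ofReal (Real.pi * R ^ 2 / 2) * ENNReal.ofReal (D c) := by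
        rw [lintegral_const_mul _ hD.measurable.ennreal_ofReal]
    _ ≤ ∫⁻ c in K, (ENNReal.ofReal (J c R) +
          ENNReal.ofReal (Real.pi * R ^ 2 / 2) * ENNReal.ofReal (C * R)) := by
        refine lintegral_mono fun c => ?_
        rw [← ENNReal.ofReal_mul (by positivity), ← ENNReal.ofReal_mul (by positivity)]
        refine le_trans (ENNReal.ofReal_le_ofReal ?_) ENNReal.ofReal_add_le
        linarith [hC c]
    _ = (∫⁻ z, (∫⁻ c in K, ENNReal.ofReal (Real.log (R / ‖z - c‖))) ∂N) +
          ENNReal.ofReal (Real.pi * R ^ 2 / 2) * (ENNReal.ofReal (C * R) * volume K) := by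
        rw [lintegral_add_right _ measurable_const, setLIntegral_const, mul_assoc,
          lintegral_setLIntegral_log_div_norm hJ hR]
    _ ≤ _ := by
        gcongr
        rw [← setLIntegral_const, ← lintegral_indicator hU.measurableSet]
        refine lintegral_mono fun z => ?_
        by_cases hz : z ∈ U
        · rw [Set.indicator_of_mem hz, ← lintegral_log_div_norm hR z]
          refine (setLIntegral_le_lintegral _ _).trans (lintegral_mono fun c => ?_)
          rw [norm_sub_rev]
        · rw [Set.indicator_of_notMem hz]
          refine (setLIntegral_eq_zero hK.measurableSet fun c hc => ?_).le
          refine ENNReal.ofReal_of_nonpos (Real.log_nonpos (by positivity) ?_)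
          have h3 : R < ‖z - c‖ := by
            rw [← dist_eq_norm]
            by_contra! h
            exact hz (hKU (Metric.mem_cthickening_of_dist_le z c R K hc h))
          exact (div_le_one (hR.trans h3)).mpr h3.le

/-- A measure on `ℂ` is determined by the asymptotics of its local logarithmic potentials. -/
theorem eq_withDensity_of_potential (hD : Continuous D) (hD0 : ∀ c, 0 ≤ D c)
    (hJ : ∀ c, ∀ R > 0, ∫⁻ z, ENNReal.ofReal (Real.log (R / ‖z - c‖)) ∂N =
      ENNReal.ofReal (J c R)) {r : ℝ} (hr : 0 < r) (hC0 : 0 ≤ C)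
    (hC : ∀ c, ∀ R > 0, R ≤ r → |J c R - Real.pi * R ^ 2 / 2 * D c| ≤
      Real.pi * R ^ 2 / 2 * (C * R)) :
    N = volume.withDensity (fun z => ENNReal.ofReal (D z)) := by
  have hN := isLocallyFiniteMeasure_of_potential hJ
  have hρ : IsLocallyFiniteMeasure (volume.withDensity (fun z => ENNReal.ofReal (D z))) :=
    IsLocallyFiniteMeasure.withDensity_ofReal hD
  have hev : ∀ᶠ R in 𝓝[>] (0 : ℝ), R ∈ Set.Ioc 0 r := Ioc_mem_nhdsGT hr
  have hlim : ∀ {M : ENNReal}, M ≠ ⊤ →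
      Tendsto (fun R => ENNReal.ofReal (C * R) * M) (𝓝[>] (0 : ℝ)) (𝓝 0) := fun {M} hM => by
    have h1 : Tendsto (fun R : ℝ => ENNReal.ofReal (C * R)) (𝓝[>] (0 : ℝ)) (𝓝 0) := by
      have : Continuous fun R : ℝ => ENNReal.ofReal (C * R) :=
        ENNReal.continuous_ofReal.comp (continuous_const.mul continuous_id)
      have h := this.tendsto 0
      simp only [mul_zero, ENNReal.ofReal_zero] at h
      exact h.mono_left nhdsWithin_le_nhds
    simpa using ENNReal.Tendsto.mul_const h1 (Or.inr hM)
  -- As `R → 0` the thickenings of `K` decrease to `K` and the error terms vanish. Inner regularity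
  -- then passes from compact to open sets, which determine both measures.
  have hup : ∀ K : Set ℂ, IsCompact K →
      N K ≤ volume.withDensity (fun z => ENNReal.ofReal (D z)) K := by
    intro K hK
    have h1 : Tendsto (fun R => volume.withDensity (fun z => ENNReal.ofReal (D z))
        (Metric.cthickening R K)) (𝓝[>] (0 : ℝ))
        (𝓝 (volume.withDensity (fun z => ENNReal.ofReal (D z)) K)) :=
      (tendsto_measure_cthickening_of_isCompact hK).mono_left nhdsWithin_le_nhds
    have h2 := h1.add (hlim (M := volume (Metric.cthickening r K))
      (hK.cthickening.measure_lt_top).ne)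
    rw [add_zero] at h2
    refine ge_of_tendsto h2 (hev.mono fun R hR => ?_)
    refine (measure_compact_le_of_potential hD hD0 hJ hR.1 hC0 (fun c => ?_) hK).trans ?_
    · have := (abs_le.mp (hC c R hR.1 hR.2)).2
      linarith
    · gcongr
      exact Metric.cthickening_mono hR.2 K
  refine Measure.OuterRegular.ext_isOpen fun U hU => le_antisymm ?_ ?_
  · rw [hU.measure_eq_iSup_isCompact N]
    exact iSup_le fun K => iSup_le fun hKU => iSup_le fun hK => (hup K hK).trans (measure_mono hKU)
  · rw [hU.measure_eq_iSup_isCompact (volume.withDensity _)]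
    refine iSup_le fun K => iSup_le fun hKU => iSup_le fun hK => ?_
    obtain ⟨δ, hδ, hsub⟩ := hK.exists_cthickening_subset_open hU hKU
    have h2 := (hlim (M := volume K) hK.measure_lt_top.ne).const_add (N U)
    rw [add_zero] at h2
    refine ge_of_tendsto h2 ?_
    filter_upwards [hev, Ioc_mem_nhdsGT hδ] with R hR hR2
    refine le_measure_open_of_potential hD hJ hR.1 (fun c => ?_) hK
      ((Metric.cthickening_mono hR2.2 K).trans hsub) hU
    have := (abs_le.mp (hC c R hR.1 hR.2)).1
    linarith

end Squeeze

end BargmannNoise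

namespace BargmannNoise

/-! ### The intensity of the critical points -/

theorem hasSum_succ_mul_pow_div_factorial (t : ℂ) :
    HasSum (fun j : ℕ => ((j : ℂ) + 1) * (t ^ j / (j.factorial : ℂ)))
      ((1 + t) * Complex.exp t) := by
  have h0 : HasSum (fun j : ℕ => t ^ j / (j.factorial : ℂ)) (Complex.exp t) := by
    rw [Complex.exp_eq_exp_ℂ]
    exact NormedSpace.expSeries_div_hasSum_exp t
  have h1 : HasSum (fun j : ℕ => (j : ℂ) * (t ^ j / (j.factorial : ℂ))) (t * Complex.exp t) := by
    rw [← hasSum_nat_add_iff' 1]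
    simp only [Finset.range_one, Finset.sum_singleton, Nat.cast_zero, zero_mul, sub_zero]
    refine (h0.mul_left t).congr_fun fun j => ?_
    have hj : ((j : ℂ) + 1) ≠ 0 := by exact_mod_cast Nat.succ_ne_zero j
    have hf : (j.factorial : ℂ) ≠ 0 := by exact_mod_cast j.factorial_ne_zero
    rw [Nat.factorial_succ]
    push_cast
    field_simp
    ring
  have := h1.add h0
  rw [show (1 + t) * Complex.exp t = t * Complex.exp t + Complex.exp t by ring]
  exact this.congr_fun fun j => by ring

/-- The term `k = 0` vanishes, and for `k = j + 1` one has `k²/k! = (j + 1)/j!`. -/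
theorem hasSum_criticalCoeff_kernel (z w : ℂ) :
    HasSum (fun k => criticalCoeff k z * (starRingEnd ℂ) (criticalCoeff k w))
      ((1 + z * (starRingEnd ℂ) w) * Complex.exp (z * (starRingEnd ℂ) w)) := by
  rw [← hasSum_nat_add_iff' 1]
  simp only [Finset.range_one, Finset.sum_singleton, criticalCoeff, Nat.cast_zero, zero_mul,
    zero_div, sub_zero]
  refine (hasSum_succ_mul_pow_div_factorial (z * (starRingEnd ℂ) w)).congr_fun fun j => ?_
  have hj : ((j : ℂ) + 1) ≠ 0 := by exact_mod_cast Nat.succ_ne_zero j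
  have hf : (j.factorial : ℂ) ≠ 0 := by exact_mod_cast j.factorial_ne_zero
  have hs : ((√((j + 1).factorial : ℝ) : ℝ) : ℂ) ^ 2 = ((j : ℂ) + 1) * (j.factorial : ℂ) := by
    rw [← Complex.ofReal_pow, Real.sq_sqrt (by positivity), Nat.factorial_succ]
    push_cast
    ring
  simp only [map_div₀, map_mul, map_pow, Complex.conj_ofReal, map_natCast, Nat.add_sub_cancel]
  rw [div_mul_div_comm, ← sq, hs, mul_pow]
  push_cast
  field_simp

theorem gafKernel_criticalCoeff (z w : ℂ) : gafKernel criticalCoeff z w =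
    (1 + z * (starRingEnd ℂ) w) * Complex.exp (z * (starRingEnd ℂ) w) :=
  (hasSum_criticalCoeff_kernel z w).tsum_eq

theorem gafVar_criticalCoeff (z : ℂ) :
    gafVar criticalCoeff z = (1 + ‖z‖ ^ 2) * Real.exp (‖z‖ ^ 2) := by
  have h := gafKernel_criticalCoeff z z
  rw [gafKernel_self, Complex.mul_conj, Complex.normSq_eq_norm_sq] at h
  exact_mod_cast h

theorem gafVar_criticalCoeff_ne_zero (z : ℂ) : gafVar criticalCoeff z ≠ 0 := by
  rw [gafVar_criticalCoeff]
  positivity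

theorem isGAFCoeff_criticalCoeff : IsGAFCoeff criticalCoeff := by
  refine ⟨fun k => ?_, fun K hK => ?_⟩
  · unfold criticalCoeff
    fun_prop
  · obtain ⟨C, hC⟩ := hK.exists_bound_of_continuousOn
      (f := fun z : ℂ => (1 + ‖z‖ ^ 2) * Real.exp (‖z‖ ^ 2)) (by fun_prop)
    refine ⟨C, fun z hz => ⟨?_, ?_⟩⟩
    · have h := (hasSum_criticalCoeff_kernel z z).summable.norm
      refine h.congr fun k => ?_
      rw [norm_mul, RCLike.norm_conj, sq]
    · have h := hC z hz
      rw [← gafVar_criticalCoeff] at h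
      exact (le_abs_self _).trans h

/-- The density of `criticalIntensity`. -/
noncomputable def criticalDensity (z : ℂ) : ℝ := 1 / Real.pi * (1 + 1 / (1 + ‖z‖ ^ 2) ^ 2)

theorem log_gafVar_criticalCoeff (z : ℂ) :
    Real.log (gafVar criticalCoeff z) / 2 = Real.log (1 + ‖z‖ ^ 2) / 2 + ‖z‖ ^ 2 / 2 := by
  rw [gafVar_criticalCoeff, Real.log_mul (by positivity) (by positivity), Real.log_exp, add_div]

theorem abs_log_one_add_sub_le {s : ℝ} (hs : |s| ≤ 1 / 2) :
    |Real.log (1 + s) - (s - s ^ 2 / 2)| ≤ 2 * |s| ^ 3 := by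
  have h := Real.abs_log_sub_add_sum_range_le (x := -s) (by rw [abs_neg]; linarith) 2
  rw [abs_neg] at h
  have e : ∑ i ∈ Finset.range 2, (-s) ^ (i + 1) / ((i : ℝ) + 1) + Real.log (1 - -s) =
      Real.log (1 + s) - (s - s ^ 2 / 2) := by
    rw [Finset.sum_range_succ, Finset.sum_range_one]
    norm_num
    ring
  rw [e] at h
  refine h.trans ((div_le_iff₀ (by linarith)).mpr ?_)
  norm_num
  nlinarith [mul_nonneg (pow_nonneg (abs_nonneg s) 3) (sub_nonneg.mpr hs)]

/-- The second order expansion of `log (gafVar criticalCoeff)` on a circle, up to the real part of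
an entire function vanishing at the centre. -/
theorem abs_log_gafVar_criticalCoeff_sub_le {c z : ℂ} {R : ℝ} (hR : 0 < R) (hR4 : R ≤ 1 / 4)
    (hz : ‖z - c‖ = R) :
    |Real.log (gafVar criticalCoeff z) / 2 - (Real.log (gafVar criticalCoeff c) / 2 +
      Real.pi * R ^ 2 / 2 * criticalDensity c +
      ((starRingEnd ℂ c * (z - c)) *
          ((1 + 1 / (1 + ‖c‖ ^ 2) - R ^ 2 / (1 + ‖c‖ ^ 2) ^ 2 : ℝ) : ℂ) -
        (starRingEnd ℂ c * (z - c)) ^ 2 * ((1 / (2 * (1 + ‖c‖ ^ 2) ^ 2) : ℝ) : ℂ)).re)| ≤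
      9 * R ^ 3 := by
  -- On the circle `|z|² = |c|² + 2 Re ζ + R²`, so with `Q = 1 + |c|²` the relative increment of `1
  -- + |z|²` is `s = (2 Re ζ + R²)/Q`. Writing `(Re ζ)² = (|ζ|² + Re ζ²)/2`, everything of order at
  -- most two is a constant plus the real part of a polynomial in `ζ`. The constant is `R²/2 · (1 +
  -- 1/Q - (Q - 1)/Q²) = R²/2 · (1 + 1/Q²)`.
  set ζ := starRingEnd ℂ c * (z - c) with hζ
  set Q := 1 + ‖c‖ ^ 2 with hQ
  have hQ1 : 1 ≤ Q := by rw [hQ]; nlinarith [sq_nonneg ‖c‖]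
  have hnζ : ‖ζ‖ = ‖c‖ * R := by rw [hζ, norm_mul, RCLike.norm_conj, hz]
  have hz2 : ‖z‖ ^ 2 = ‖c‖ ^ 2 + 2 * ζ.re + R ^ 2 := by
    have : z = c + (z - c) := by ring
    conv_lhs => rw [this]
    rw [← hz, ← Complex.normSq_eq_norm_sq, ← Complex.normSq_eq_norm_sq, ← Complex.normSq_eq_norm_sq,
      Complex.normSq_add, hζ, mul_comm c, ← Complex.conj_re (starRingEnd ℂ c * (z - c))]
    simp
    ring
  have hx2 : ζ.re ^ 2 = (‖c‖ ^ 2 * R ^ 2 + (ζ ^ 2).re) / 2 := by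
    have h1 : ζ.re ^ 2 + ζ.im ^ 2 = ‖c‖ ^ 2 * R ^ 2 := by
      rw [← mul_pow, ← hnζ, ← Complex.normSq_eq_norm_sq, Complex.normSq_apply]
      ring
    have h2 : (ζ ^ 2).re = ζ.re ^ 2 - ζ.im ^ 2 := by
      rw [sq, sq, sq]
      exact Complex.mul_re ζ ζ
    linarith
  set s := (2 * ζ.re + R ^ 2) / Q with hs
  have hsle : |s| ≤ 2 * R := by
    rw [hs, abs_div, abs_of_pos (by linarith : 0 < Q), div_le_iff₀ (by linarith)]
    have h1 : |ζ.re| ≤ ‖c‖ * R := hnζ ▸ Complex.abs_re_le_norm ζ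
    have h2 : |2 * ζ.re + R ^ 2| ≤ 2 * |ζ.re| + R ^ 2 := by
      refine (abs_add_le _ _).trans ?_
      rw [abs_mul, abs_two, abs_of_nonneg (sq_nonneg R)]
    nlinarith [sq_nonneg (‖c‖ - 1), norm_nonneg c, sq_nonneg ‖c‖]
  have hs2 : |s| ≤ 1 / 2 := by linarith
  have h1s : 0 < 1 + s := by linarith [(abs_le.mp hs2).1]
  have hQs : 1 + ‖z‖ ^ 2 = Q * (1 + s) := by
    rw [hs, hz2, hQ]
    field_simp
    ring
  have hlog := abs_log_one_add_sub_le hs2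
  have hs3 : |s| ^ 3 ≤ 8 * R ^ 3 := by
    calc |s| ^ 3 ≤ (2 * R) ^ 3 := by gcongr
      _ = 8 * R ^ 3 := by ring
  have hR4' : R ^ 4 / (4 * Q ^ 2) ≤ R ^ 3 := by
    rw [div_le_iff₀ (by positivity)]
    have : R ^ 3 * R ≤ R ^ 3 * (4 * Q ^ 2) := by
      gcongr
      nlinarith
    calc R ^ 4 = R ^ 3 * R := by ring
      _ ≤ _ := this
  have hR40 : 0 ≤ R ^ 4 / (4 * Q ^ 2) := by positivity
  have hre : (ζ * ((1 + 1 / Q - R ^ 2 / Q ^ 2 : ℝ) : ℂ) - ζ ^ 2 * ((1 / (2 * Q ^ 2) : ℝ) : ℂ)).re =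
      ζ.re * (1 + 1 / Q - R ^ 2 / Q ^ 2) - (ζ ^ 2).re * (1 / (2 * Q ^ 2)) := by
    rw [Complex.sub_re, Complex.re_mul_ofReal, Complex.re_mul_ofReal]
  have hmain : Real.log (gafVar criticalCoeff z) / 2 - (Real.log (gafVar criticalCoeff c) / 2 +
      Real.pi * R ^ 2 / 2 * criticalDensity c +
      (ζ * ((1 + 1 / Q - R ^ 2 / Q ^ 2 : ℝ) : ℂ) - ζ ^ 2 * ((1 / (2 * Q ^ 2) : ℝ) : ℂ)).re) =
      (Real.log (1 + s) - (s - s ^ 2 / 2)) / 2 - R ^ 4 / (4 * Q ^ 2) := by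
    rw [hre, log_gafVar_criticalCoeff, log_gafVar_criticalCoeff, hQs, ← hQ,
      Real.log_mul (by positivity) h1s.ne', hz2, criticalDensity, ← hQ]
    have e1 : (ζ ^ 2).re = 2 * ζ.re ^ 2 - ‖c‖ ^ 2 * R ^ 2 := by rw [hx2]; ring
    have e2 : ‖c‖ ^ 2 = Q - 1 := by rw [hQ]; ring
    rw [e1, e2, hs]
    field_simp
    ring
  -- The constant `9` is `8`, from half of `2|s|³` with `|s| ≤ 2R`, plus `1` for the term
  -- `R⁴/(4Q²)`.
  rw [hmain, abs_le]
  obtain ⟨a1, a2⟩ := abs_le.mp hlog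
  constructor <;> linarith

theorem abs_circleAverage_log_gafVar_criticalCoeff_sub_le (c : ℂ) {R : ℝ} (hR : 0 < R)
    (hR4 : R ≤ 1 / 4) :
    |Real.circleAverage (fun z => Real.log (gafVar criticalCoeff z) / 2) c R -
        Real.log (gafVar criticalCoeff c) / 2 - Real.pi * R ^ 2 / 2 * criticalDensity c| ≤
      Real.pi * R ^ 2 / 2 * (6 * R) := by
  have hcont : Continuous fun z => Real.log (gafVar criticalCoeff z) / 2 :=
    ((continuous_gafVar isGAFCoeff_criticalCoeff).log gafVar_criticalCoeff_ne_zero).div_const 2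
  set A := Real.log (gafVar criticalCoeff c) / 2 + Real.pi * R ^ 2 / 2 * criticalDensity c with hA
  let H : ℂ → ℂ := fun z => (starRingEnd ℂ c * (z - c)) *
      ((1 + 1 / (1 + ‖c‖ ^ 2) - R ^ 2 / (1 + ‖c‖ ^ 2) ^ 2 : ℝ) : ℂ) -
    (starRingEnd ℂ c * (z - c)) ^ 2 * ((1 / (2 * (1 + ‖c‖ ^ 2) ^ 2) : ℝ) : ℂ)
  have hHd : Differentiable ℂ H := by fun_prop
  have hHc : Continuous fun z => (H z).re := Complex.continuous_re.comp hHd.continuous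
  -- `H` is holomorphic and vanishes at `c`, so it drops out of circle averages.
  have havg : ∀ t : ℝ, Real.circleAverage (fun z => ((t : ℂ) + H z).re) c R = t := by
    intro t
    have hd : Differentiable ℂ fun z => (t : ℂ) + H z := by fun_prop
    rw [InnerProductSpace.HarmonicOnNhd.circleAverage_eq
      fun z _ => (hd.analyticAt z).harmonicAt_re]
    simp [H]
  have hbound : ∀ z ∈ Metric.sphere c |R|,
      |Real.log (gafVar criticalCoeff z) / 2 - (A + (H z).re)| ≤ 9 * R ^ 3 := by
    intro z hz
    rw [abs_of_pos hR, mem_sphere_iff_norm] at hz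
    exact abs_log_gafVar_criticalCoeff_sub_le hR hR4 hz
  have hint : ∀ t : ℝ, CircleIntegrable (fun z => ((t : ℂ) + H z).re) c R := fun t => by
    have : Continuous fun z => ((t : ℂ) + H z).re :=
      Complex.continuous_re.comp (by fun_prop)
    exact this.continuousOn.circleIntegrable'
  have hup := Real.circleAverage_mono (f₂ := fun z => (((A + 9 * R ^ 3 : ℝ) : ℂ) + H z).re)
    hcont.continuousOn.circleIntegrable' (hint _) fun z hz => by
      rw [Complex.add_re, Complex.ofReal_re]
      linarith [(abs_le.mp (hbound z hz)).2]
  have hlo := Real.circleAverage_mono (f₁ := fun z => (((A - 9 * R ^ 3 : ℝ) : ℂ) + H z).re)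
    (hint _) hcont.continuousOn.circleIntegrable' fun z hz => by
      rw [Complex.add_re, Complex.ofReal_re]
      linarith [(abs_le.mp (hbound z hz)).1]
  rw [havg] at hup hlo
  -- The constant `6` suffices because `3π > 9`.
  have h3 : 9 * R ^ 3 ≤ Real.pi * R ^ 2 / 2 * (6 * R) := by
    have : 0 < R ^ 3 := by positivity
    nlinarith [Real.pi_gt_three]
  rw [abs_le]
  constructor <;> linarith

/-- The potentials from Jensen's formula have the second order asymptotics of the density; this
replaces computing `Δ log K(z,z)/(4π)` as a distribution. -/
theorem meanZeros_criticalCoeff : meanZeros criticalCoeff = criticalIntensity := by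
  have hD : Continuous criticalDensity := by
    unfold criticalDensity
    exact continuous_const.mul (continuous_const.add
      (continuous_const.div (by fun_prop) fun z => by positivity))
  exact eq_withDensity_of_potential (r := 1 / 4) (C := 6) hD
    (fun c => by positivity)
    (fun c R hR => (lintegral_log_meanZeros isGAFCoeff_criticalCoeff hR
      fun z _ => gafVar_criticalCoeff_ne_zero z).1) (by norm_num) (by norm_num)
    fun c R hR hR4 => abs_circleAverage_log_gafVar_criticalCoeff_sub_le c hR hR4

instance : IsLocallyFiniteMeasure criticalIntensity := by
  rw [← meanZeros_criticalCoeff]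
  exact isLocallyFiniteMeasure_of_potential fun c R hR =>
    (lintegral_log_meanZeros isGAFCoeff_criticalCoeff hR
      fun z _ => gafVar_criticalCoeff_ne_zero z).1

end BargmannNoise

namespace BargmannNoise

/-! ### Analytic functions with the mean value property are harmonic -/

theorem exists_re_eq_of_clm (L : ℂ →L[ℝ] ℝ) : ∃ β : ℂ, ∀ y, L y = (β * y).re := by
  refine ⟨L 1 - L Complex.I * Complex.I, fun y => ?_⟩
  have hy : y = y.re • (1 : ℂ) + y.im • Complex.I := by simp [Complex.re_add_im]
  conv_lhs => rw [hy]
  rw [map_add, map_smul, map_smul]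
  simp
  ring

/-- A real quadratic form on the plane is a multiple of `|y|²`, given by its trace, plus a
trace-free part, which is the real part of a complex square. -/
theorem exists_re_eq_of_bilin (B : ℂ →ₗ[ℝ] ℂ →ₗ[ℝ] ℝ) : ∃ γ : ℂ, ∀ y,
    B y y = (B 1 1 + B Complex.I Complex.I) / 2 * ‖y‖ ^ 2 + (γ * y ^ 2).re := by
  refine ⟨((B 1 1 - B Complex.I Complex.I) / 2 : ℝ) -
    ((B 1 Complex.I + B Complex.I 1) / 2 : ℝ) * Complex.I, fun y => ?_⟩
  have hy : y = y.re • (1 : ℂ) + y.im • Complex.I := by simp [Complex.re_add_im]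
  have h1 : B y y = y.re * (y.re * B 1 1 + y.im * B 1 Complex.I) +
      y.im * (y.re * B Complex.I 1 + y.im * B Complex.I Complex.I) := by
    conv_lhs => rw [hy]
    simp only [map_add, map_smul, LinearMap.add_apply, LinearMap.smul_apply, smul_eq_mul]
    ring
  rw [h1, ← Complex.normSq_eq_norm_sq, Complex.normSq_apply, sq y]
  simp
  ring

/-- By Taylor expansion the circle average is `f(c) + T R²/4 + O(R³)` with `T` the Laplacian: the
linear and trace-free quadratic parts are real parts of holomorphic functions vanishing at `c`. The
mean value property forces `|T/4| = O(R)` for all small `R`. -/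
theorem laplacian_eq_zero_of_circleAverage {f : ℂ → ℝ} {c : ℂ} (hf : AnalyticAt ℝ f c)
    (hmv : ∀ᶠ R in 𝓝[>] (0 : ℝ), Real.circleAverage f c R = f c) :
    Laplacian.laplacian f c = 0 := by
  obtain ⟨p, r, hp⟩ := id hf
  obtain ⟨C, hC⟩ := hp.hasFPowerSeriesAt.isBigO_sub_partialSum_pow 3 |>.bound
  set B := bilinearIteratedFDerivTwo ℝ f c with hB
  have hBe : ∀ e₁ e₂, B e₁ e₂ = iteratedFDeriv ℝ 2 f c ![e₁, e₂] := fun e₁ e₂ =>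
    bilinearIteratedFDerivTwo_eq_iteratedFDeriv f c e₁ e₂
  obtain ⟨β, hβ⟩ := exists_re_eq_of_clm (fderiv ℝ f c)
  obtain ⟨γ, hγ⟩ := exists_re_eq_of_bilin B
  have hlap : Laplacian.laplacian f c = B 1 1 + B Complex.I Complex.I := by
    rw [InnerProductSpace.laplacian_eq_iteratedFDeriv_complexPlane, hBe, hBe]
  rw [hlap]
  set T := B 1 1 + B Complex.I Complex.I with hT
  have hps : ∀ y, p.partialSum 3 y =
      f c + T / 4 * ‖y‖ ^ 2 + (β * y + γ / 2 * y ^ 2).re := by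
    intro y
    have h1 := hp.factorial_smul y 1
    have h2 := hp.factorial_smul y 2
    have e2 : (fun _ : Fin 2 => y) = ![y, y] := by
      funext i; fin_cases i <;> rfl
    rw [iteratedFDeriv_one_apply, hβ] at h1
    rw [e2, ← hBe, hγ] at h2
    have h3 : (γ / 2 * y ^ 2).re = (γ * y ^ 2).re / 2 := by
      rw [div_mul_eq_mul_div]
      simp
    have h0 : p 0 (fun _ => y) = f c := hp.coeff_zero _
    simp only [Nat.factorial_one, one_smul, Nat.factorial_two, nsmul_eq_mul, Nat.cast_ofNat] at h1 h2
    rw [FormalMultilinearSeries.partialSum, Finset.sum_range_succ, Finset.sum_range_succ,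
      Finset.sum_range_one, h0, h1, Complex.add_re, h3, e2]
    linarith
  have hC0 : ∀ᶠ y in 𝓝 (0 : ℂ), |f (c + y) - p.partialSum 3 y| ≤ |C| * ‖y‖ ^ 3 := by
    filter_upwards [hC] with y hy
    refine hy.trans ?_
    rw [norm_pow, norm_norm]
    gcongr
    exact le_abs_self C
  have htend : Tendsto (fun y : ℂ => c + y) (𝓝 0) (𝓝 c) := by
    have : Continuous fun y : ℂ => c + y := by fun_prop
    simpa using this.tendsto 0
  obtain ⟨δ, hδ, hball⟩ := Metric.eventually_nhds_iff_ball.mp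
    (hC0.and (htend.eventually hf.eventually_analyticAt))
  have key : ∀ᶠ R in 𝓝[>] (0 : ℝ), |T / 4| ≤ |C| * R := by
    filter_upwards [hmv, Ioo_mem_nhdsGT hδ] with R hR hRδ
    have hR0 : 0 < R := hRδ.1
    have hy : ∀ z ∈ Metric.sphere c |R|, ‖z - c‖ = R ∧ z - c ∈ Metric.ball (0 : ℂ) δ := by
      intro z hz
      rw [abs_of_pos hR0, mem_sphere_iff_norm] at hz
      exact ⟨hz, by rw [mem_ball_zero_iff, hz]; exact hRδ.2⟩
    have hcont : CircleIntegrable f c R := by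
      refine ContinuousOn.circleIntegrable' fun z hz => ?_
      have := (hball _ (hy z hz).2).2
      rw [add_sub_cancel] at this
      exact this.continuousAt.continuousWithinAt
    let H : ℂ → ℂ := fun z => β * (z - c) + γ / 2 * (z - c) ^ 2
    have hint : ∀ t : ℝ, CircleIntegrable (fun z => ((t : ℂ) + H z).re) c R := fun t => by
      have : Continuous fun z => ((t : ℂ) + H z).re :=
        Complex.continuous_re.comp (by fun_prop)
      exact this.continuousOn.circleIntegrable'
    have havg : ∀ t : ℝ, Real.circleAverage (fun z => ((t : ℂ) + H z).re) c R = t := by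
      intro t
      have hd : Differentiable ℂ fun z => (t : ℂ) + H z := by fun_prop
      rw [InnerProductSpace.HarmonicOnNhd.circleAverage_eq
        fun z _ => (hd.analyticAt z).harmonicAt_re]
      simp [H]
    have hbd : ∀ z ∈ Metric.sphere c |R|,
        |f z - (f c + T / 4 * R ^ 2 + (H z).re)| ≤ |C| * R ^ 3 := by
      intro z hz
      have h1 := (hball _ (hy z hz).2).1
      rw [hps, add_sub_cancel, (hy z hz).1] at h1
      exact h1
    have hup := Real.circleAverage_mono
      (f₂ := fun z => (((f c + T / 4 * R ^ 2 + |C| * R ^ 3 : ℝ) : ℂ) + H z).re)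
      hcont (hint _) fun z hz => by
        rw [Complex.add_re, Complex.ofReal_re]
        linarith [(abs_le.mp (hbd z hz)).2]
    have hlo := Real.circleAverage_mono
      (f₁ := fun z => (((f c + T / 4 * R ^ 2 - |C| * R ^ 3 : ℝ) : ℂ) + H z).re)
      (hint _) hcont fun z hz => by
        rw [Complex.add_re, Complex.ofReal_re]
        linarith [(abs_le.mp (hbd z hz)).1]
    rw [havg, hR] at hup hlo
    have hR2 : 0 < R ^ 2 := by positivity
    rw [← mul_le_mul_iff_left₀ hR2]
    rw [← abs_of_pos hR2, ← abs_mul, abs_of_pos hR2, abs_le]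
    constructor <;> nlinarith
  have hlim : Tendsto (fun R : ℝ => |C| * R) (𝓝[>] 0) (𝓝 0) := by
    have : Continuous fun R : ℝ => |C| * R := by fun_prop
    have h := this.tendsto 0
    rw [mul_zero] at h
    exact h.mono_left nhdsWithin_le_nhds
  have := abs_nonpos_iff.mp (ge_of_tendsto hlim key)
  linarith

theorem harmonicAt_of_circleAverage {f : ℂ → ℝ} {w : ℂ} (hf : AnalyticAt ℝ f w)
    (hmv : ∀ᶠ c in 𝓝 w, ∀ᶠ R in 𝓝[>] (0 : ℝ), Real.circleAverage f c R = f c) :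
    InnerProductSpace.HarmonicAt f w := by
  refine ⟨hf.contDiffAt, ?_⟩
  filter_upwards [hmv, hf.eventually_analyticAt] with c h1 h2
  exact laplacian_eq_zero_of_circleAverage h2 h1

/-! ### Polarization -/

theorem eqOn_zero_of_forall_real {g : ℂ → ℂ} {ρ δ : ℝ} (hδ : 0 < δ) (hδρ : δ ≤ ρ)
    (hg : DifferentiableOn ℂ g (Metric.ball 0 ρ)) (h0 : ∀ t : ℝ, |t| < δ → g t = 0) :
    ∀ s ∈ Metric.ball (0 : ℂ) ρ, g s = 0 := by
  have hρ : 0 < ρ := hδ.trans_le hδρ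
  refine (hg.analyticOnNhd Metric.isOpen_ball).eqOn_zero_of_preconnected_of_frequently_eq_zero
    (convex_ball (0 : ℂ) ρ).isPreconnected (Metric.mem_ball_self hρ) ?_
  have ht : Tendsto (fun n : ℕ => ((1 / ((n : ℝ) + 1) : ℝ) : ℂ)) atTop (𝓝[≠] 0) := by
    refine tendsto_nhdsWithin_iff.mpr ⟨?_, Eventually.of_forall fun n => ?_⟩
    · have := (Complex.continuous_ofReal.tendsto 0).comp
        (tendsto_one_div_add_atTop_nhds_zero_nat (𝕜 := ℝ))
      rw [Complex.ofReal_zero] at this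
      exact this
    · exact Complex.ofReal_ne_zero.mpr (by positivity)
  refine ht.frequently (Eventually.frequently ?_)
  filter_upwards [(tendsto_one_div_add_atTop_nhds_zero_nat (𝕜 := ℝ)).eventually_lt_const hδ]
    with n hn
  exact h0 _ (by rwa [abs_of_pos (by positivity)])

/-- A function of two variables which is holomorphic along lines and vanishes at all points
`(z, conj z)` vanishes. -/
theorem eq_zero_of_diagonal_eq_zero {Φ : ℂ → ℂ → ℂ} {w : ℂ} {ρ δ : ℝ} (hδ : 0 < δ) (hδρ : δ ≤ ρ)
    (hhol : ∀ p q : ℂ → ℂ, Differentiable ℂ p → Differentiable ℂ q →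
      DifferentiableOn ℂ (fun s => Φ (p s) (q s))
        {s | ‖p s - w‖ < 2 * ρ ∧ ‖q s - (starRingEnd ℂ) w‖ < 2 * ρ})
    (hdiag : ∀ z, ‖z - w‖ < 2 * δ → Φ z ((starRingEnd ℂ) z) = 0) {z y : ℂ} (hz : ‖z - w‖ < ρ)
    (hy : ‖y - (starRingEnd ℂ) w‖ < ρ) : Φ z y = 0 := by
  -- Coordinates `z = w + s + it` and `y = conj w + s - it`: real `s, t` give `y = conj z`. The
  -- identity theorem extends the vanishing to complex `s`, then to complex `t`. Only one-variable
  -- holomorphy along affine lines is used.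
  have hnorm : ∀ s t : ℂ, ‖s‖ < ρ → ‖t‖ < ρ →
      ‖w + s + t * Complex.I - w‖ < 2 * ρ ∧
      ‖(starRingEnd ℂ) w + s - t * Complex.I - (starRingEnd ℂ) w‖ < 2 * ρ := by
    intro s t hs ht
    have e : ‖t * Complex.I‖ = ‖t‖ := by simp
    have e1 : w + s + t * Complex.I - w = s + t * Complex.I := by ring
    have e2 : (starRingEnd ℂ) w + s - t * Complex.I - (starRingEnd ℂ) w =
      s - t * Complex.I := by ring
    rw [e1, e2]
    have := norm_add_le s (t * Complex.I)
    have := norm_sub_le s (t * Complex.I)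
    constructor <;> linarith
  have step1 : ∀ t : ℝ, |t| < δ → ∀ s ∈ Metric.ball (0 : ℂ) ρ,
      Φ (w + s + t * Complex.I) ((starRingEnd ℂ) w + s - t * Complex.I) = 0 := by
    intro t ht
    refine eqOn_zero_of_forall_real hδ hδρ
      (g := fun s => Φ (w + s + t * Complex.I) ((starRingEnd ℂ) w + s - t * Complex.I)) ?_ ?_
    · refine (hhol (fun s => w + s + t * Complex.I)
        (fun s => (starRingEnd ℂ) w + s - t * Complex.I) (by fun_prop) (by fun_prop)).mono
        fun s hs => ?_
      refine hnorm s t (mem_ball_zero_iff.mp hs) ?_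
      rw [Complex.norm_real]
      exact ht.trans_le hδρ
    · intro s hs
      have e : (starRingEnd ℂ) w + s - t * Complex.I =
          (starRingEnd ℂ) (w + s + t * Complex.I) := by
        simp [sub_eq_add_neg]
      change Φ _ _ = 0
      rw [e]
      refine hdiag _ ?_
      have e1 : w + s + t * Complex.I - w = s + t * Complex.I := by ring
      rw [e1]
      have := norm_add_le (s : ℂ) (t * Complex.I)
      rw [norm_mul, Complex.norm_I, mul_one, Complex.norm_real, Complex.norm_real] at this
      simp only [Real.norm_eq_abs] at this
      linarith
  have step2 : ∀ s ∈ Metric.ball (0 : ℂ) ρ, ∀ t ∈ Metric.ball (0 : ℂ) ρ,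
      Φ (w + s + t * Complex.I) ((starRingEnd ℂ) w + s - t * Complex.I) = 0 := by
    intro s hs
    refine eqOn_zero_of_forall_real hδ hδρ
      (g := fun t => Φ (w + s + t * Complex.I) ((starRingEnd ℂ) w + s - t * Complex.I)) ?_ ?_
    · exact (hhol (fun t => w + s + t * Complex.I)
        (fun t => (starRingEnd ℂ) w + s - t * Complex.I) (by fun_prop) (by fun_prop)).mono
        fun t ht => hnorm s t (mem_ball_zero_iff.mp hs) (mem_ball_zero_iff.mp ht)
    · exact fun t ht => step1 t ht s hs
  set s := ((z - w) + (y - (starRingEnd ℂ) w)) / 2 with hs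
  set t := ((z - w) - (y - (starRingEnd ℂ) w)) / 2 * (-Complex.I) with ht
  have hsn : ‖s‖ < ρ := by
    rw [hs, norm_div, Complex.norm_ofNat]
    have := norm_add_le (z - w) (y - (starRingEnd ℂ) w)
    linarith
  have htn : ‖t‖ < ρ := by
    rw [ht, norm_mul, norm_neg, Complex.norm_I, mul_one, norm_div, Complex.norm_ofNat]
    have := norm_sub_le (z - w) (y - (starRingEnd ℂ) w)
    linarith
  have h := step2 s (mem_ball_zero_iff.mpr hsn) t (mem_ball_zero_iff.mpr htn)
  have htI : t * Complex.I = ((z - w) - (y - (starRingEnd ℂ) w)) / 2 := by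
    rw [ht, mul_assoc, neg_mul, Complex.I_mul_I]
    ring
  have e1 : w + s + t * Complex.I = z := by rw [htI, hs]; ring
  have e2 : (starRingEnd ℂ) w + s - t * Complex.I = y := by rw [htI, hs]; ring
  rwa [e1, e2] at h

end BargmannNoise

namespace BargmannNoise

/-! ### Analyticity of the covariance kernel -/

/-- The coefficient functions of a Gaussian analytic function as a map to `ℓ²(ℕ, ℂ)`. -/
noncomputable def gafVec {Ψ : ℕ → ℂ → ℂ} (hΨ : IsGAFCoeff Ψ) (z : ℂ) : lp (fun _ : ℕ => ℂ) 2 :=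
  ⟨fun k => Ψ k z, memℓp_gen (by simpa using hΨ.summable z)⟩

theorem norm_sq_lp_two (f : lp (fun _ : ℕ => ℂ) 2) : ‖f‖ ^ 2 = ∑' k, ‖f k‖ ^ 2 := by
  simpa using lp.norm_rpow_eq_tsum (p := 2) (by simp) f

theorem norm_sq_gafVec {Ψ : ℕ → ℂ → ℂ} (hΨ : IsGAFCoeff Ψ) (z : ℂ) :
    ‖gafVec hΨ z‖ ^ 2 = gafVar Ψ z :=
  norm_sq_lp_two _

theorem sum_smul_single_apply (f : ℕ → ℂ) (n k : ℕ) :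
    (∑ j ∈ Finset.range n, f j • lp.single (E := fun _ : ℕ => ℂ) 2 j (1 : ℂ) :
      lp (fun _ : ℕ => ℂ) 2) k = if k < n then f k else 0 := by
  rw [lp.coeFn_sum, Finset.sum_apply]
  simp only [lp.coeFn_smul, Pi.smul_apply, lp.single_apply, smul_eq_mul, Pi.single_apply, mul_ite,
    mul_one, mul_zero, Finset.sum_ite_eq, Finset.mem_range]

/-- Truncations are holomorphic with values in `ℓ²`, and the summable bound on discs makes their
tails uniformly small. -/
theorem differentiable_gafVec {Ψ : ℕ → ℂ → ℂ} (hΨ : IsGAFCoeff Ψ) :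
    Differentiable ℂ (gafVec hΨ) := by
  have h : TendstoLocallyUniformlyOn (fun n z => ∑ j ∈ Finset.range n,
      Ψ j z • lp.single (E := fun _ : ℕ => ℂ) 2 j (1 : ℂ)) (gafVec hΨ) atTop Set.univ := by
    refine tendstoLocallyUniformlyOn_of_forall_exists_nhds fun z _ => ?_
    refine ⟨Metric.ball 0 (‖z‖ + 1), mem_nhdsWithin_of_mem_nhds (Metric.isOpen_ball.mem_nhds
      (mem_ball_zero_iff.mpr (lt_add_one ‖z‖))), ?_⟩
    obtain ⟨M, hM, hle⟩ := hΨ.exists_bound (‖z‖ + 1)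
    rw [Metric.tendstoUniformlyOn_iff]
    intro ε hε
    filter_upwards [(tendsto_sum_nat_add M).eventually_lt_const (pow_pos hε 2)] with n hn u hu
    rw [dist_eq_norm]
    refine lt_of_pow_lt_pow_left₀ 2 hε.le (lt_of_le_of_lt ?_ hn)
    have hc : ∀ k, (gafVec hΨ u - ∑ j ∈ Finset.range n,
        Ψ j u • lp.single (E := fun _ : ℕ => ℂ) 2 j (1 : ℂ) : lp (fun _ : ℕ => ℂ) 2) k =
        if k < n then 0 else Ψ k u := by
      intro k
      rw [lp.coeFn_sub, Pi.sub_apply, sum_smul_single_apply (fun j => Ψ j u)]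
      change Ψ k u - _ = _
      split_ifs <;> simp
    have hs : Summable fun k => ‖(if k < n then 0 else Ψ k u)‖ ^ 2 :=
      Summable.of_nonneg_of_le (fun k => by positivity) (fun k => by split_ifs <;> simp)
        (hΨ.summable u)
    rw [norm_sq_lp_two]
    simp_rw [hc]
    rw [← hs.sum_add_tsum_nat_add n, Finset.sum_eq_zero, zero_add]
    · refine Summable.tsum_le_tsum (fun k => ?_) ((summable_nat_add_iff n).mpr hs)
        ((summable_nat_add_iff n).mpr hM)
      rw [if_neg (by omega)]
      exact hle _ _ (mem_ball_zero_iff.mp hu).le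
    · intro k hk
      simp [Finset.mem_range.mp hk]
  refine differentiableOn_univ.mp (h.differentiableOn (Eventually.of_forall fun n => ?_)
    isOpen_univ)
  exact DifferentiableOn.fun_sum fun j _ => ((hΨ.1 j).smul_const _).differentiableOn

/-- The variance is the squared norm of a holomorphic `ℓ²`-valued map, and the real inner product is
a bounded bilinear map. -/
theorem analyticAt_gafVar {Ψ : ℕ → ℂ → ℂ} (hΨ : IsGAFCoeff Ψ) (z : ℂ) :
    AnalyticAt ℝ (gafVar Ψ) z := by
  have h1 : AnalyticAt ℝ (gafVec hΨ) z :=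
    ((differentiable_gafVec hΨ).analyticAt z).restrictScalars
  have h2 := ((innerSL ℝ (E := lp (fun _ : ℕ => ℂ) 2)).analyticAt_bilinear
    (gafVec hΨ z, gafVec hΨ z)).comp₂ h1 h1
  refine h2.congr (Eventually.of_forall fun w => ?_)
  change inner ℝ (gafVec hΨ w) (gafVec hΨ w) = _
  rw [real_inner_self_eq_norm_sq, norm_sq_gafVec]

/-- The kernel is antiholomorphic in its second variable; the extra conjugate makes it holomorphic,
as `conj ∘ Ψ_k ∘ conj` is entire. This is the form in which polarization uses it. -/
theorem differentiable_gafKernel_comp {Ψ : ℕ → ℂ → ℂ} (hΨ : IsGAFCoeff Ψ) {p q : ℂ → ℂ}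
    (hp : Differentiable ℂ p) (hq : Differentiable ℂ q) :
    Differentiable ℂ fun s => gafKernel Ψ (p s) ((starRingEnd ℂ) (q s)) := by
  intro s₀
  obtain ⟨A, hA⟩ := (isCompact_closedBall s₀ 1).exists_bound_of_continuousOn
    hp.continuous.continuousOn
  obtain ⟨B, hB⟩ := (isCompact_closedBall s₀ 1).exists_bound_of_continuousOn
    hq.continuous.continuousOn
  obtain ⟨M, hM, hle⟩ := hΨ.exists_bound (max A B)
  refine (Complex.differentiableOn_tsum_of_summable_norm (U := Metric.ball s₀ 1) hM
    (fun k => ?_) Metric.isOpen_ball fun k s hs => ?_).differentiableAt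
      (Metric.ball_mem_nhds s₀ one_pos)
  · have h1 : Differentiable ℂ fun s => (starRingEnd ℂ) (Ψ k ((starRingEnd ℂ) (q s))) := by
      intro s
      have := ((hΨ.1 k) ((starRingEnd ℂ) (q s))).conj_conj
      rw [Complex.conj_conj] at this
      exact this.comp s (hq s)
    exact (((hΨ.1 k).comp hp).mul h1).differentiableOn
  · have hs' := Metric.ball_subset_closedBall hs
    have h1 := hle k (p s) ((hA s hs').trans (le_max_left _ _))
    have h2 := hle k ((starRingEnd ℂ) (q s))
      (by rw [RCLike.norm_conj]; exact (hB s hs').trans (le_max_right _ _))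
    rw [norm_mul, RCLike.norm_conj]
    nlinarith [sq_nonneg (‖Ψ k (p s)‖ - ‖Ψ k ((starRingEnd ℂ) (q s))‖)]

theorem conj_gafKernel (Ψ : ℕ → ℂ → ℂ) (z w : ℂ) :
    (starRingEnd ℂ) (gafKernel Ψ z w) = gafKernel Ψ w z := by
  rw [gafKernel, Complex.conj_tsum, gafKernel]
  congr 1
  funext k
  rw [map_mul, Complex.conj_conj, mul_comm]

/-! ### Gaussian analytic functions with the same first intensity -/

/-- Jensen's formula for both functions has the same left side. The right sides may be compared
because `ENNReal.ofReal` is injective on nonnegative reals, which is what the nonnegativity clause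
of `lintegral_log_meanZeros` is for. -/
theorem circleAverage_log_gafVar_sub {Ψ₁ Ψ₂ : ℕ → ℂ → ℂ} (h₁ : IsGAFCoeff Ψ₁)
    (h₂ : IsGAFCoeff Ψ₂) (hmean : meanZeros Ψ₁ = meanZeros Ψ₂) {c : ℂ} {R : ℝ} (hR : 0 < R)
    (hv₁ : ∀ z ∈ Metric.closedBall c R, gafVar Ψ₁ z ≠ 0)
    (hv₂ : ∀ z ∈ Metric.closedBall c R, gafVar Ψ₂ z ≠ 0) :
    Real.circleAverage (fun z => Real.log (gafVar Ψ₁ z) / 2 - Real.log (gafVar Ψ₂ z) / 2) c R =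
      Real.log (gafVar Ψ₁ c) / 2 - Real.log (gafVar Ψ₂ c) / 2 := by
  obtain ⟨a1, a2⟩ := lintegral_log_meanZeros h₁ hR hv₁
  obtain ⟨b1, b2⟩ := lintegral_log_meanZeros h₂ hR hv₂
  rw [hmean, b1, ENNReal.ofReal_eq_ofReal_iff b2 a2] at a1
  have hint : ∀ {Ψ : ℕ → ℂ → ℂ}, IsGAFCoeff Ψ → (∀ z ∈ Metric.closedBall c R, gafVar Ψ z ≠ 0) →
      CircleIntegrable (fun z => Real.log (gafVar Ψ z) / 2) c R := fun hΨ hv => by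
    refine ContinuousOn.circleIntegrable' (ContinuousOn.div_const (ContinuousOn.log
      (continuous_gafVar hΨ).continuousOn fun z hz => hv z ?_) 2)
    rw [abs_of_pos hR] at hz
    exact Metric.sphere_subset_closedBall hz
  rw [Real.circleAverage_fun_sub (hint h₁ hv₁) (hint h₂ hv₂)]
  linarith

theorem harmonicAt_log_gafVar_sub {Ψ₁ Ψ₂ : ℕ → ℂ → ℂ} (h₁ : IsGAFCoeff Ψ₁)
    (h₂ : IsGAFCoeff Ψ₂) (hmean : meanZeros Ψ₁ = meanZeros Ψ₂) {w : ℂ}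
    (hw₁ : gafVar Ψ₁ w ≠ 0) (hw₂ : gafVar Ψ₂ w ≠ 0) :
    InnerProductSpace.HarmonicAt
      (fun z => Real.log (gafVar Ψ₁ z) / 2 - Real.log (gafVar Ψ₂ z) / 2) w := by
  have han : ∀ {Ψ : ℕ → ℂ → ℂ}, IsGAFCoeff Ψ → gafVar Ψ w ≠ 0 →
      AnalyticAt ℝ (fun z => Real.log (gafVar Ψ z) / 2) w := fun hΨ hw => by
    have h := (analyticAt_log ((gafVar_nonneg _ w).lt_of_ne' hw)).comp (analyticAt_gafVar hΨ w)
    exact h.div analyticAt_const two_ne_zero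
  refine harmonicAt_of_circleAverage ((han h₁ hw₁).sub (han h₂ hw₂)) ?_
  have hopen : IsOpen {z | gafVar Ψ₁ z ≠ 0 ∧ gafVar Ψ₂ z ≠ 0} :=
    (isOpen_ne_fun (continuous_gafVar h₁) continuous_const).inter
      (isOpen_ne_fun (continuous_gafVar h₂) continuous_const)
  filter_upwards [hopen.mem_nhds ⟨hw₁, hw₂⟩] with c hc
  obtain ⟨δ, hδ, hball⟩ := Metric.isOpen_iff.mp hopen c hc
  filter_upwards [Ioo_mem_nhdsGT hδ] with R hR
  have hsub : Metric.closedBall c R ⊆ {z | gafVar Ψ₁ z ≠ 0 ∧ gafVar Ψ₂ z ≠ 0} :=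
    (Metric.closedBall_subset_ball hR.2).trans hball
  exact circleAverage_log_gafVar_sub h₁ h₂ hmean hR.1 (fun z hz => (hsub hz).1)
    fun z hz => (hsub hz).2

/-- Local Calabi rigidity. The harmonic function is `Re h` on a disc, which gives the relation on
the diagonal with `g = e^h`, and polarization removes the restriction to the diagonal. -/
theorem exists_gafKernel_eq_mul {Ψ₁ Ψ₂ : ℕ → ℂ → ℂ} (h₁ : IsGAFCoeff Ψ₁)
    (h₂ : IsGAFCoeff Ψ₂) (hmean : meanZeros Ψ₁ = meanZeros Ψ₂) {w : ℂ}
    (hw₁ : gafVar Ψ₁ w ≠ 0) (hw₂ : gafVar Ψ₂ w ≠ 0) :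
    ∃ ρ > 0, ∃ g : ℂ → ℂ, ∀ z u, ‖z - w‖ < ρ → ‖u - w‖ < ρ →
      gafKernel Ψ₁ z u = g z * (starRingEnd ℂ) (g u) * gafKernel Ψ₂ z u := by
  have hopen : IsOpen {z | gafVar Ψ₁ z ≠ 0 ∧ gafVar Ψ₂ z ≠ 0} :=
    (isOpen_ne_fun (continuous_gafVar h₁) continuous_const).inter
      (isOpen_ne_fun (continuous_gafVar h₂) continuous_const)
  obtain ⟨r, hr, hball⟩ := Metric.isOpen_iff.mp hopen w ⟨hw₁, hw₂⟩
  obtain ⟨h, hh, hre⟩ := InnerProductSpace.HarmonicOnNhd.exists_analyticOnNhd_ball_re_eq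
    (f := fun z => Real.log (gafVar Ψ₁ z) / 2 - Real.log (gafVar Ψ₂ z) / 2) (z := w) (R := r)
    fun z hz => harmonicAt_log_gafVar_sub h₁ h₂ hmean (hball hz).1 (hball hz).2
  have hr2 : 2 * (r / 2) = r := by ring
  refine ⟨r / 2, by positivity, fun z => Complex.exp (h z), fun z u hz hu => ?_⟩
  have hmem : ∀ {z : ℂ}, ‖z - w‖ < r → z ∈ Metric.ball w r := fun hz => by
    rwa [Metric.mem_ball, dist_eq_norm]
  have key := eq_zero_of_diagonal_eq_zero (w := w) (ρ := r / 2) (δ := r / 2) (by positivity) le_rfl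
    (Φ := fun z y => gafKernel Ψ₁ z ((starRingEnd ℂ) y) - Complex.exp (h z) *
      (starRingEnd ℂ) (Complex.exp (h ((starRingEnd ℂ) y))) * gafKernel Ψ₂ z ((starRingEnd ℂ) y))
    (fun p q hp hq => by
      rintro s ⟨hs1, hs2⟩
      rw [hr2] at hs1 hs2
      refine DifferentiableAt.differentiableWithinAt ?_
      have hd1 := (differentiable_gafKernel_comp h₁ hp hq) s
      have hd2 := (differentiable_gafKernel_comp h₂ hp hq) s
      have he1 : DifferentiableAt ℂ (fun s => Complex.exp (h (p s))) s :=
        ((hh _ (hmem hs1)).differentiableAt.comp s (hp s)).cexp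
      have he2 : DifferentiableAt ℂ
          (fun s => (starRingEnd ℂ) (Complex.exp (h ((starRingEnd ℂ) (q s))))) s := by
        have hq' : ‖(starRingEnd ℂ) (q s) - w‖ < r := by
          rw [← RCLike.norm_conj, map_sub, Complex.conj_conj]
          exact hs2
        have := ((hh _ (hmem hq')).differentiableAt.cexp).conj_conj
        rw [Complex.conj_conj] at this
        exact this.comp s (hq s)
      exact hd1.sub ((he1.mul he2).mul hd2))
    (fun z hz => by
      rw [hr2] at hz
      have hz1 := hball (hmem hz)
      have p1 : 0 < gafVar Ψ₁ z := (gafVar_nonneg _ z).lt_of_ne' hz1.1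
      have p2 : 0 < gafVar Ψ₂ z := (gafVar_nonneg _ z).lt_of_ne' hz1.2
      have h3 := hre (hmem hz)
      simp only at h3
      rw [Complex.conj_conj, gafKernel_self, gafKernel_self, Complex.mul_conj,
        Complex.normSq_eq_norm_sq, Complex.norm_exp, h3, ← Real.exp_nat_mul]
      have h4 : ((2 : ℕ) : ℝ) * (Real.log (gafVar Ψ₁ z) / 2 - Real.log (gafVar Ψ₂ z) / 2) =
          Real.log (gafVar Ψ₁ z) - Real.log (gafVar Ψ₂ z) := by push_cast; ring
      rw [h4, Real.exp_sub, Real.exp_log p1, Real.exp_log p2, ← Complex.ofReal_mul,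
        div_mul_cancel₀ _ p2.ne', sub_self])
    hz (y := (starRingEnd ℂ) u) (by rw [← map_sub, RCLike.norm_conj]; exact hu)
  simp only [Complex.conj_conj] at key
  exact sub_eq_zero.mp key

/-- Cross-multiplication at the base point `w` cancels the local factor `g`. Both sides are then
defined on all of `ℂ²`, so polarization propagates the identity from a small disc to any radius,
with no continuation of `g` across zeros of the variances. -/
theorem gafKernel_identity {Ψ₁ Ψ₂ : ℕ → ℂ → ℂ} (h₁ : IsGAFCoeff Ψ₁)
    (h₂ : IsGAFCoeff Ψ₂) (hmean : meanZeros Ψ₁ = meanZeros Ψ₂) {w : ℂ}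
    (hw₁ : gafVar Ψ₁ w ≠ 0) (hw₂ : gafVar Ψ₂ w ≠ 0) (z u : ℂ) :
    gafKernel Ψ₁ z u * gafKernel Ψ₂ z w * gafKernel Ψ₂ w u * gafVar Ψ₁ w =
      gafKernel Ψ₁ z w * gafKernel Ψ₁ w u * gafKernel Ψ₂ z u * gafVar Ψ₂ w := by
  obtain ⟨δ, hδ, g, hg⟩ := exists_gafKernel_eq_mul h₁ h₂ hmean hw₁ hw₂
  set ρ := max (δ / 2) (‖z - w‖ + ‖u - w‖ + 1) with hρ
  have hρ2 : ‖z - w‖ + ‖u - w‖ + 1 ≤ ρ := le_max_right _ _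
  have key := eq_zero_of_diagonal_eq_zero (w := w) (ρ := ρ) (δ := δ / 2) (by positivity)
    (le_max_left _ _)
    (Φ := fun z y =>
      gafKernel Ψ₁ z ((starRingEnd ℂ) y) * gafKernel Ψ₂ z ((starRingEnd ℂ) ((starRingEnd ℂ) w)) *
        gafKernel Ψ₂ w ((starRingEnd ℂ) y) * gafVar Ψ₁ w -
      gafKernel Ψ₁ z ((starRingEnd ℂ) ((starRingEnd ℂ) w)) * gafKernel Ψ₁ w ((starRingEnd ℂ) y) *
        gafKernel Ψ₂ z ((starRingEnd ℂ) y) * gafVar Ψ₂ w)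
    (fun p q hp hq => by
      have hc : ∀ a : ℂ, Differentiable ℂ fun _ : ℂ => a := fun a => differentiable_const a
      refine Differentiable.differentiableOn (Differentiable.sub ?_ ?_)
      · exact (((differentiable_gafKernel_comp h₁ hp hq).mul
          (differentiable_gafKernel_comp h₂ hp (hc _))).mul
          (differentiable_gafKernel_comp h₂ (hc _) hq)).mul_const _
      · exact (((differentiable_gafKernel_comp h₁ hp (hc _)).mul
          (differentiable_gafKernel_comp h₁ (hc _) hq)).mul
          (differentiable_gafKernel_comp h₂ hp hq)).mul_const _)
    (fun z hz => by
      have hz' : ‖z - w‖ < δ := by linarith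
      have hw' : ‖w - w‖ < δ := by simpa using hδ
      simp only [Complex.conj_conj, ← gafKernel_self]
      rw [hg z z hz' hz', hg z w hz' hw', hg w z hw' hz', hg w w hw' hw']
      ring)
    (z := z) (y := (starRingEnd ℂ) u) (by linarith [norm_nonneg (u - w)])
    (by rw [← map_sub, RCLike.norm_conj]; linarith [norm_nonneg (z - w)])
  simp only [Complex.conj_conj] at key
  exact sub_eq_zero.mp key

/-- The law of the random zeros of a Gaussian analytic function is determined by their first
intensity. -/
theorem map_pointMeasure_seqZeros_eq_of_meanZeros_eq {Ψ₁ Ψ₂ : ℕ → ℂ → ℂ} (h₁ : IsGAFCoeff Ψ₁)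
    (h₂ : IsGAFCoeff Ψ₂) (hmean : meanZeros Ψ₁ = meanZeros Ψ₂) {w : ℂ}
    (hw₁ : gafVar Ψ₁ w ≠ 0) (hw₂ : gafVar Ψ₂ w ≠ 0) :
    seqLaw.map (fun x => pointMeasure (seqZeros Ψ₁ x)) =
      seqLaw.map (fun x => pointMeasure (seqZeros Ψ₂ x)) := by
  have hdiff : ∀ {Ψ : ℕ → ℂ → ℂ}, IsGAFCoeff Ψ → ∀ t : ℝ,
      Differentiable ℂ fun z => gafKernel Ψ z w * (t : ℂ) := fun hΨ t => by
    have := differentiable_gafKernel_comp hΨ differentiable_id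
      (differentiable_const ((starRingEnd ℂ) w))
    simp only [id, Complex.conj_conj] at this
    exact this.mul_const _
  have hne : ∀ {Ψ Ψ' : ℕ → ℂ → ℂ}, gafVar Ψ w ≠ 0 → gafVar Ψ' w ≠ 0 →
      gafKernel Ψ w w * ((√(gafVar Ψ' w) : ℝ) : ℂ) ≠ 0 := fun {Ψ Ψ'} ha hb => by
    rw [gafKernel_self]
    exact mul_ne_zero (Complex.ofReal_ne_zero.mpr ha)
      (Complex.ofReal_ne_zero.mpr (Real.sqrt_ne_zero'.mpr ((gafVar_nonneg Ψ' w).lt_of_ne' hb)))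
  have hsq : ∀ Ψ : ℕ → ℂ → ℂ, ((√(gafVar Ψ w) : ℝ) : ℂ) * ((√(gafVar Ψ w) : ℝ) : ℂ) =
      gafVar Ψ w := fun Ψ => by
    rw [← Complex.ofReal_mul, Real.mul_self_sqrt (gafVar_nonneg Ψ w)]
  -- With these multipliers `gafKernel_identity` becomes equality of the kernels of `g₁ Ψ₁` and `g₂
  -- Ψ₂`; the square roots split the factors `gafVar · w` evenly between the two variables.
  set g₁ : ℂ → ℂ := fun z => gafKernel Ψ₂ z w * ((√(gafVar Ψ₁ w) : ℝ) : ℂ) with hg₁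
  set g₂ : ℂ → ℂ := fun z => gafKernel Ψ₁ z w * ((√(gafVar Ψ₂ w) : ℝ) : ℂ) with hg₂
  have hK : ∀ z u, gafKernel (fun k z => g₁ z * Ψ₁ k z) z u =
      gafKernel (fun k z => g₂ z * Ψ₂ k z) z u := by
    intro z u
    rw [gafKernel_mul, gafKernel_mul, hg₁, hg₂]
    simp only [map_mul, conj_gafKernel, Complex.conj_ofReal]
    linear_combination gafKernel_identity h₁ h₂ hmean hw₁ hw₂ z u +
      gafKernel Ψ₂ z w * gafKernel Ψ₂ w u * gafKernel Ψ₁ z u * hsq Ψ₁ -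
      gafKernel Ψ₁ z w * gafKernel Ψ₁ w u * gafKernel Ψ₂ z u * hsq Ψ₂
  have hd₁ : Differentiable ℂ g₁ := hdiff h₂ _
  have hd₂ : Differentiable ℂ g₂ := hdiff h₁ _
  have e₁ : (fun x => pointMeasure (seqZeros (fun k z => g₁ z * Ψ₁ k z) x)) =ᵐ[seqLaw]
      fun x => pointMeasure (seqZeros Ψ₁ x) := by
    filter_upwards [ae_seqZeros_mul h₁ hd₁ ⟨w, hne hw₂ hw₁⟩] with x hx
    rw [hx]
  have e₂ : (fun x => pointMeasure (seqZeros (fun k z => g₂ z * Ψ₂ k z) x)) =ᵐ[seqLaw]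
      fun x => pointMeasure (seqZeros Ψ₂ x) := by
    filter_upwards [ae_seqZeros_mul h₂ hd₂ ⟨w, hne hw₁ hw₂⟩] with x hx
    rw [hx]
  rw [← Measure.map_congr e₁, ← Measure.map_congr e₂]
  refine map_pointMeasure_seqZeros_eq (h₁.mul hd₁) (h₂.mul hd₂) hK (w := w) ?_
  rw [gafVar_mul]
  exact mul_ne_zero (pow_ne_zero 2 (norm_ne_zero_iff.mpr (hne hw₂ hw₁))) hw₁

end BargmannNoise

namespace BargmannNoise

/-! ### White noise and the critical points of its Bargmann transform -/

theorem map_conj_stdComplexGaussian :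
    stdComplexGaussian.map (starRingEnd ℂ) = stdComplexGaussian := by
  have hc : Measurable (starRingEnd ℂ) := Complex.continuous_conj.measurable
  have hn : (gaussianReal 0 1).map (fun x : ℝ => -x) = gaussianReal 0 1 := by
    rw [gaussianReal_map_neg, neg_zero]
  have hp : ((gaussianReal 0 1).prod (gaussianReal 0 1)).map (Prod.map id fun x : ℝ => -x) =
      (gaussianReal 0 1).prod (gaussianReal 0 1) := by
    rw [← Measure.map_prod_map _ _ measurable_id measurable_neg, Measure.map_id, hn]
  have hm : Measurable (Prod.map id fun x : ℝ => -x : ℝ × ℝ → ℝ × ℝ) :=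
    measurable_id.prodMap measurable_neg
  conv_rhs => rw [stdComplexGaussian, ← hp, Measure.map_map measurable_stdComplexGaussian_map hm]
  rw [stdComplexGaussian, Measure.map_map hc measurable_stdComplexGaussian_map]
  congr 1
  funext p
  simp [Complex.conj_ofReal]

theorem IsIIDStdComplexGaussian.conj {Ω : Type*} [MeasurableSpace Ω] {a : ℕ → Ω → ℂ}
    {P : Measure Ω} (ha : IsIIDStdComplexGaussian a P) :
    IsIIDStdComplexGaussian (fun k ω => (starRingEnd ℂ) (a k ω)) P := by
  have hc : Measurable (starRingEnd ℂ) := Complex.continuous_conj.measurable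
  refine ⟨fun k => ⟨hc.comp_aemeasurable (ha.hasLaw k).aemeasurable, ?_⟩,
    ha.indep.comp (fun _ => starRingEnd ℂ) fun _ => hc⟩
  have h := AEMeasurable.map_map_of_aemeasurable hc.aemeasurable (ha.hasLaw k).aemeasurable
  rw [(ha.hasLaw k).map_eq, map_conj_stdComplexGaussian] at h
  exact h.symm

/-- The expectation of `∑ |x_k|²/(1 + k²)` is finite, so the sum is almost surely finite. -/
theorem ae_memℓp_seqLaw : ∀ᵐ x ∂seqLaw,
    Memℓp (fun k : ℕ => x k / ((√(1 + (k : ℝ) ^ 2) : ℝ) : ℂ)) 2 := by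
  have hs : Summable fun k : ℕ => 1 / (1 + (k : ℝ) ^ 2) := by
    refine Summable.of_nonneg_of_le (fun k => by positivity) (fun k => ?_)
      (((summable_nat_add_iff 1).mpr (Real.summable_one_div_nat_pow.mpr one_lt_two)).mul_left 2)
    push_cast
    rw [mul_one_div, div_le_div_iff₀ (by positivity) (by positivity)]
    nlinarith [sq_nonneg ((k : ℝ) - 1)]
  have hm : ∀ k : ℕ, Measurable fun x : ℕ → ℂ =>
      ENNReal.ofReal (‖x k‖ ^ 2 * (1 / (1 + (k : ℝ) ^ 2))) := fun k =>
    (((measurable_pi_apply k).norm.pow_const 2).mul_const _).ennreal_ofReal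
  have hint : ∀ k : ℕ, ∫⁻ x : ℕ → ℂ, ENNReal.ofReal (‖x k‖ ^ 2 * (1 / (1 + (k : ℝ) ^ 2))) ∂seqLaw =
      ENNReal.ofReal ((∫ z, ‖z‖ ^ 2 ∂stdComplexGaussian) * (1 / (1 + (k : ℝ) ^ 2))) := by
    intro k
    rw [← integral_norm_sq_eval_seqLaw k, ← integral_mul_const,
      ofReal_integral_eq_lintegral_ofReal _ (ae_of_all _ fun x => by positivity)]
    exact ((memLp_eval_seqLaw k).integrable_norm_pow two_ne_zero).mul_const _
  have hlt : ∀ᵐ x ∂seqLaw, ∑' k : ℕ, ENNReal.ofReal (‖x k‖ ^ 2 * (1 / (1 + (k : ℝ) ^ 2))) < ⊤ := by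
    refine ae_lt_top (Measurable.tsum hm) ?_
    rw [lintegral_tsum fun k => (hm k).aemeasurable]
    simp_rw [hint]
    exact (hs.mul_left _).tsum_ofReal_ne_top
  filter_upwards [hlt] with x hx
  refine memℓp_gen ?_
  have h := ENNReal.summable_toReal hx.ne
  refine h.congr fun k => ?_
  have hsq : √(1 + (k : ℝ) ^ 2) ^ 2 = 1 + (k : ℝ) ^ 2 := Real.sq_sqrt (by positivity)
  simp only [ENNReal.toReal_ofNat, Real.rpow_ofNat]
  rw [ENNReal.toReal_ofReal (by positivity), norm_div, div_pow, Complex.norm_real,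
    Real.norm_of_nonneg (Real.sqrt_nonneg _), hsq, mul_one_div]

section

variable {Ω : Type*} [MeasurableSpace Ω] {P : Measure Ω} {c : ℕ → Ω → ℂ}

theorem IsIIDStdComplexGaussian.ae_of_ae_seqLaw (hc : IsIIDStdComplexGaussian c P)
    {p : (ℕ → ℂ) → Prop} (h : ∀ᵐ x ∂seqLaw, p x) : ∀ᵐ ω ∂P, p fun k => c k ω :=
  ae_of_ae_map hc.aemeasurable (hc.map_eq.symm ▸ h)

theorem IsIIDStdComplexGaussian.aemeasurable_pointMeasure_seqZeros
    (hc : IsIIDStdComplexGaussian c P) {Ψ : ℕ → ℂ → ℂ} (hΨ : IsGAFCoeff Ψ) {w : ℂ}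
    (hw : gafVar Ψ w ≠ 0) :
    AEMeasurable (fun ω => pointMeasure (seqZeros Ψ fun k => c k ω)) P :=
  AEMeasurable.comp_aemeasurable (g := fun x => pointMeasure (seqZeros Ψ x))
    (hc.map_eq.symm ▸ BargmannNoise.aemeasurable_pointMeasure_seqZeros hΨ hw) hc.aemeasurable

theorem IsIIDStdComplexGaussian.map_pointMeasure_seqZeros
    (hc : IsIIDStdComplexGaussian c P) {Ψ : ℕ → ℂ → ℂ} (hΨ : IsGAFCoeff Ψ) {w : ℂ}
    (hw : gafVar Ψ w ≠ 0) :
    P.map (fun ω => pointMeasure (seqZeros Ψ fun k => c k ω)) =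
      seqLaw.map fun x => pointMeasure (seqZeros Ψ x) := by
  have h := AEMeasurable.map_map_of_aemeasurable (g := fun x => pointMeasure (seqZeros Ψ x))
    (hc.map_eq.symm ▸ BargmannNoise.aemeasurable_pointMeasure_seqZeros hΨ hw) hc.aemeasurable
  rw [hc.map_eq] at h
  exact h.symm

theorem IsIIDStdComplexGaussian.bind_pointMeasure_seqZeros
    (hc : IsIIDStdComplexGaussian c P) {Ψ : ℕ → ℂ → ℂ} (hΨ : IsGAFCoeff Ψ) {w : ℂ}
    (hw : gafVar Ψ w ≠ 0) :
    P.bind (fun ω => pointMeasure (seqZeros Ψ fun k => c k ω)) = meanZeros Ψ := by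
  rw [meanZeros, Measure.bind, Measure.bind, hc.map_pointMeasure_seqZeros hΨ hw]

theorem IsIIDStdComplexGaussian.ae_finite_seqZeros
    (hc : IsIIDStdComplexGaussian c P) {Ψ : ℕ → ℂ → ℂ} (hΨ : IsGAFCoeff Ψ) {w : ℂ}
    (hw : gafVar Ψ w ≠ 0) :
    ∀ᵐ ω ∂P, ∀ K : Set ℂ, IsCompact K → (seqZeros Ψ (fun k => c k ω) ∩ K).Finite := by
  filter_upwards [hc.ae_of_ae_seqLaw ((ae_seqConverges hΨ).and (ae_seqGaf_ne_zero hΨ hw))]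
    with ω hω K hK
  exact (finite_zeroSet_inter (hω.1.differentiable hΨ.1) ⟨w, hω.2⟩ hK).subset
    (Set.inter_subset_inter_left K Set.inter_subset_left)

/-- The variance of the derivative never vanishes, so every critical point is a random zero. The
conjugates come from the conjugate linearity of the transform. -/
theorem IsIIDStdComplexGaussian.ae_criticalPoints_eq (hc : IsIIDStdComplexGaussian c P) :
    ∀ᵐ ω ∂P, criticalPoints (bargmannTheta (whiteNoise c ω)) =
      seqZeros criticalCoeff fun k => (starRingEnd ℂ) (c k ω) := by
  filter_upwards [hc.ae_of_ae_seqLaw ae_memℓp_seqLaw] with ω hω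
  ext z
  have h : seqGaf criticalCoeff (fun k => (starRingEnd ℂ) (c k ω)) z =
      deriv (bargmannTheta (whiteNoise c ω)) z :=
    (hasSum_deriv_bargmannTheta_whiteNoise hω z).tendsto_sum_nat.limUnder_eq
  simp [criticalPoints, seqZeros, zeroSet, h, gafVar_criticalCoeff_ne_zero]

end

/-- For `k ≥ 1`, `√k!/(k - 1)! = k/√k!`; for `k = 0` both sides vanish. -/
theorem planarCoeff_one (k : ℕ) (z : ℂ) : planarCoeff 1 k z = z * criticalCoeff k z := by
  rcases k with _ | k
  · simp [planarCoeff, criticalCoeff]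
  · have hf : (k.factorial : ℂ) ≠ 0 := by exact_mod_cast k.factorial_ne_zero
    have hs0 : ((√((k + 1).factorial : ℝ) : ℝ) : ℂ) ≠ 0 :=
      Complex.ofReal_ne_zero.mpr (by positivity)
    have hs : ((√((k + 1).factorial : ℝ) : ℝ) : ℂ) ^ 2 = ((k : ℂ) + 1) * (k.factorial : ℂ) := by
      rw [← Complex.ofReal_pow, Real.sq_sqrt (by positivity), Nat.factorial_succ]
      push_cast
      ring
    rw [planarCoeff, if_pos (by omega), criticalCoeff, Nat.add_sub_cancel, Complex.ofReal_div,
      Complex.ofReal_natCast]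
    push_cast
    field_simp
    rw [hs]
    ring

theorem criticalIntensity_ne_zero : criticalIntensity ≠ 0 := by
  intro h
  have hm : AEMeasurable
      (fun z : ℂ => ENNReal.ofReal (1 / Real.pi * (1 + 1 / (1 + ‖z‖ ^ 2) ^ 2))) volume := by
    have : Measurable fun z : ℂ => 1 / Real.pi * (1 + 1 / (1 + ‖z‖ ^ 2) ^ 2) := by fun_prop
    exact this.ennreal_ofReal.aemeasurable
  rw [criticalIntensity, withDensity_eq_zero_iff hm] at h
  obtain ⟨z, hz⟩ := h.exists
  have : 0 < 1 / Real.pi * (1 + 1 / (1 + ‖z‖ ^ 2) ^ 2) := by positivity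
  exact this.not_ge (ENNReal.ofReal_eq_zero.mp hz)

theorem seqZeros_eq_empty {Ψ : ℕ → ℂ → ℂ} (h : ∀ z, gafVar Ψ z = 0) (x : ℕ → ℂ) :
    seqZeros Ψ x = ∅ := by
  ext z
  simp [seqZeros, h z]

/-- An identically vanishing variance would leave no random zeros, against a nonzero intensity. The
point `w` supplies the nondegeneracy needed by the measurability and rigidity lemmas. -/
theorem exists_gafVar_ne_zero_of_isFirstIntensity {Ω : Type*} [MeasurableSpace Ω] {Q : Measure Ω}
    {c : ℕ → Ω → ℂ} {Ψ : ℕ → ℂ → ℂ}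
    (h : IsFirstIntensity Q (fun ω => seqZeros Ψ fun k => c k ω) criticalIntensity) :
    ∃ w, gafVar Ψ w ≠ 0 := by
  by_contra! hz
  have he : (fun ω => seqZeros Ψ fun k => c k ω) = fun _ : Ω => (∅ : Set ℂ) :=
    funext fun ω => seqZeros_eq_empty hz _
  rw [he] at h
  have h0 : pointMeasure ∅ = 0 := by simp [pointMeasure]
  have hb := bind_eq_of_isFirstIntensity (ae_of_all _ fun _ K _ => by simp) aemeasurable_const h
  refine criticalIntensity_ne_zero (hb ▸ ?_)
  ext B hB
  rw [Measure.bind_apply hB aemeasurable_const, h0]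
  simp

end BargmannNoise


theorem mainTheorem8 {Ω Ω' : Type*} [MeasurableSpace Ω] [MeasurableSpace Ω']
    (P : Measure Ω) [IsProbabilityMeasure P] (P' : Measure Ω') [IsProbabilityMeasure P']
    -- the coordinates of the white noise, and the coefficients of the Gaussian analytic function
    (a : ℕ → Ω → ℂ) (ha : IsIIDStdComplexGaussian a P)
    (b : ℕ → Ω' → ℂ) (hb : IsIIDStdComplexGaussian b P') :
    -- the white noise and its Bargmann transform are well defined
    (∀ᵐ ω ∂P, Summable (fun k => a k ω • toTheta (hermiteL2 k))) ∧
    (∀ θ : Theta, Differentiable ℂ (bargmannTheta θ) ∧ ∀ z : ℂ,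
      Tendsto (fun f : Signal => bargmann f z) (comap toTheta (𝓝 θ)) (𝓝 (bargmannTheta θ z))) ∧
    -- its critical points are almost surely locally finite
    (∀ᵐ ω ∂P, ∀ K : Set ℂ, IsCompact K →
      (criticalPoints (bargmannTheta (whiteNoise a ω)) ∩ K).Finite) ∧
    -- their law is the law of the random zeros of the first planar Gaussian analytic function
    IdentDistrib
      (fun ω => pointMeasure (criticalPoints (bargmannTheta (whiteNoise a ω))))
      (fun ω' => pointMeasure (randomZeros P' (gaf (planarCoeff 1) b) ω')) P P' ∧
    -- their first intensity
    IsFirstIntensity P (fun ω => criticalPoints (bargmannTheta (whiteNoise a ω)))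
      criticalIntensity ∧
    -- their law is characterized by this first intensity among zeros of Gaussian analytic functions
    (∀ (Ω'' : Type*) [MeasurableSpace Ω''] (Q : Measure Ω'') [IsProbabilityMeasure Q]
      (c : ℕ → Ω'' → ℂ) (Ψ : ℕ → ℂ → ℂ), IsIIDStdComplexGaussian c Q → IsGAFCoeff Ψ →
      IsFirstIntensity Q (randomZeros Q (gaf Ψ c)) criticalIntensity →
      IdentDistrib
        (fun ω'' => pointMeasure (randomZeros Q (gaf Ψ c) ω''))
        (fun ω => pointMeasure (criticalPoints (bargmannTheta (whiteNoise a ω)))) Q P) := by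
  have hcc := isGAFCoeff_criticalCoeff
  have h0 := gafVar_criticalCoeff_ne_zero 0
  have hcrit := ha.ae_criticalPoints_eq
  have hcm : (fun ω => pointMeasure (criticalPoints (bargmannTheta (whiteNoise a ω)))) =ᵐ[P]
      fun ω => pointMeasure (seqZeros criticalCoeff fun k => (starRingEnd ℂ) (a k ω)) :=
    hcrit.mono fun ω hω => by simp only [hω]
  have hcmeas := (ha.conj.aemeasurable_pointMeasure_seqZeros hcc h0).congr hcm.symm
  have hcmap : P.map (fun ω => pointMeasure (criticalPoints (bargmannTheta (whiteNoise a ω)))) =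
      seqLaw.map fun x => pointMeasure (seqZeros criticalCoeff x) := by
    rw [Measure.map_congr hcm, ha.conj.map_pointMeasure_seqZeros hcc h0]
  have hfin : ∀ᵐ ω ∂P, ∀ K : Set ℂ, IsCompact K →
      (criticalPoints (bargmannTheta (whiteNoise a ω)) ∩ K).Finite := by
    filter_upwards [hcrit, ha.conj.ae_finite_seqZeros hcc h0] with ω h1 h2
    rwa [h1]
  refine ⟨?_, fun θ => ⟨differentiable_bargmannTheta θ, fun z => ?_⟩, hfin, ?_, ?_, ?_⟩
  · filter_upwards [ha.ae_of_ae_seqLaw ae_memℓp_seqLaw] with ω hω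
    exact (hasSum_whiteNoise hω).summable
  · rw [bargmannTheta_eq_inner]
    exact tendsto_bargmann_comap θ z
  · have hp : planarCoeff 1 = fun k z => z * criticalCoeff k z :=
      funext fun k => funext fun z => planarCoeff_one k z
    have hpc : IsGAFCoeff (planarCoeff 1) := hp ▸ hcc.mul differentiable_id
    -- The base point is `1` since the planar function vanishes at the origin.
    have hp1 : gafVar (planarCoeff 1) 1 ≠ 0 := by
      rw [hp, gafVar_mul (g := fun z => z)]
      simpa using gafVar_criticalCoeff_ne_zero 1
    have hz : (fun ω' => pointMeasure (randomZeros P' (gaf (planarCoeff 1) b) ω')) =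
        fun ω' => pointMeasure (seqZeros (planarCoeff 1) fun k => b k ω') :=
      funext fun ω' => by rw [randomZeros_gaf hb hpc]
    rw [hz]
    refine ⟨hcmeas, hb.aemeasurable_pointMeasure_seqZeros hpc hp1, ?_⟩
    rw [hcmap, hb.map_pointMeasure_seqZeros hpc hp1]
    refine Measure.map_congr ?_
    filter_upwards [ae_seqZeros_mul hcc differentiable_id ⟨1, one_ne_zero⟩] with x hx
    rw [hp, ← hx]
    rfl
  · refine isFirstIntensity_of_bind_eq hfin hcmeas ?_
    rw [Measure.bind, hcmap, ← meanZeros_criticalCoeff]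
    rfl
  · intro Ω'' _ Q _ c Ψ hc hΨ hI
    have hz : randomZeros Q (gaf Ψ c) = fun ω => seqZeros Ψ fun k => c k ω :=
      funext fun ω => randomZeros_gaf hc hΨ ω
    rw [hz] at hI ⊢
    obtain ⟨w, hw⟩ := exists_gafVar_ne_zero_of_isFirstIntensity hI
    have hmeas := hc.aemeasurable_pointMeasure_seqZeros hΨ hw
    refine ⟨hmeas, hcmeas, ?_⟩
    rw [hcmap, hc.map_pointMeasure_seqZeros hΨ hw]
    -- Rigidity needs a common point of nonzero variance; any `w` good for `Ψ` works, as the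
    -- variance of `criticalCoeff` is positive everywhere.
    refine map_pointMeasure_seqZeros_eq_of_meanZeros_eq hΨ hcc ?_ hw
      (gafVar_criticalCoeff_ne_zero w)
    rw [meanZeros_criticalCoeff, ← hc.bind_pointMeasure_seqZeros hΨ hw]
    exact bind_eq_of_isFirstIntensity (hc.ae_finite_seqZeros hΨ hw) hmeas hI
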